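/- Let $K$ be an algebraically closed field which is complete with respect to a non-trivial non-archimedean absolute value $|\cdot|$, let $d\ge 2$ be an integer, and assume that $\operatorname{char}K=0$ or $\operatorname{char}K>d$. Let $\phi\in K(z)$ be a rational function of degree $d$, with a fixed point $\gamma\in\mathbb{P}^1(K)$ of multiplier $\lambda$ (that is, $\lambda=\phi'(\gamma)$, computed in a coordinate in which $\gamma\neq\infty$). Suppose that $$0<|\lambda|<|\deg_{\zeta,\vec v}\phi|^d$$ for every point $\zeta$ of the Berkovich projective line $\mathbb{P}^1_{\mathrm{Berk}}$ over $K$ and every direction $\vec v$ at $\zeta$. Here a direction at $\zeta$ is a connected component of $\mathbb{P}^1_{\mathrm{Berk}}\setminus\{\zeta\}$, the multiplicity $\deg_{\zeta,\vec v}\phi$ is the integer $m\ge 1$ such that $\phi$ maps every sufficiently thin open annulus that abuts $\zeta$ in the direction $\vec v$ everywhere $m$-to-one (counting multiplicity) onto its image, and $|\deg_{\zeta,\vec v}\phi|$ is the absolute value in $K$ of this integer. Then there is a disk $U\subseteq\mathbb{P}^1(K)$ containing $\gamma$ such that $\phi$ maps $U$ into itself injectively, $\phi^n(x)\to\gamma$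 as $n\to\infty$ for every $x\in U$, and $U$ contains a critical value of $\phi$ that is strictly attracted to $\gamma$: there is a critical point $c\in\mathbb{P}^1(K)$ of $\phi$ with $\phi(c)\in U$, $\phi^n(\phi(c))\to\gamma$, and $\phi^l(\phi(c))\ne\gamma$ for all $l\ge1$. (A disk in $\mathbb{P}^1(K)$ is an open or closed disk of positive radius in $K$, or the complement of one.) -/

import Mathlib

open Filter Topology Polynomial

noncomputable section

namespace BerkDyn

/-! ### Rational functions acting on the projective line

The projective line over `K` is modelled, as a set, by `OnePoint K`, the field together with one
extra point. (The topology that Mathlib puts on `OnePoint K` is not used: convergence is defined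
below by means of disks.) -/

section Algebraic

variable {K : Type*} [Field K]

/-- The degree of a rational function written in lowest terms `p / q`: the maximum of the degrees
of `p` and `q`. -/
def ratDegree (φ : RatFunc K) : ℕ := max φ.num.natDegree φ.denom.natDegree

open Classical in
/-- The map induced by a rational function on the projective line. With `φ = p / q` in lowest
terms and `d` the degree of `φ`, the value at infinity is read off from the coefficients of
degree `d`. -/
def ratEval (φ : RatFunc K) : OnePoint K → OnePoint K
  | OnePoint.some x =>
      if φ.denom.eval x = 0 then OnePoint.infty
      else OnePoint.some (φ.num.eval x / φ.denom.eval x)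
  | OnePoint.infty =>
      if φ.denom.coeff (ratDegree φ) = 0 then OnePoint.infty
      else OnePoint.some (φ.num.coeff (ratDegree φ) / φ.denom.coeff (ratDegree φ))

/-- For `φ = p / q` in lowest terms, the polynomial whose roots (together with infinity, with the
multiplicity given by the defect from `d = deg φ`) form the fibre of `φ` over `y`:
it is `p - y q` for finite `y`, and `q` for `y = ∞`. -/
def fiberPoly (φ : RatFunc K) : OnePoint K → K[X]
  | OnePoint.some y => φ.num - C y * φ.denom
  | OnePoint.infty => φ.denom

/-- The multiplicity of `x` as a solution of `φ(x) = y` (it is `0` if `φ(x) ≠ y`), for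
nonconstant `φ`. -/
def fiberMult (φ : RatFunc K) (y : OnePoint K) : OnePoint K → ℕ
  | OnePoint.some x => (fiberPoly φ y).rootMultiplicity x
  | OnePoint.infty => ratDegree φ - (fiberPoly φ y).natDegree

/-- `x` is a critical point of `φ`: it is a solution of `φ(·) = φ(x)` of multiplicity at
least two. (Equivalently, the derivative of `φ`, in local coordinates, vanishes at `x`.) -/
def IsCriticalPoint (φ : RatFunc K) (x : OnePoint K) : Prop := 2 ≤ fiberMult φ (ratEval φ x) x

/-- The value at `x` of the derivative of `p / q`, where `q(x) ≠ 0`. -/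
def derivQuot (p q : K[X]) (x : K) : K :=
  ((derivative p).eval x * q.eval x - p.eval x * (derivative q).eval x) / (q.eval x) ^ 2

/-- The multiplier of `φ` at a fixed point. At a finite fixed point it is the derivative. At a fixed
point at infinity it is the derivative at `0` of `1 / φ(1 / w)`, which is the quotient of the
reversed polynomials `w ^ d q(1 / w)` and `w ^ d p(1 / w)`, where `φ = p / q` in lowest terms has
degree `d`. -/
def multiplier (φ : RatFunc K) : OnePoint K → K
  | OnePoint.some x => derivQuot φ.num φ.denom x
  | OnePoint.infty => derivQuot (φ.denom.reflect (ratDegree φ)) (φ.num.reflect (ratDegree φ)) 0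

/-- `φ` maps `S` everywhere `m`-to-one onto its image `φ(S)`: every point of the image has exactly
`m` preimages in `S`, counted with multiplicity. -/
def MapsWithMult (φ : RatFunc K) (S : Set (OnePoint K)) (m : ℕ) : Prop :=
  ∀ y ∈ ratEval φ '' S, ∑ᶠ x ∈ S, fiberMult φ y x = m

end Algebraic

/-! ### Disks in the projective line and attraction -/

section Disks

variable {K : Type*} [NontriviallyNormedField K]

/-- The open disk of center `a` and radius `r` in `K`, as a subset of the projective line. -/
def finOpenDisk (a : K) (r : ℝ) : Set (OnePoint K) := OnePoint.some '' {x : K | ‖x - a‖ < r}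

/-- The closed disk of center `a` and radius `r` in `K`, as a subset of the projective line. -/
def finClosedDisk (a : K) (r : ℝ) : Set (OnePoint K) := OnePoint.some '' {x : K | ‖x - a‖ ≤ r}

/-- Open disks of the projective line: open disks in `K` and complements of closed disks. -/
def IsOpenDisk (U : Set (OnePoint K)) : Prop :=
  ∃ (a : K) (r : ℝ), 0 < r ∧ (U = finOpenDisk a r ∨ U = (finClosedDisk a r)ᶜ)

/-- Closed disks of the projective line: closed disks in `K` and complements of open disks. -/
def IsClosedDisk (U : Set (OnePoint K)) : Prop :=
  ∃ (a : K) (r : ℝ), 0 < r ∧ (U = finClosedDisk a r ∨ U = (finOpenDisk a r)ᶜ)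

/-- Disks of the projective line, open or closed. -/
def IsDisk (U : Set (OnePoint K)) : Prop := IsOpenDisk U ∨ IsClosedDisk U

/-- Convergence in the projective line over a non-archimedean field, whose topology has the open
disks as a basis. -/
def ConvergesTo (x : ℕ → OnePoint K) (γ : OnePoint K) : Prop :=
  ∀ U : Set (OnePoint K), IsOpenDisk U → γ ∈ U → ∀ᶠ n in atTop, x n ∈ U

/-- The fixed point `γ` attracts `x`: the iterates of `x` converge to `γ`. -/
def Attracts (φ : RatFunc K) (γ x : OnePoint K) : Prop :=
  ConvergesTo (fun n => (ratEval φ)^[n] x) γ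

/-- The fixed point `γ` strictly attracts `x`: the iterates of `x` converge to `γ` without ever
reaching it. -/
def StrictlyAttracts (φ : RatFunc K) (γ x : OnePoint K) : Prop :=
  Attracts φ γ x ∧ ∀ l : ℕ, 1 ≤ l → (ratEval φ)^[l] x ≠ γ

end Disks

/-! ### The Berkovich projective line -/

section Berkovich

/-- The Berkovich affine line over `K`: multiplicative seminorms on `K[z]` extending the absolute
value of `K`. -/
def BerkA1 (K : Type*) [NontriviallyNormedField K] : Type _ :=
  {ν : MulRingSeminorm K[X] // ∀ c : K, ν (C c) = ‖c‖}

variable {K : Type*} [NontriviallyNormedField K]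

/-- The topology of the Berkovich affine line is the coarsest one for which `ζ ↦ ‖f‖_ζ` is
continuous for every polynomial `f`. -/
instance : TopologicalSpace (BerkA1 K) :=
  TopologicalSpace.induced (fun (ζ : BerkA1 K) (f : K[X]) => ζ.1 f) inferInstance

/-- The Berkovich projective line: the one-point compactification of the (locally compact
Hausdorff) Berkovich affine line. -/
abbrev BerkP1 (K : Type*) [NontriviallyNormedField K] : Type _ := OnePoint (BerkA1 K)

/-- The type I point of the Berkovich affine line given by `x : K`, that is, the seminorm
`f ↦ ‖f(x)‖`. -/
def typeI (x : K) : BerkA1 K :=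
  ⟨{ toFun := fun f => ‖f.eval x‖
     map_zero' := by simp
     add_le' := fun f g => by simpa using norm_add_le (f.eval x) (g.eval x)
     neg' := fun f => by simp
     map_one' := by simp
     map_mul' := fun f g => by simp }, fun c => by
      change ‖(C c).eval x‖ = ‖c‖
      simp⟩

/-- The inclusion of the projective line in the Berkovich projective line, as the set of points of
type I. -/
def toBerk : OnePoint K → BerkP1 K := OnePoint.map typeI

/-- The connected component containing `ξ` of the complement of `ζ` (for `ξ ≠ ζ`): the tangent
direction at `ζ` that contains `ξ`. -/
def component (ζ ξ : BerkP1 K) : Set (BerkP1 K) := connectedComponentIn {ζ}ᶜ ξ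

/-- `v` is a tangent direction at `ζ`: a connected component of the complement of `ζ`. -/
def IsDirection (ζ : BerkP1 K) (v : Set (BerkP1 K)) : Prop :=
  ∃ ξ : BerkP1 K, ξ ≠ ζ ∧ v = component ζ ξ

/-- `ξ` lies strictly between `ζ` and `η`: it differs from both, and it separates them. -/
def StrictlyBetween (ζ η ξ : BerkP1 K) : Prop :=
  ξ ≠ ζ ∧ ξ ≠ η ∧ η ∉ component ξ ζ

/-- The open annulus between two distinct points `ζ` and `ξ` of the Berkovich line: the
points of the projective line that lie both in the direction of `ξ` at `ζ` and in the direction of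
`ζ` at `ξ`. For instance, between `ζ(a, r)` and `ζ(a, s)`, with `0 < r < s`, it is
`{x | r < ‖x - a‖ < s}`. -/
def annulus (ζ ξ : BerkP1 K) : Set (OnePoint K) :=
  {x | toBerk x ∈ component ζ ξ ∧ toBerk x ∈ component ξ ζ}

/-- `φ` has multiplicity `m` at `ζ` in the direction `v`: all sufficiently thin annuli
in the direction `v` that abut `ζ` are mapped everywhere `m`-to-one onto their images. The annuli
abutting `ζ` in the direction `v` are those between `ζ` and a point `ξ` of the open segment from
`ζ` to a point `η` of `v`, and they are thin when `η` is close to `ζ`. -/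
def HasDirectionalDegree (φ : RatFunc K) (ζ : BerkP1 K) (v : Set (BerkP1 K)) (m : ℕ) : Prop :=
  ∃ η ∈ v, ∀ ξ : BerkP1 K, StrictlyBetween ζ η ξ → MapsWithMult φ (annulus ζ ξ) m

end Berkovich

end BerkDyn

end

open Filter Topology Polynomial

noncomputable section

namespace BerkDyn

/-! ### Non-archimedean fields -/

section Ultrametric

variable {K : Type*} [NontriviallyNormedField K] [IsUltrametricDist K]

/-! Put the fixed point at infinity, so that the map is `A / B` with deg A = d, deg B = d - 1, and
the multiplier has size L = |lead B| / |lead A|. Fix a pole `a`, replace `A` by `A - a B`, and let S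
be the set of zeros and poles of the new A / B and ρ the largest distance from `a` to a point of S.
Where |z - a| > ρ, the map is one-to-one and its value is at distance |z - a| / L from `a`. The
hypothesis for multiplicity 1 gives L < 1, so the outside of the disk, together with infinity, is an
invariant disk U whose finite points escape to infinity without reaching it
(`AnnulusBound.injective_of_far`). What is missing is a critical point v with |A(v)| > ρ |B(v)|,
since its value is then a finite point of U.

Suppose there is none (`AnnulusBound.exists_root_logNumerator`). Let V be the numerator of the
logarithmic derivative ∑ ν_s / (X - s) of B / A. Compare it with the numerator H of a form ∑ u_s /
(X - s) whose coefficients have all nonempty subset sums of norm 1, and which vanishes at a point h₀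
at distance ρ from every point of S. Take a generic y with |y| slightly below 1 / ρ and set G = B -
y A, of degree d. V and H have equal degree and unimodular leading coefficients, so by the symmetry
of the resultant (`prod_norm_eval_roots`) products of |V| and |H| over the zeros of G become
products of |G| over the zeros of V and H. On zeros of V, |G| = |B| by assumption. The product of
|B| over zeros of V is at most the one over zeros of H, because |V| ≤ |H| at the zeros of B. On
zeros of H, |B| ≤ |G|, with a gain by the factor ρ |y| / L at h₀. Hence some zero x of G satisfies ρ
|y| |V(x)|^d ≤ L |H(x)|^d.

Let s₀ be the point of S nearest to x. Genericity of u gives |H(x)| = ∏ |x - s| / |x - s₀|, while a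
residue estimate on the circle about s₀ through x gives |m| |H(x)| ≤ |V(x)|, where ±m is the total
order of B / A inside that circle (`norm_sum_filter_mul_le`). As m is also the multiplicity of A / B
on an annulus, L < |m|^d, and this contradicts the previous inequality once ρ |y| is close to 1.

The Berkovich hypothesis is needed only at points given by disks: the directions there cut out round
annuli (`annulus_berkPoint`, `exists_direction_of_mapsWithMult`), on which multiplicities are found
by counting zeros (`countP_roots_sub`). -/

theorem norm_sub_le_max (x y : K) : ‖x - y‖ ≤ max ‖x‖ ‖y‖ := by
  simpa [sub_eq_add_neg] using IsUltrametricDist.norm_add_le_max x (-y)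

theorem norm_sub_eq_left {x y : K} (h : ‖y‖ < ‖x‖) : ‖x - y‖ = ‖x‖ := by
  have := IsUltrametricDist.norm_add_eq_max_of_norm_ne_norm (x := x) (y := -y)
    (by rw [norm_neg]; exact h.ne')
  rw [sub_eq_add_neg, this, norm_neg, max_eq_left h.le]

theorem norm_sub_eq_right {x y : K} (h : ‖x‖ < ‖y‖) : ‖x - y‖ = ‖y‖ := by
  rw [norm_sub_rev, norm_sub_eq_left h]

theorem norm_add_eq_left {x y : K} (h : ‖y‖ < ‖x‖) : ‖x + y‖ = ‖x‖ := by
  have := norm_sub_eq_left (x := x) (y := -y) (by rwa [norm_neg])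
  rwa [sub_neg_eq_add] at this

theorem norm_sub_eq_max_of_center {x a c : K} (h : ‖x - c‖ ≠ ‖a - c‖) :
    ‖x - a‖ = max ‖x - c‖ ‖a - c‖ := by
  rw [← sub_sub_sub_cancel_right x a c]
  rcases lt_or_gt_of_ne h with h | h
  · rw [norm_sub_eq_right h, max_eq_right h.le]
  · rw [norm_sub_eq_left h, max_eq_left h.le]

theorem norm_sum_lt {ι : Type*} {s : Finset ι} {f : ι → K} {C : ℝ} (hC : 0 < C)
    (h : ∀ i ∈ s, ‖f i‖ < C) : ‖∑ i ∈ s, f i‖ < C := by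
  rcases s.eq_empty_or_nonempty with rfl | hs
  · simpa
  · obtain ⟨i, hi, hle⟩ := IsUltrametricDist.exists_norm_finsetSum_le_of_nonempty hs f
    exact hle.trans_lt (h i hi)

/-- Supplies arbitrarily large integers prime to the residue characteristic, the orders of the roots
of unity used for averaging in `norm_sum_filter_le_of_sphere`. -/
theorem exists_pos_forall_norm_mul_add_one (K : Type*) [NontriviallyNormedField K]
    [IsUltrametricDist K] : ∃ k : ℕ, 0 < k ∧ ∀ j : ℕ, ‖((k * j + 1 : ℕ) : K)‖ = 1 := by
  by_cases h : ∃ k : ℕ, 0 < k ∧ ‖(k : K)‖ < 1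
  · obtain ⟨k, hk, hk1⟩ := h
    refine ⟨k, hk, fun j => ?_⟩
    have h1 : ‖((k * j : ℕ) : K)‖ < ‖(1 : K)‖ := by
      rw [norm_one, Nat.cast_mul, norm_mul]
      have := IsUltrametricDist.norm_natCast_le_one K j
      nlinarith [norm_nonneg (k : K), norm_nonneg (j : K)]
    have := norm_add_eq_left h1
    rw [add_comm] at this
    rw [Nat.cast_add, Nat.cast_one, this, norm_one]
  · push Not at h
    refine ⟨1, one_pos, fun j => ?_⟩
    exact le_antisymm (IsUltrametricDist.norm_natCast_le_one K _) (h _ (by omega))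

variable [IsAlgClosed K]

omit [IsUltrametricDist K] in
-- The value group is dense: an n-th root of an element of norm above 1 has norm in (1, t / s) for
-- large n, and one of its integral powers lands in the interval.
theorem exists_norm_mem_Ioo {s t : ℝ} (hs : 0 ≤ s) (hst : s < t) :
    ∃ x : K, s < ‖x‖ ∧ ‖x‖ < t := by
  wlog hs0 : 0 < s generalizing s
  · obtain ⟨x, hx⟩ := this (s := (s + t) / 2) (by linarith) (by linarith) (by linarith)
    exact ⟨x, by linarith, hx.2⟩
  obtain ⟨c, hc⟩ := NormedField.exists_one_lt_norm K
  have hts : 1 < t / s := by rwa [one_lt_div hs0]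
  obtain ⟨n, hn⟩ := pow_unbounded_of_one_lt ‖c‖ hts
  have hn0 : n ≠ 0 := by
    rintro rfl
    simp at hn
    linarith
  obtain ⟨e, he⟩ := IsAlgClosed.exists_pow_nat_eq c (Nat.pos_of_ne_zero hn0)
  rw [← he, norm_pow] at hn hc
  have he1 : 1 < ‖e‖ := (one_lt_pow_iff_of_nonneg (norm_nonneg _) hn0).1 hc
  have he2 : ‖e‖ < t / s := lt_of_pow_lt_pow_left₀ n (by linarith) hn
  obtain ⟨k, hk1, hk2⟩ := exists_mem_Ico_zpow hs0 he1
  refine ⟨e ^ (k + 1), by rwa [norm_zpow], ?_⟩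
  rw [norm_zpow, zpow_add_one₀ (by linarith)]
  calc ‖e‖ ^ k * ‖e‖ ≤ s * ‖e‖ := by gcongr
    _ < s * (t / s) := by gcongr
    _ = t := by field_simp

omit [IsUltrametricDist K] in
theorem exists_norm_sub_mem_Ioo (c : K) {s t : ℝ} (hs : 0 ≤ s) (hst : s < t) :
    ∃ x : K, s < ‖x - c‖ ∧ ‖x - c‖ < t := by
  obtain ⟨x, hx⟩ := exists_norm_mem_Ioo (K := K) hs hst
  exact ⟨x + c, by simpa using hx⟩

/-- Finitely many residue classes do not exhaust the unit ball. -/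
theorem exists_norm_sub_eq_one (F : Finset K) (hF : ∀ c ∈ F, ‖c‖ ≤ 1) :
    ∃ u : K, ‖u‖ ≤ 1 ∧ ∀ c ∈ F, ‖u - c‖ = 1 := by
  classical
  set p : K[X] := (∏ c ∈ F, (X - C c)) * X with hp
  have hmon : p.Monic := (monic_prod_of_monic _ _ fun c _ => monic_X_sub_C c).mul monic_X
  have hdeg : 0 < p.natDegree := by
    rw [hp, natDegree_mul_X (monic_prod_of_monic _ _ fun c _ => monic_X_sub_C c).ne_zero]
    omega
  -- The product of all u - c and of u itself is made equal to 1. If |u| > 1, every factor has norm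
  -- |u|, which is impossible; so every factor has norm at most 1, hence exactly 1.
  obtain ⟨u, hu⟩ := IsAlgClosed.exists_root (p - C 1) (by
    rw [degree_sub_C (natDegree_pos_iff_degree_pos.1 hdeg)]
    exact (natDegree_pos_iff_degree_pos.1 hdeg).ne')
  have hu' : (∏ c ∈ F, (u - c)) * u = 1 := by
    simpa [hp, eval_prod, sub_eq_zero] using hu
  have hn : (∏ c ∈ F, ‖u - c‖) * ‖u‖ = 1 := by
    rw [← norm_prod, ← norm_mul, hu', norm_one]
  have hu1 : ‖u‖ ≤ 1 := by
    by_contra! h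
    have : ∀ c ∈ F, ‖u - c‖ = ‖u‖ := fun c hc => norm_sub_eq_left ((hF c hc).trans_lt h)
    rw [Finset.prod_congr rfl this, Finset.prod_const, ← pow_succ] at hn
    exact (one_lt_pow₀ h (Nat.succ_ne_zero _)).ne' hn
  have hc1 : ∀ c ∈ F, ‖u - c‖ ≤ 1 := fun c hc =>
    (norm_sub_le_max u c).trans (max_le hu1 (hF c hc))
  refine ⟨u, hu1, fun c hc => le_antisymm (hc1 c hc) ?_⟩
  rw [← Finset.mul_prod_erase F _ hc, mul_assoc] at hn
  have h1 : (∏ c ∈ F.erase c, ‖u - c‖) * ‖u‖ ≤ 1 :=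
    mul_le_one₀ (Finset.prod_le_one (fun _ _ => norm_nonneg _)
      fun i hi => hc1 i (Finset.mem_of_mem_erase hi)) (norm_nonneg _) hu1
  calc 1 = ‖u - c‖ * ((∏ c ∈ F.erase c, ‖u - c‖) * ‖u‖) := hn.symm
    _ ≤ ‖u - c‖ * 1 := by gcongr
    _ = ‖u - c‖ := mul_one _

/-- Each new coefficient is chosen outside the residue classes of the negatives of all subset sums
already present, including the empty sum. -/
theorem exists_forall_norm_sum_eq_one (S : Finset K) :
    ∃ u : K → K, ∀ T ⊆ S, T.Nonempty → ‖∑ s ∈ T, u s‖ = 1 := by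
  classical
  induction S using Finset.induction_on with
  | empty =>
    refine ⟨0, fun T hT hne => ?_⟩
    rw [Finset.subset_empty.1 hT] at hne
    simp at hne
  | insert p S hp ih =>
    obtain ⟨u, hu⟩ := ih
    have hle : ∀ T ⊆ S, ‖∑ s ∈ T, u s‖ ≤ 1 := fun T hT => by
      rcases T.eq_empty_or_nonempty with rfl | hne
      · simp
      · exact (hu T hT hne).le
    obtain ⟨μ, hμ, hμF⟩ := exists_norm_sub_eq_one (S.powerset.image fun T => -∑ s ∈ T, u s) (by
      intro c hc
      obtain ⟨T, hT, rfl⟩ := Finset.mem_image.1 hc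
      rw [norm_neg]
      exact hle T (Finset.mem_powerset.1 hT))
    refine ⟨Function.update u p μ, fun T hT hne => ?_⟩
    by_cases hpT : p ∈ T
    · have h1 : T.erase p ⊆ S := fun x hx => by
        have := hT (Finset.mem_of_mem_erase hx)
        exact (Finset.mem_insert.1 this).resolve_left (Finset.ne_of_mem_erase hx)
      rw [← Finset.add_sum_erase _ _ hpT, Function.update_self]
      have : ∑ x ∈ T.erase p, Function.update u p μ x = ∑ x ∈ T.erase p, u x :=
        Finset.sum_congr rfl fun x hx => Function.update_of_ne (Finset.ne_of_mem_erase hx) _ _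
      rw [this]
      simpa using hμF _ (Finset.mem_image_of_mem _ (Finset.mem_powerset.2 h1))
    · have hne' : ∀ x ∈ T, x ≠ p := fun x hx h => hpT (h ▸ hx)
      have h1 : T ⊆ S := fun x hx =>
        (Finset.mem_insert.1 (hT hx)).resolve_left (hne' x hx)
      have : ∑ x ∈ T, Function.update u p μ x = ∑ x ∈ T, u x :=
        Finset.sum_congr rfl fun x hx => Function.update_of_ne (hne' x hx) _ _
      rw [this]
      exact hu T h1 hne

end Ultrametric

/-! ### Logarithmic forms: generic coefficients and a residue estimate -/

section LogForms

variable {K : Type*} [NontriviallyNormedField K] [IsUltrametricDist K]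

/-- A generic logarithmic form `∑ u s / (X - s)` has at `x` the size of the inverse of the distance
from `x` to the set of its poles. -/
theorem norm_sum_div_eq_of_generic {S : Finset K} {u : K → K}
    (hu : ∀ T ⊆ S, T.Nonempty → ‖∑ s ∈ T, u s‖ = 1) {x s₀ : K} (hs₀ : s₀ ∈ S) (hx : x ≠ s₀)
    (hmin : ∀ s ∈ S, ‖x - s₀‖ ≤ ‖x - s‖) (hgen : ∀ s ∈ S, ‖s - s₀‖ ≠ ‖x - s₀‖) :
    ‖∑ s ∈ S, u s / (x - s)‖ = 1 / ‖x - s₀‖ := by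
  classical
  set r := ‖x - s₀‖ with hr
  have hr0 : 0 < r := norm_pos_iff.2 (sub_ne_zero.2 hx)
  have hus : ∀ s ∈ S, ‖u s‖ = 1 := fun s hs => by
    simpa using hu {s} (Finset.singleton_subset_iff.2 hs) (Finset.singleton_nonempty s)
  -- Only the poles closer to `s₀` than `x` matter: replacing their denominators by `x - s₀` costs
  -- strictly less than `1 / r`, and the farther poles contribute strictly less than `1 / r`.
  set T := S.filter fun s => ‖s - s₀‖ < r with hT
  have hs₀T : s₀ ∈ T := by simp [hT, hs₀, hr0]
  have hmain : ‖(∑ s ∈ T, u s) / (x - s₀)‖ = 1 / r := by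
    rw [norm_div, hu T (Finset.filter_subset _ _) ⟨s₀, hs₀T⟩]
  have herr : ‖∑ s ∈ S, (u s / (x - s) - if s ∈ T then u s / (x - s₀) else 0)‖ < 1 / r := by
    refine norm_sum_lt (by positivity) fun s hs => ?_
    have hxs : 0 < ‖x - s‖ := hr0.trans_le (hmin s hs)
    have hxs0 : x - s ≠ 0 := norm_pos_iff.1 hxs
    by_cases h : s ∈ T
    · have hlt : ‖s - s₀‖ < r := (Finset.mem_filter.1 h).2
      rw [if_pos h]
      have : u s / (x - s) - u s / (x - s₀) = u s * (s - s₀) / ((x - s) * (x - s₀)) := by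
        have : x - s₀ ≠ 0 := sub_ne_zero.2 hx
        field_simp
        ring
      rw [this, norm_div, norm_mul, norm_mul, hus s hs, ← hr, one_mul, div_lt_div_iff₀
        (by positivity) hr0]
      nlinarith [hmin s hs]
    · have hlt : r < ‖s - s₀‖ := by
        rcases lt_or_gt_of_ne (hgen s hs) with h' | h'
        · exact absurd (Finset.mem_filter.2 ⟨hs, h'⟩) h
        · exact h'
      rw [if_neg h, sub_zero, norm_div, hus s hs]
      have : ‖x - s‖ = ‖s - s₀‖ := by
        rw [norm_sub_eq_max_of_center (c := s₀) (hgen s hs).symm, max_eq_right hlt.le]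
      rw [this]
      exact one_div_lt_one_div_of_lt hr0 hlt
  have hsplit : ∑ s ∈ S, u s / (x - s) = (∑ s ∈ T, u s) / (x - s₀) +
      ∑ s ∈ S, (u s / (x - s) - if s ∈ T then u s / (x - s₀) else 0) := by
    rw [Finset.sum_sub_distrib, ← Finset.sum_filter, Finset.sum_div]
    have : S.filter (· ∈ T) = T := by
      ext s
      simp only [Finset.mem_filter, hT]
      tauto
    rw [this]
    ring
  rw [hsplit, norm_add_eq_left (by rwa [hmain]), hmain]

variable [IsAlgClosed K]

/-- All coefficients except those at `p` and `q` are chosen generically; the one at `q` is a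
parameter `μ`, and vanishing at `h₀` then forces the one at `p` to be `-(κ μ + w)`. Since `p` and
`q` are in different residue classes at scale `ρ`, both `κ` and `1 - κ` are units, so genericity
excludes only finitely many classes of `μ`. -/
theorem exists_forall_norm_sum_eq_one_of_sum_eq_zero {S : Finset K} {p q h₀ : K} {ρ : ℝ}
    (hρ : 0 < ρ) (hp : p ∈ S) (hq : q ∈ S) (hpq : ‖p - q‖ = ρ) (hh : ∀ s ∈ S, ‖h₀ - s‖ = ρ) :
    ∃ u : K → K, (∀ T ⊆ S, T.Nonempty → ‖∑ s ∈ T, u s‖ = 1) ∧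
      ∑ s ∈ S, u s / (h₀ - s) = 0 := by
  classical
  have hh0 : ∀ s ∈ S, h₀ - s ≠ 0 := fun s hs => norm_pos_iff.1 (by rw [hh s hs]; exact hρ)
  have hpq' : p ≠ q := by
    rintro rfl
    simp at hpq
    linarith
  set S' := (S.erase p).erase q with hS'
  have hqS : q ∈ S.erase p := Finset.mem_erase.2 ⟨hpq'.symm, hq⟩
  have hpS' : p ∉ S' := by simp [hS']
  have hqS' : q ∉ S' := by simp [hS']
  have hS'S : S' ⊆ S := (Finset.erase_subset _ _).trans (Finset.erase_subset _ _)
  obtain ⟨v, hv⟩ := exists_forall_norm_sum_eq_one S'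
  have hv1 : ∀ s ∈ S', ‖v s‖ = 1 := fun s hs => by
    simpa using hv {s} (Finset.singleton_subset_iff.2 hs) (Finset.singleton_nonempty s)
  have hle : ∀ T ⊆ S', ‖∑ s ∈ T, v s‖ ≤ 1 := fun T hT => by
    rcases T.eq_empty_or_nonempty with rfl | hne
    · simp
    · exact (hv T hT hne).le
  set w := ∑ s ∈ S', (h₀ - p) * (v s / (h₀ - s)) with hw
  have hw1 : ‖w‖ ≤ 1 := by
    refine IsUltrametricDist.norm_sum_le_of_forall_le_of_nonneg zero_le_one fun s hs => ?_
    rw [norm_mul, norm_div, hh _ hp, hh _ (hS'S hs), hv1 s hs]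
    field_simp
    exact le_rfl
  set κ := (h₀ - p) / (h₀ - q) with hκ
  have hκ1 : ‖κ‖ = 1 := by rw [hκ, norm_div, hh _ hp, hh _ hq, div_self hρ.ne']
  have hκ0 : κ ≠ 0 := norm_pos_iff.1 (by rw [hκ1]; exact one_pos)
  have hκ2 : ‖1 - κ‖ = 1 := by
    have : 1 - κ = (p - q) / (h₀ - q) := by
      rw [hκ]
      have := hh0 q hq
      field_simp
      ring
    rw [this, norm_div, hpq, hh _ hq, div_self hρ.ne']
  have hκ3 : 1 - κ ≠ 0 := norm_pos_iff.1 (by rw [hκ2]; exact one_pos)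
  -- The three excluded families treat the subsets containing `q` only, `p` only, and both.
  obtain ⟨μ, hμ, hμF⟩ := exists_norm_sub_eq_one
    (S'.powerset.image (fun T => -∑ s ∈ T, v s) ∪
      (S'.powerset.image (fun T => (∑ s ∈ T, v s - w) / κ) ∪
        S'.powerset.image (fun T => (w - ∑ s ∈ T, v s) / (1 - κ)))) (by
    intro c hc
    simp only [Finset.mem_union, Finset.mem_image, Finset.mem_powerset] at hc
    rcases hc with ⟨T, hT, rfl⟩ | ⟨T, hT, rfl⟩ | ⟨T, hT, rfl⟩
    · rw [norm_neg]
      exact hle T hT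
    · rw [norm_div, hκ1, div_one]
      exact (norm_sub_le_max _ _).trans (max_le (hle T hT) hw1)
    · rw [norm_div, hκ2, div_one]
      exact (norm_sub_le_max _ _).trans (max_le hw1 (hle T hT)))
  have hF1 : ∀ T ⊆ S', ‖μ + ∑ s ∈ T, v s‖ = 1 := fun T hT => by
    have := hμF (-∑ s ∈ T, v s) (Finset.mem_union_left _
      (Finset.mem_image_of_mem _ (Finset.mem_powerset.2 hT)))
    rwa [sub_neg_eq_add] at this
  have hF2 : ∀ T ⊆ S', ‖-(κ * μ + w) + ∑ s ∈ T, v s‖ = 1 := fun T hT => by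
    have := hμF ((∑ s ∈ T, v s - w) / κ) (Finset.mem_union_right _ (Finset.mem_union_left _
      (Finset.mem_image_of_mem _ (Finset.mem_powerset.2 hT))))
    rw [← this, show -(κ * μ + w) + ∑ s ∈ T, v s = -(κ * (μ - (∑ s ∈ T, v s - w) / κ)) by
      field_simp; ring, norm_neg, norm_mul, hκ1, one_mul]
  have hF3 : ∀ T ⊆ S', ‖-(κ * μ + w) + (μ + ∑ s ∈ T, v s)‖ = 1 := fun T hT => by
    have := hμF ((w - ∑ s ∈ T, v s) / (1 - κ)) (Finset.mem_union_right _
      (Finset.mem_union_right _ (Finset.mem_image_of_mem _ (Finset.mem_powerset.2 hT))))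
    rw [← this, show -(κ * μ + w) + (μ + ∑ s ∈ T, v s) =
      (1 - κ) * (μ - (w - ∑ s ∈ T, v s) / (1 - κ)) by
      field_simp; ring, norm_mul, hκ2, one_mul]
  set u := Function.update (Function.update v q μ) p (-(κ * μ + w)) with hu
  have hup : u p = -(κ * μ + w) := Function.update_self _ _ _
  have huq : u q = μ := by
    rw [hu, Function.update_of_ne hpq'.symm, Function.update_self]
  have hus : ∀ s, s ≠ p → s ≠ q → u s = v s := fun s h1 h2 => by
    rw [hu, Function.update_of_ne h1, Function.update_of_ne h2]
  have hsum : ∀ T ⊆ S', ∑ s ∈ T, u s = ∑ s ∈ T, v s := fun T hT =>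
    Finset.sum_congr rfl fun s hs => hus s (fun h => hpS' (h ▸ hT hs)) fun h => hqS' (h ▸ hT hs)
  refine ⟨u, fun T hT hne => ?_, ?_⟩
  · have hsub : (T.erase p).erase q ⊆ S' :=
      Finset.erase_subset_erase _ (Finset.erase_subset_erase _ hT)
    by_cases h1 : p ∈ T <;> by_cases h2 : q ∈ T
    · rw [← Finset.add_sum_erase _ _ h1,
        ← Finset.add_sum_erase _ _ (Finset.mem_erase.2 ⟨hpq'.symm, h2⟩), hsum _ hsub, hup, huq]
      exact hF3 _ hsub
    · have h3 : (T.erase p).erase q = T.erase p := Finset.erase_eq_of_notMem (by simp [h2])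
      rw [h3] at hsub
      rw [← Finset.add_sum_erase _ _ h1, hsum _ hsub, hup]
      exact hF2 _ hsub
    · rw [Finset.erase_eq_of_notMem h1] at hsub
      rw [← Finset.add_sum_erase _ _ h2, hsum _ hsub, huq]
      exact hF1 _ hsub
    · rw [Finset.erase_eq_of_notMem h1, Finset.erase_eq_of_notMem h2] at hsub
      rw [hsum _ hsub]
      exact hv _ hsub hne
  · rw [← Finset.add_sum_erase _ _ hp, ← Finset.add_sum_erase _ _ hqS, hup, huq, ← hS']
    have : ∑ s ∈ S', u s / (h₀ - s) = w / (h₀ - p) := by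
      rw [hw, Finset.sum_div]
      refine Finset.sum_congr rfl fun s hs => ?_
      rw [hus s (fun h => hpS' (h ▸ hs)) fun h => hqS' (h ▸ hs)]
      have := hh0 p hp
      field_simp
    rw [this, hκ]
    have h1 := hh0 p hp
    have h2 := hh0 q hq
    field_simp
    ring

omit [IsUltrametricDist K] in
-- This is the logarithmic derivative of `X ^ n - z ^ n` at `a`, rewritten by means of ζz / (ζz - a)
-- = 1 - a / (a - ζz).
theorem sum_nthRoots_div_sub {n : ℕ} (hn : (n : K) ≠ 0) {a z : K} (haz : a ^ n ≠ z ^ n) :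
    ∑ ζ ∈ nthRootsFinset n (1 : K), ζ * z / (ζ * z - a) = n * (z ^ n / (z ^ n - a ^ n)) := by
  classical
  have hn0 : 0 < n := Nat.pos_of_ne_zero (by rintro rfl; simp at hn)
  have : NeZero (n : K) := ⟨hn⟩
  obtain ⟨ξ, hξ⟩ := HasEnoughRootsOfUnity.exists_primitiveRoot K n
  set p : K[X] := X ^ n - C (z ^ n) with hp
  have hprod : ∏ ζ ∈ nthRootsFinset n (1 : K), (X - C (ζ * z)) = p := by
    refine Polynomial.funext fun x => ?_
    rw [eval_prod, hp]
    simp only [eval_sub, eval_X, eval_C, eval_pow]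
    rw [hξ.pow_sub_pow_eq_prod_sub_mul _ _ hn0]
  have hroots : p.roots = (nthRootsFinset n (1 : K)).val.map fun ζ => ζ * z := by
    rw [← hprod, Finset.prod_eq_multiset_prod]
    have := roots_multiset_prod_X_sub_C ((nthRootsFinset n (1 : K)).val.map fun ζ => ζ * z)
    rwa [Multiset.map_map] at this
  have hpa : p.eval a ≠ 0 := by simpa [hp, sub_eq_zero] using haz
  have hld := (IsAlgClosed.splits p).eval_derivative_div_eval_of_ne_zero hpa
  rw [hroots, Multiset.map_map] at hld
  have hld' : n * a ^ (n - 1) / (a ^ n - z ^ n) =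
      ∑ ζ ∈ nthRootsFinset n (1 : K), 1 / (a - ζ * z) := by
    have hder : p.derivative.eval a = n * a ^ (n - 1) := by
      rw [hp, derivative_sub, derivative_C, derivative_X_pow]
      simp
    have heval : p.eval a = a ^ n - z ^ n := by
      rw [hp, eval_sub, eval_C, eval_pow, eval_X]
    rwa [hder, heval] at hld
  have hne : ∀ ζ ∈ nthRootsFinset n (1 : K), ζ * z - a ≠ 0 := fun ζ hζ h => haz (by
    rw [← sub_eq_zero.1 h, mul_pow, (mem_nthRootsFinset hn0 1).1 hζ, one_mul])
  have hterm : ∑ ζ ∈ nthRootsFinset n (1 : K), ζ * z / (ζ * z - a) =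
      ∑ ζ ∈ nthRootsFinset n (1 : K), (1 - a * (1 / (a - ζ * z))) := by
    refine Finset.sum_congr rfl fun ζ hζ => ?_
    have h1 := hne ζ hζ
    have h2 : a - ζ * z ≠ 0 := by rw [← neg_sub]; exact neg_ne_zero.2 h1
    rw [div_eq_iff h1]
    field_simp
    ring
  rw [hterm, Finset.sum_sub_distrib, ← Finset.mul_sum, ← hld', Finset.sum_const,
    hξ.card_nthRootsFinset, nsmul_eq_mul, mul_one]
  have h1 : a ^ n - z ^ n ≠ 0 := sub_ne_zero.2 haz
  have h2 : z ^ n - a ^ n ≠ 0 := sub_ne_zero.2 haz.symm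
  have h3 : a * (n * a ^ (n - 1) / (a ^ n - z ^ n)) = n * a ^ n / (a ^ n - z ^ n) := by
    rw [mul_div_assoc', mul_left_comm, mul_pow_sub_one hn0.ne']
  rw [h3, eq_comm, mul_div_assoc', div_eq_iff h2, sub_mul, div_mul_eq_mul_div, eq_sub_iff_add_eq,
    ← sub_eq_zero]
  field_simp
  ring

/-- The size of the residue of `∑ ν s / (X - s)` in a disk is bounded by the values on the
boundary circle. -/
theorem norm_sum_filter_le_of_sphere {S : Finset K} {ν : K → K} {s₀ : K} {r C : ℝ} {x : K}
    (hr : 0 < r) (hxr : ‖x - s₀‖ = r) (hgen : ∀ s ∈ S, ‖s - s₀‖ ≠ r)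
    (hC : ∀ x' : K, ‖x' - s₀‖ = r → ‖∑ s ∈ S, ν s / (x' - s)‖ ≤ C) :
    ‖∑ s ∈ S with ‖s - s₀‖ < r, ν s‖ ≤ r * C := by
  classical
  obtain ⟨k, hk, hk1⟩ := exists_pos_forall_norm_mul_add_one K
  set z := x - s₀ with hz
  have hz0 : z ≠ 0 := norm_pos_iff.1 (by rw [hxr]; exact hr)
  have hC0 : 0 ≤ C := (norm_nonneg _).trans (hC x hxr)
  set N : ℕ → ℕ := fun j => k * j + 1 with hN
  have hNtop : Tendsto N atTop atTop := by
    refine tendsto_atTop_mono (fun j => ?_) tendsto_id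
    simp only [hN, id]
    nlinarith
  set a : ℕ → K := fun j => ∑ s ∈ S, ν s * (z ^ N j / (z ^ N j - (s - s₀) ^ N j)) with ha
  have hpow : ∀ s ∈ S, ∀ n : ℕ, n ≠ 0 → (s - s₀) ^ n ≠ z ^ n := fun s hs n hn h => by
    have := congrArg norm h
    rw [norm_pow, norm_pow, pow_left_inj₀ (norm_nonneg _) (norm_nonneg _) hn] at this
    exact hgen s hs (this.trans hxr)
  have hbound : ∀ j, ‖a j‖ ≤ r * C := fun j => by
    have hNj : ((N j : ℕ) : K) ≠ 0 := norm_pos_iff.1 (by rw [hN, hk1]; exact one_pos)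
    have hNj0 : 0 < N j := by simp [hN]
    -- A discrete contour integral: the form times the distance vector to `s₀`, summed over the
    -- rotations of `x` by roots of unity of order `N j`, where `N j` is a unit.
    have key : (N j : K) * a j = ∑ ζ ∈ nthRootsFinset (N j) (1 : K),
        (ζ * z) * ∑ s ∈ S, ν s / ((s₀ + ζ * z) - s) := by
      simp only [Finset.mul_sum]
      rw [Finset.sum_comm, ha, Finset.mul_sum]
      refine Finset.sum_congr rfl fun s hs => ?_
      rw [mul_left_comm, ← sum_nthRoots_div_sub hNj (hpow s hs _ hNj0.ne'), Finset.mul_sum]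
      refine Finset.sum_congr rfl fun ζ _ => ?_
      rw [show s₀ + ζ * z - s = ζ * z - (s - s₀) by ring]
      ring
    have h1 : ‖a j‖ = ‖(N j : K) * a j‖ := by rw [norm_mul, hN, hk1, one_mul]
    rw [h1, key]
    refine IsUltrametricDist.norm_sum_le_of_forall_le_of_nonneg (by positivity) fun ζ hζ => ?_
    have hζ1 : ‖ζ‖ = 1 := by
      have h := congrArg norm ((mem_nthRootsFinset hNj0 1).1 hζ)
      rw [norm_pow, norm_one] at h
      exact (pow_eq_one_iff_of_nonneg (norm_nonneg _) hNj0.ne').1 h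
    have h2 : ‖ζ * z‖ = r := by rw [norm_mul, hζ1, one_mul, hxr]
    rw [norm_mul, h2]
    gcongr
    exact hC _ (by simpa using h2)
  -- The weight z^N / (z^N - (s - s₀)^N) tends to 1 for poles inside the circle and to 0 for poles
  -- outside, so the average converges to the sum of the residues inside.
  have hlim : Tendsto a atTop (𝓝 (∑ s ∈ S, if ‖s - s₀‖ < r then ν s else 0)) := by
    refine tendsto_finsetSum _ fun s hs => ?_
    split_ifs with h
    · have h1 : Tendsto (fun n : ℕ => 1 / (1 - ((s - s₀) / z) ^ n)) atTop (𝓝 (1 / (1 - 0))) := by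
        refine tendsto_const_nhds.div (tendsto_const_nhds.sub ?_) (by simp)
        refine tendsto_pow_atTop_nhds_zero_of_norm_lt_one ?_
        rw [norm_div, hxr, div_lt_one hr]
        exact h
      have h2 := (h1.comp hNtop).const_mul (ν s)
      simp only [sub_zero, div_one, mul_one] at h2
      refine h2.congr fun j => ?_
      have hne : z ^ N j - (s - s₀) ^ N j ≠ 0 :=
        sub_ne_zero.2 (hpow s hs (N j) (by simp [hN])).symm
      have hne' : z ^ N j ≠ 0 := pow_ne_zero _ hz0
      simp only [Function.comp_apply]
      rw [div_pow, one_sub_div hne', one_div_div]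
    · have hlt : r < ‖s - s₀‖ := lt_of_le_of_ne (not_lt.1 h) (hgen s hs).symm
      have hs0 : s - s₀ ≠ 0 := norm_pos_iff.1 (hr.trans hlt)
      have hlim0 : Tendsto (fun n : ℕ => (z / (s - s₀)) ^ n) atTop (𝓝 0) := by
        refine tendsto_pow_atTop_nhds_zero_of_norm_lt_one ?_
        rw [norm_div, hxr, div_lt_one (hr.trans hlt)]
        exact hlt
      have h1 : Tendsto (fun n : ℕ => (z / (s - s₀)) ^ n / ((z / (s - s₀)) ^ n - 1)) atTop
          (𝓝 (0 / (0 - 1))) :=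
        hlim0.div (hlim0.sub tendsto_const_nhds) (by simp)
      have h2 := (h1.comp hNtop).const_mul (ν s)
      simp only [zero_div, mul_zero] at h2
      refine h2.congr fun j => ?_
      have hne' : (s - s₀) ^ N j ≠ 0 := pow_ne_zero _ hs0
      simp only [Function.comp_apply]
      rw [div_pow, div_sub_one hne', div_div_div_cancel_right₀ hne']
  rw [Finset.sum_filter]
  exact le_of_tendsto hlim.norm (Eventually.of_forall hbound)

end LogForms

/-! ### Counting zeros of polynomials in annuli -/

section Counting

variable {K : Type*} [NontriviallyNormedField K] [IsUltrametricDist K]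

/-- The value at `P` of the seminorm of the disk of center `c` and radius `ρ`, when `P` splits. -/
def diskNorm (c : K) (ρ : ℝ) (P : K[X]) : ℝ :=
  ‖P.leadingCoeff‖ * (P.roots.map fun α => max ρ ‖α - c‖).prod

omit [IsUltrametricDist K] in
theorem diskNorm_pos {c : K} {ρ : ℝ} (hρ : 0 < ρ) {P : K[X]} (hP : P ≠ 0) :
    0 < diskNorm c ρ P := by
  refine mul_pos (norm_pos_iff.2 (leadingCoeff_ne_zero.2 hP)) (Multiset.prod_pos fun a ha => ?_)
  obtain ⟨α, -, rfl⟩ := Multiset.mem_map.1 ha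
  exact lt_max_of_lt_left hρ

omit [IsUltrametricDist K] in
open Classical in
theorem prod_max_of_annulus {m : Multiset K} {c : K} {s t ρ : ℝ}
    (hm : ∀ α ∈ m, ‖α - c‖ ≤ s ∨ t ≤ ‖α - c‖) (hs : s ≤ ρ) (ht : ρ ≤ t) :
    (m.map fun α => max ρ ‖α - c‖).prod =
      ((m.filter fun α => ¬ ‖α - c‖ < t).map fun α => ‖α - c‖).prod *
        ρ ^ m.countP (fun α => ‖α - c‖ < t) := by
  induction m using Multiset.induction_on with
  | empty => simp
  | cons a m ih =>
    have ih' := ih fun α hα => hm α (Multiset.mem_cons_of_mem hα)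
    rw [Multiset.map_cons, Multiset.prod_cons, ih']
    by_cases h : ‖a - c‖ < t
    · have hle : ‖a - c‖ ≤ s := (hm a (Multiset.mem_cons_self a m)).resolve_right (not_le.2 h)
      rw [Multiset.filter_cons_of_neg _ (by simpa using h),
        Multiset.countP_cons_of_pos (p := fun α => ‖α - c‖ < t) _ h, max_eq_left (by linarith)]
      ring
    · rw [Multiset.filter_cons_of_pos _ (by simpa using h),
        Multiset.countP_cons_of_neg (p := fun α => ‖α - c‖ < t) _ h,
        max_eq_right (by linarith [not_lt.1 h]), Multiset.map_cons, Multiset.prod_cons]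
      ring

omit [IsUltrametricDist K] in
open Classical in
/-- Between two radii without zeros in between, `diskNorm` is a monomial in the radius. -/
theorem exists_diskNorm_eq_mul_pow {G : K[X]} (hG : G ≠ 0) {c : K} {s t : ℝ} (ht : 0 < t)
    (hr : ∀ α ∈ G.roots, ‖α - c‖ ≤ s ∨ t ≤ ‖α - c‖) :
    ∃ D : ℝ, 0 < D ∧ ∀ ρ, s ≤ ρ → ρ ≤ t →
      diskNorm c ρ G = D * ρ ^ G.roots.countP (fun α => ‖α - c‖ < t) := by
  refine ⟨‖G.leadingCoeff‖ *
    ((G.roots.filter fun α => ¬ ‖α - c‖ < t).map fun α => ‖α - c‖).prod, ?_, fun ρ hs ht => ?_⟩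
  · refine mul_pos (norm_pos_iff.2 (leadingCoeff_ne_zero.2 hG)) ?_
    refine Multiset.prod_pos fun a ha => ?_
    obtain ⟨α, hα, rfl⟩ := Multiset.mem_map.1 ha
    have := (Multiset.mem_filter.1 hα).2
    linarith [not_lt.1 this]
  · rw [diskNorm, prod_max_of_annulus hr hs ht, mul_assoc]

variable [IsAlgClosed K]

omit [IsUltrametricDist K] in
theorem norm_eval_eq_prod_roots (G : K[X]) (x : K) :
    ‖G.eval x‖ = ‖G.leadingCoeff‖ * (G.roots.map fun α => ‖x - α‖).prod := by
  rw [(IsAlgClosed.splits G).eval_eq_prod_roots x, norm_mul]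
  congr 1
  rw [← coe_nnnorm, ← nnnormHom_apply, map_multiset_prod, Multiset.map_map]
  simp [NNReal.coe_multiset_prod, Multiset.map_map, Function.comp_def]

omit [IsUltrametricDist K] in
theorem norm_eval_eq_diskNorm {G : K[X]} {c x : K} {ρ : ℝ}
    (h : ∀ α ∈ G.roots, ‖x - α‖ = max ρ ‖α - c‖) : ‖G.eval x‖ = diskNorm c ρ G := by
  rw [norm_eval_eq_prod_roots, diskNorm, Multiset.map_congr rfl h]

theorem norm_eval_eq_diskNorm_of_ne {G : K[X]} {c x : K}
    (h : ∀ α ∈ G.roots, ‖α - c‖ ≠ ‖x - c‖) : ‖G.eval x‖ = diskNorm c ‖x - c‖ G :=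
  norm_eval_eq_diskNorm fun α hα => norm_sub_eq_max_of_center (h α hα).symm

open Classical in
/-- On an annulus without zeros the norm of a polynomial is a monomial in the radius. -/
theorem exists_norm_eval_eq_mul_pow {G : K[X]} (hG : G ≠ 0) {c : K} {s t : ℝ} (ht : 0 < t)
    (hr : ∀ α ∈ G.roots, ‖α - c‖ ≤ s ∨ t ≤ ‖α - c‖) :
    ∃ D : ℝ, 0 < D ∧ ∀ x : K, s < ‖x - c‖ → ‖x - c‖ < t →
      ‖G.eval x‖ = D * ‖x - c‖ ^ G.roots.countP (fun α => ‖α - c‖ < t) := by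
  obtain ⟨D, hD, h⟩ := exists_diskNorm_eq_mul_pow hG ht hr
  refine ⟨D, hD, fun x hx hxt => ?_⟩
  rw [norm_eval_eq_diskNorm_of_ne, h _ hx.le hxt.le]
  intro α hα
  rcases hr α hα with h | h <;> intro h' <;> linarith

open Classical in
-- A positive norm excludes zeros in the annulus, so the norm is also a monomial with the number of
-- inner zeros as exponent; comparing the two monomials at two different radii identifies the
-- exponents.
theorem countP_roots_of_norm_eval {G : K[X]} {c : K} {s t D : ℝ} {k : ℕ} (hs : 0 ≤ s)
    (hst : s < t) (hD : 0 < D)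
    (h : ∀ x : K, s < ‖x - c‖ → ‖x - c‖ < t → ‖G.eval x‖ = D * ‖x - c‖ ^ k) :
    G.roots.countP (fun α => ‖α - c‖ < t) = k ∧
      ∀ α ∈ G.roots, ‖α - c‖ ≤ s ∨ t ≤ ‖α - c‖ := by
  obtain ⟨x₁, hx₁, hx₁'⟩ := exists_norm_sub_mem_Ioo c hs hst
  obtain ⟨x₂, hx₂, hx₂'⟩ := exists_norm_sub_mem_Ioo c (hs.trans hx₁.le) hx₁'
  have h1 : 0 < ‖x₁ - c‖ := hs.trans_lt hx₁
  have hG : G ≠ 0 := by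
    rintro rfl
    have := h x₁ hx₁ hx₁'
    rw [eval_zero, norm_zero] at this
    exact (mul_pos hD (pow_pos h1 k)).ne this
  have hroots : ∀ α ∈ G.roots, ‖α - c‖ ≤ s ∨ t ≤ ‖α - c‖ := by
    intro α hα
    by_contra! hcon
    have := h α hcon.1 hcon.2
    rw [(mem_roots'.1 hα).2.eq_zero, norm_zero] at this
    exact (mul_pos hD (pow_pos (hs.trans_lt hcon.1) k)).ne this
  refine ⟨?_, hroots⟩
  obtain ⟨E, hE, hEx⟩ := exists_norm_eval_eq_mul_pow hG (hs.trans_lt hst) hroots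
  set n := G.roots.countP (fun α => ‖α - c‖ < t)
  have e1 := (hEx x₁ hx₁ hx₁').symm.trans (h x₁ hx₁ hx₁')
  have e2 := (hEx x₂ (hx₁.trans hx₂) hx₂').symm.trans (h x₂ (hx₁.trans hx₂) hx₂')
  have e3 : (‖x₂ - c‖ / ‖x₁ - c‖) ^ n = (‖x₂ - c‖ / ‖x₁ - c‖) ^ k := by
    have hp1 := pow_pos h1 n
    have hp2 := pow_pos h1 k
    have : E * D * (‖x₂ - c‖ ^ n * ‖x₁ - c‖ ^ k) = E * D * (‖x₂ - c‖ ^ k * ‖x₁ - c‖ ^ n) := by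
      linear_combination D * ‖x₁ - c‖ ^ k * e2 - D * ‖x₂ - c‖ ^ k * e1
    rw [div_pow, div_pow, div_eq_div_iff hp1.ne' hp2.ne']
    exact mul_left_cancel₀ (mul_pos hE hD).ne' this
  exact pow_right_injective₀ (div_pos (h1.trans hx₂) h1) ((one_lt_div h1).2 hx₂).ne' e3

open Classical in
-- The norms of `P` and `y Q` balance exactly on the circle through `z`. Inside it `y Q` dominates
-- and outside it `P` dominates, so `P - y Q` has j zeros within the inner radius and i within the
-- outer one, the difference lying on that circle.
theorem countP_roots_sub_of_lt {P Q : K[X]} {c : K} {s t p q : ℝ} {i j : ℕ} (hs : 0 ≤ s)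
    (hp : 0 < p) (hq : 0 < q) (hji : j < i)
    (hP : ∀ x : K, s < ‖x - c‖ → ‖x - c‖ < t → ‖P.eval x‖ = p * ‖x - c‖ ^ i)
    (hQ : ∀ x : K, s < ‖x - c‖ → ‖x - c‖ < t → ‖Q.eval x‖ = q * ‖x - c‖ ^ j)
    {y z : K} (hz : s < ‖z - c‖) (hzt : ‖z - c‖ < t) (hyz : P.eval z = y * Q.eval z) :
    (P - C y * Q).roots.countP (fun α => s < ‖α - c‖ ∧ ‖α - c‖ < t) = i - j := by
  set r := ‖z - c‖ with hr
  have hr0 : 0 < r := hs.trans_lt hz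
  have hbal : p * r ^ i = ‖y‖ * (q * r ^ j) := by
    rw [← hP z hz hzt, ← hQ z hz hzt, hyz, norm_mul]
  have hy : 0 < ‖y‖ := by
    by_contra! h
    have : 0 < p * r ^ i := by positivity
    have h' : 0 < q * r ^ j := by positivity
    nlinarith
  obtain ⟨n, rfl⟩ : ∃ n, i = j + n := ⟨i - j, by omega⟩
  have hn : n ≠ 0 := by omega
  have hbal' : p * r ^ n = ‖y‖ * q := by
    have : r ^ j * (p * r ^ n) = r ^ j * (‖y‖ * q) := by
      rw [pow_add] at hbal
      linear_combination hbal
    exact mul_left_cancel₀ (pow_pos hr0 j).ne' this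
  have heval : ∀ x, (P - C y * Q).eval x = P.eval x - y * Q.eval x := fun x => by simp
  have hin : ∀ x : K, s < ‖x - c‖ → ‖x - c‖ < r →
      ‖(P - C y * Q).eval x‖ = ‖y‖ * q * ‖x - c‖ ^ j := fun x h1 h2 => by
    have h0 : 0 < ‖x - c‖ := hs.trans_lt h1
    have hlt : ‖P.eval x‖ < ‖y * Q.eval x‖ := by
      rw [norm_mul, hP x h1 (h2.trans hzt), hQ x h1 (h2.trans hzt), pow_add]
      calc p * (‖x - c‖ ^ j * ‖x - c‖ ^ n) = ‖x - c‖ ^ j * (p * ‖x - c‖ ^ n) := by ring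
        _ < ‖x - c‖ ^ j * (p * r ^ n) := by gcongr
        _ = ‖y‖ * (q * ‖x - c‖ ^ j) := by rw [hbal']; ring
    rw [heval, norm_sub_eq_right hlt, norm_mul, hQ x h1 (h2.trans hzt)]
    ring
  have hout : ∀ x : K, r < ‖x - c‖ → ‖x - c‖ < t →
      ‖(P - C y * Q).eval x‖ = p * ‖x - c‖ ^ (j + n) := fun x h1 h2 => by
    have h0 : 0 < ‖x - c‖ := hr0.trans h1
    have hlt : ‖y * Q.eval x‖ < ‖P.eval x‖ := by
      rw [norm_mul, hP x (hz.trans h1) h2, hQ x (hz.trans h1) h2, pow_add]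
      calc ‖y‖ * (q * ‖x - c‖ ^ j) = ‖x - c‖ ^ j * (p * r ^ n) := by rw [hbal']; ring
        _ < ‖x - c‖ ^ j * (p * ‖x - c‖ ^ n) := by gcongr
        _ = p * (‖x - c‖ ^ j * ‖x - c‖ ^ n) := by ring
    rw [heval, norm_sub_eq_left hlt, hP x (hz.trans h1) h2]
  obtain ⟨c1, c1'⟩ := countP_roots_of_norm_eval hs hz (mul_pos hy hq) hin
  obtain ⟨c2, -⟩ := countP_roots_of_norm_eval hr0.le hzt hp hout
  have hsplit := Multiset.countP_eq_countP_filter_add (P - C y * Q).roots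
    (fun α => ‖α - c‖ < t) (fun α => s < ‖α - c‖)
  rw [Multiset.countP_filter, Multiset.countP_filter, c2] at hsplit
  have e1 : (P - C y * Q).roots.countP (fun α => ‖α - c‖ < t ∧ ¬ s < ‖α - c‖) = j := by
    rw [← c1]
    refine Multiset.countP_congr rfl fun α hα => ?_
    simp only [eq_iff_iff]
    constructor
    · rintro ⟨-, h⟩
      exact (not_lt.1 h).trans_lt hz
    · intro h
      exact ⟨h.trans hzt, not_lt.2 ((c1' α hα).resolve_right (not_le.2 h))⟩
  have e2 : (P - C y * Q).roots.countP (fun α => ‖α - c‖ < t ∧ s < ‖α - c‖) =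
      (P - C y * Q).roots.countP (fun α => s < ‖α - c‖ ∧ ‖α - c‖ < t) :=
    Multiset.countP_congr rfl fun α _ => by simp only [and_comm]
  rw [e1, e2] at hsplit
  omega

open Classical in
/-- If the norms of `P` and `Q` are monomials in the radius, of distinct degrees, on an annulus,
then `P / Q` is everywhere `|i - j|`-to-one there. -/
theorem countP_roots_sub {P Q : K[X]} {c : K} {s t p q : ℝ} {i j : ℕ} (hs : 0 ≤ s)
    (hp : 0 < p) (hq : 0 < q) (hij : i ≠ j)
    (hP : ∀ x : K, s < ‖x - c‖ → ‖x - c‖ < t → ‖P.eval x‖ = p * ‖x - c‖ ^ i)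
    (hQ : ∀ x : K, s < ‖x - c‖ → ‖x - c‖ < t → ‖Q.eval x‖ = q * ‖x - c‖ ^ j)
    {y z : K} (hz : s < ‖z - c‖) (hzt : ‖z - c‖ < t) (hyz : P.eval z = y * Q.eval z) :
    (P - C y * Q).roots.countP (fun α => s < ‖α - c‖ ∧ ‖α - c‖ < t) =
      ((i : ℤ) - j).natAbs := by
  rcases lt_or_gt_of_ne hij with h | h
  · have hy : y ≠ 0 := by
      rintro rfl
      have := hP z hz hzt
      rw [hyz, zero_mul, norm_zero] at this
      exact (mul_pos hp (pow_pos (hs.trans_lt hz) i)).ne this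
    -- When the denominator has the larger exponent, the fibre is read as that of `Q / P` over the
    -- inverse of `y`.
    have h1 : P - C y * Q = C (-y) * (Q - C y⁻¹ * P) := by
      have : C y * C y⁻¹ = (1 : K[X]) := by rw [← C_mul, mul_inv_cancel₀ hy, C_1]
      rw [C_neg]
      linear_combination (-P) * this
    rw [h1, roots_C_mul _ (neg_ne_zero.2 hy),
      countP_roots_sub_of_lt hs hq hp h hQ hP hz hzt (by rw [hyz]; field_simp)]
    omega
  · rw [countP_roots_sub_of_lt hs hp hq h hP hQ hz hzt hyz]
    omega

end Counting

/-! ### Numerators of logarithmic differential forms -/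

section LogNumerator

variable {K : Type*} [Field K]

open Classical in
/-- The numerator of `∑ s ∈ S, u s / (X - s)` over the denominator `∏ s ∈ S, (X - s)`. -/
def logNumerator (S : Finset K) (u : K → K) : K[X] :=
  ∑ s ∈ S, C (u s) * ∏ s' ∈ S.erase s, (X - C s')

open Classical in
-- At a point of `S` the numerators of two forms differ only through their coefficients there; a
-- nonzero coefficient means that the numerator does not vanish.
theorem eval_logNumerator_of_mem {S : Finset K} {u : K → K} {β : K} (hβ : β ∈ S) :
    (logNumerator S u).eval β = u β * ∏ s ∈ S.erase β, (β - s) := by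
  rw [logNumerator, eval_finsetSum, Finset.sum_eq_single β]
  · simp [eval_prod]
  · intro s hs hne
    rw [eval_mul, eval_prod, Finset.prod_eq_zero (Finset.mem_erase.2 ⟨hne.symm, hβ⟩)]
    · simp
    · simp
  · exact fun h => absurd hβ h

theorem eval_logNumerator_of_notMem {S : Finset K} {u : K → K} {x : K} (hx : x ∉ S) :
    (logNumerator S u).eval x = (∑ s ∈ S, u s / (x - s)) * ∏ s ∈ S, (x - s) := by
  classical
  rw [logNumerator, eval_finsetSum, Finset.sum_mul]
  refine Finset.sum_congr rfl fun s hs => ?_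
  have : x - s ≠ 0 := sub_ne_zero.2 fun h => hx (h ▸ hs)
  rw [← Finset.mul_prod_erase S _ hs, eval_mul, eval_C, eval_prod]
  simp only [eval_sub, eval_X, eval_C]
  field_simp

theorem natDegree_logNumerator_le (S : Finset K) (u : K → K) :
    (logNumerator S u).natDegree ≤ S.card - 1 := by
  classical
  refine natDegree_sum_le_of_forall_le _ _ fun s hs => ?_
  refine (natDegree_C_mul_le _ _).trans ?_
  rw [natDegree_prod_of_monic _ _ fun s' _ => monic_X_sub_C s']
  simp [Finset.card_erase_of_mem hs]

theorem coeff_logNumerator (S : Finset K) (u : K → K) :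
    (logNumerator S u).coeff (S.card - 1) = ∑ s ∈ S, u s := by
  classical
  rw [logNumerator, finsetSum_coeff]
  refine Finset.sum_congr rfl fun s hs => ?_
  have hm : (∏ s' ∈ S.erase s, (X - C s')).Monic := monic_prod_of_monic _ _ fun s' _ =>
    monic_X_sub_C s'
  have hd : (∏ s' ∈ S.erase s, (X - C s')).natDegree = S.card - 1 := by
    rw [natDegree_prod_of_monic _ _ fun s' _ => monic_X_sub_C s']
    simp [Finset.card_erase_of_mem hs]
  rw [coeff_C_mul, ← hd, hm.coeff_natDegree, mul_one]

theorem natDegree_logNumerator {S : Finset K} {u : K → K} (h : ∑ s ∈ S, u s ≠ 0) :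
    (logNumerator S u).natDegree = S.card - 1 :=
  le_antisymm (natDegree_logNumerator_le S u)
    (le_natDegree_of_ne_zero (by rwa [coeff_logNumerator]))

theorem leadingCoeff_logNumerator {S : Finset K} {u : K → K} (h : ∑ s ∈ S, u s ≠ 0) :
    (logNumerator S u).leadingCoeff = ∑ s ∈ S, u s := by
  rw [leadingCoeff, natDegree_logNumerator h, coeff_logNumerator]

end LogNumerator

/-! ### Products of values over zeros -/

section Products

theorem multiset_prod_map_lt {ι : Type*} {m : Multiset ι} {f g : ι → ℝ} (hm : m ≠ 0)
    (hf : ∀ i ∈ m, 0 ≤ f i) (h : ∀ i ∈ m, f i < g i) : (m.map f).prod < (m.map g).prod := by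
  induction m using Multiset.induction_on with
  | empty => exact absurd rfl hm
  | cons a m ih =>
    rw [Multiset.map_cons, Multiset.prod_cons, Multiset.map_cons, Multiset.prod_cons]
    have ha := Multiset.mem_cons_self a m
    rcases eq_or_ne m 0 with rfl | hm0
    · simpa using h a ha
    · have h1 := ih hm0 (fun i hi => hf i (Multiset.mem_cons_of_mem hi))
        fun i hi => h i (Multiset.mem_cons_of_mem hi)
      have h2 : 0 ≤ (m.map f).prod := Multiset.prod_nonneg fun a ha => by
        obtain ⟨i, hi, rfl⟩ := Multiset.mem_map.1 ha
        exact hf i (Multiset.mem_cons_of_mem hi)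
      exact mul_lt_mul'' (h a ha) h1 (hf a ha) h2

theorem multiset_prod_map_le {ι : Type*} {m : Multiset ι} {f g : ι → ℝ}
    (hf : ∀ i ∈ m, 0 ≤ f i) (h : ∀ i ∈ m, f i ≤ g i) : (m.map f).prod ≤ (m.map g).prod := by
  induction m using Multiset.induction_on with
  | empty => simp
  | cons a m ih =>
    rw [Multiset.map_cons, Multiset.prod_cons, Multiset.map_cons, Multiset.prod_cons]
    have ha := Multiset.mem_cons_self a m
    have h1 := ih (fun i hi => hf i (Multiset.mem_cons_of_mem hi))
        fun i hi => h i (Multiset.mem_cons_of_mem hi)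
    have h2 : 0 ≤ (m.map f).prod := Multiset.prod_nonneg fun a ha => by
      obtain ⟨i, hi, rfl⟩ := Multiset.mem_map.1 ha
      exact hf i (Multiset.mem_cons_of_mem hi)
    exact mul_le_mul (h a ha) h1 h2 ((hf a ha).trans (h a ha))

variable {K : Type*} [NontriviallyNormedField K] [IsAlgClosed K]

/-- Evaluating `W` at the zeros of `G` and `G` at the zeros of `W`. -/
theorem prod_norm_eval_roots (W G : K[X]) :
    ‖G.leadingCoeff‖ ^ W.natDegree * (G.roots.map fun x => ‖W.eval x‖).prod =
      ‖W.leadingCoeff‖ ^ G.natDegree * (W.roots.map fun v => ‖G.eval v‖).prod := by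
  have hW := (IsAlgClosed.splits W).natDegree_eq_card_roots
  have hG := (IsAlgClosed.splits G).natDegree_eq_card_roots
  simp only [norm_eval_eq_prod_roots, Multiset.prod_map_mul, Multiset.map_const',
    Multiset.prod_replicate, ← hW, ← hG]
  rw [Multiset.prod_map_prod_map]
  simp only [norm_sub_rev]
  ring

/-- If two polynomials of the same degree with unimodular leading coefficients satisfy
`|V| ≤ |H|` at the zeros of `B`, then the norms of the products of the values of `B` at the
zeros of `V` and `H` compare in the same way. -/
theorem prod_norm_eval_roots_le {V H B : K[X]} (hdeg : V.natDegree = H.natDegree)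
    (hV : ‖V.leadingCoeff‖ = 1) (hH : ‖H.leadingCoeff‖ = 1)
    (h : ∀ β ∈ B.roots, ‖V.eval β‖ ≤ ‖H.eval β‖) :
    (V.roots.map fun v => ‖B.eval v‖).prod ≤ (H.roots.map fun v => ‖B.eval v‖).prod := by
  have h1 := prod_norm_eval_roots V B
  have h2 := prod_norm_eval_roots H B
  rw [hV, one_pow, one_mul] at h1
  rw [hH, one_pow, one_mul] at h2
  rw [← h1, ← h2, hdeg]
  gcongr
  exact multiset_prod_map_le (fun _ _ => norm_nonneg _) h

end Products

/-! ### Intervals avoiding finite sets -/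

section Intervals

theorem exists_Ioo_disjoint_finset (E : Finset ℝ) {lo hi : ℝ} (h : lo < hi) :
    ∃ lo' hi', lo ≤ lo' ∧ lo' < hi' ∧ hi' ≤ hi ∧ ∀ e ∈ E, ¬ (lo' < e ∧ e < hi') := by
  classical
  induction E using Finset.induction_on with
  | empty => exact ⟨lo, hi, le_rfl, h, le_rfl, by simp⟩
  | insert e E _ ih =>
    obtain ⟨a, b, h1, h2, h3, h4⟩ := ih
    by_cases he : a < e ∧ e < b
    · refine ⟨a, e, h1, he.1, he.2.le.trans h3, fun e' he' hcon => ?_⟩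
      rcases Finset.mem_insert.1 he' with rfl | he'
      · exact lt_irrefl _ hcon.2
      · exact h4 e' he' ⟨hcon.1, hcon.2.trans he.2⟩
    · refine ⟨a, b, h1, h2, h3, fun e' he' => ?_⟩
      rcases Finset.mem_insert.1 he' with rfl | he'
      · exact he
      · exact h4 e' he'

theorem exists_gt_forall_le_of_finset (E : Finset ℝ) (r : ℝ) :
    ∃ t, r < t ∧ ∀ e ∈ E, r < e → t ≤ e := by
  classical
  rcases (E.filter (r < ·)).eq_empty_or_nonempty with h | h
  · refine ⟨r + 1, by linarith, fun e he hr => ?_⟩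
    have : e ∈ E.filter (r < ·) := Finset.mem_filter.2 ⟨he, hr⟩
    rw [h] at this
    simp at this
  · refine ⟨(E.filter (r < ·)).min' h, (Finset.mem_filter.1 (Finset.min'_mem _ h)).2,
      fun e he hr => Finset.min'_le _ _ (Finset.mem_filter.2 ⟨he, hr⟩)⟩

end Intervals

/-! ### The attracted critical point -/

section Divisor

variable {K : Type*} [Field K]

open Classical in
/-- The zeros and poles of `B / A`. -/
def divisorSupport (A B : K[X]) : Finset K := A.roots.toFinset ∪ B.roots.toFinset

/-- The order of `B / A` at `s`. -/
def divisorOrder (A B : K[X]) (s : K) : ℤ := B.rootMultiplicity s - A.rootMultiplicity s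

theorem mem_divisorSupport {A B : K[X]} (hA : A ≠ 0) (hB : B ≠ 0) {s : K} :
    s ∈ divisorSupport A B ↔ A.eval s = 0 ∨ B.eval s = 0 := by
  simp [divisorSupport, hA, hB]

omit [Field K] in
theorem sum_count_filter {m : Multiset K} {S : Finset K} (hS : ∀ s ∈ m, s ∈ S) (p : K → Prop)
    [DecidableEq K] [DecidablePred p] : ∑ s ∈ S with p s, m.count s = m.countP p := by
  rw [Multiset.countP_eq_card_filter, ← Multiset.sum_count_eq_card (s := S)
    fun a ha => hS a (Multiset.mem_of_mem_filter ha), Finset.sum_filter]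
  exact Finset.sum_congr rfl fun s _ => (Multiset.count_filter ..).symm

theorem sum_divisorOrder (A B : K[X]) (p : K → Prop) [DecidablePred p] :
    ∑ s ∈ divisorSupport A B with p s, divisorOrder A B s =
      (B.roots.countP p : ℤ) - A.roots.countP p := by
  classical
  rw [← sum_count_filter (m := B.roots) (S := divisorSupport A B)
      (fun s hs => Finset.mem_union_right _ (Multiset.mem_toFinset.2 hs)),
    ← sum_count_filter (m := A.roots) (S := divisorSupport A B)
      (fun s hs => Finset.mem_union_left _ (Multiset.mem_toFinset.2 hs))]
  push_cast
  rw [← Finset.sum_sub_distrib]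
  simp [divisorOrder]

theorem divisorOrder_of_eval_eq_zero_right {A B : K[X]} (hAB : IsCoprime A B) (hB : B ≠ 0) {s : K}
    (hs : B.eval s = 0) : ∃ n : ℕ, 0 < n ∧ n ≤ B.natDegree ∧ divisorOrder A B s = n := by
  classical
  have hA : A.rootMultiplicity s = 0 := rootMultiplicity_eq_zero fun h => by
    obtain ⟨a, b, hab⟩ := hAB
    have := congrArg (eval s) hab
    simp [hs, h.eq_zero] at this
  refine ⟨B.rootMultiplicity s, (rootMultiplicity_pos hB).2 hs, ?_, by simp [divisorOrder, hA]⟩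
  rw [← count_roots]
  exact (Multiset.count_le_card _ _).trans (card_roots' B)

theorem divisorOrder_swap (A B : K[X]) (s : K) : divisorOrder A B s = -divisorOrder B A s := by
  simp [divisorOrder]

/-- The hypothesis on the characteristic enters here: by coprimality each order is, up to sign, an
integer between 1 and `d`. -/
theorem divisorOrder_cast_ne_zero {A B : K[X]} {d : ℕ} (hA : A ≠ 0) (hB : B ≠ 0)
    (hAB : IsCoprime A B) (hAd : A.natDegree ≤ d) (hBd : B.natDegree ≤ d)
    (hchar : ∀ n : ℕ, 0 < n → n ≤ d → (n : K) ≠ 0) {s : K} (hs : s ∈ divisorSupport A B) :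
    (divisorOrder A B s : K) ≠ 0 := by
  rcases (mem_divisorSupport hA hB).1 hs with h | h
  · obtain ⟨n, hn, hnd, he⟩ := divisorOrder_of_eval_eq_zero_right hAB.symm hA h
    rw [divisorOrder_swap, he]
    simpa using hchar n hn (hnd.trans hAd)
  · obtain ⟨n, hn, hnd, he⟩ := divisorOrder_of_eval_eq_zero_right hAB hB h
    rw [he]
    simpa using hchar n hn (hnd.trans hBd)

/-- Shows that zeros of this form off the support are critical points of `A / B`. -/
theorem sum_divisorOrder_div [IsAlgClosed K] {A B : K[X]} {x : K} (hA : A.eval x ≠ 0)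
    (hB : B.eval x ≠ 0) :
    ∑ s ∈ divisorSupport A B, (divisorOrder A B s : K) / (x - s) =
      B.derivative.eval x / B.eval x - A.derivative.eval x / A.eval x := by
  classical
  have key : ∀ P : K[X], P.eval x ≠ 0 → P.roots.toFinset ⊆ divisorSupport A B →
      P.derivative.eval x / P.eval x =
        ∑ s ∈ divisorSupport A B, (P.rootMultiplicity s : K) / (x - s) := fun P hP hS => by
    rw [(IsAlgClosed.splits P).eval_derivative_div_eval_of_ne_zero hP,
      Finset.sum_multiset_map_count, ← Finset.sum_subset hS]
    · simp [div_eq_mul_inv]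
    · intro s _ hs
      have : P.roots.count s = 0 := Multiset.count_eq_zero.2 fun h => hs (Multiset.mem_toFinset.2 h)
      rw [count_roots] at this
      simp [this]
  rw [key A hA Finset.subset_union_left, key B hB Finset.subset_union_right,
    ← Finset.sum_sub_distrib]
  simp [divisorOrder, sub_div]

end Divisor

/-! ### Multiplicities on annuli -/

section Core

variable {K : Type*} [NontriviallyNormedField K]

open Classical in
/-- `L < |m| ^ d` whenever `A / B` is everywhere `m`-to-one on all subannuli of some annulus
without zeros of `B`. -/
def AnnulusBound (A B : K[X]) (L : ℝ) (d : ℕ) : Prop :=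
  ∀ (c : K) (s t : ℝ) (m : ℕ), 0 < s → s < t →
    (∀ z : K, s < ‖z - c‖ → ‖z - c‖ < t → B.eval z ≠ 0) →
    (∀ s' t' : ℝ, s ≤ s' → s' < t' → t' ≤ t → ∀ y z : K, s' < ‖z - c‖ → ‖z - c‖ < t' →
      A.eval z = y * B.eval z →
        (A - C y * B).roots.countP (fun α => s' < ‖α - c‖ ∧ ‖α - c‖ < t') = m) →
    L < ‖(m : K)‖ ^ d

theorem AnnulusBound.sub_C_mul {A B : K[X]} {L : ℝ} {d : ℕ} (h : AnnulusBound A B L d) (a : K) :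
    AnnulusBound (A - C a * B) B L d := by
  intro c s t m hs hst hB hc
  refine h c s t m hs hst hB fun s' t' h1 h2 h3 y z h4 h5 hy => ?_
  have := hc s' t' h1 h2 h3 (y - a) z h4 h5 (by
    rw [eval_sub, eval_mul, eval_C, hy]
    ring)
  rwa [C_sub, sub_mul, sub_sub_sub_cancel_right] at this

variable [IsUltrametricDist K] [IsAlgClosed K]

/-- The bound coming from an annulus without zeros and poles of `B / A`. -/
theorem AnnulusBound.lt_of_forall_mem {A B : K[X]} {L : ℝ} {d : ℕ} (h : AnnulusBound A B L d)
    (hA : A ≠ 0) (hB : B ≠ 0) {c : K} {s t : ℝ} {i j : ℕ} (hs : 0 < s) (hst : s < t)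
    (hS : ∀ σ ∈ divisorSupport A B, ‖σ - c‖ ≤ s ∨ t ≤ ‖σ - c‖)
    (hi : A.roots.countP (fun α => ‖α - c‖ < t) = i)
    (hj : B.roots.countP (fun α => ‖α - c‖ < t) = j) (hij : i ≠ j) :
    L < ‖((((i : ℤ) - j).natAbs : ℕ) : K)‖ ^ d := by
  classical
  have hSA : ∀ α ∈ A.roots, ‖α - c‖ ≤ s ∨ t ≤ ‖α - c‖ := fun α hα =>
    hS α (Finset.mem_union_left _ (Multiset.mem_toFinset.2 hα))
  have hSB : ∀ α ∈ B.roots, ‖α - c‖ ≤ s ∨ t ≤ ‖α - c‖ := fun α hα =>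
    hS α (Finset.mem_union_right _ (Multiset.mem_toFinset.2 hα))
  obtain ⟨p, hp, hP⟩ := exists_norm_eval_eq_mul_pow hA (hs.trans hst) hSA
  obtain ⟨q, hq, hQ⟩ := exists_norm_eval_eq_mul_pow hB (hs.trans hst) hSB
  have hi' : A.roots.countP (fun α => ‖α - c‖ < t) = i := by rw [← hi]
  have hj' : B.roots.countP (fun α => ‖α - c‖ < t) = j := by rw [← hj]
  rw [hi'] at hP
  rw [hj'] at hQ
  refine h c s t _ hs hst (fun z h1 h2 h0 => ?_) fun s' t' h1 h2 h3 y z h4 h5 hy => ?_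
  · have := hQ z h1 h2
    rw [h0, norm_zero] at this
    exact (mul_pos hq (pow_pos (hs.trans h1) j)).ne this
  · exact countP_roots_sub (hs.le.trans h1) hp hq hij
      (fun x hx hx' => hP x (h1.trans_lt hx) (hx'.trans_le h3))
      (fun x hx hx' => hQ x (h1.trans_lt hx) (hx'.trans_le h3)) h4 h5 hy

end Core

/-! ### Generic points of a fibre -/

section Core

variable {K : Type*} [NontriviallyNormedField K] [IsUltrametricDist K] [IsAlgClosed K]

/-- On the circle about `s₀` through `x` there are no points of `S` and no zeros of the numerator
for `ν`, so the form has constant norm there, and this bounds its total residue inside. By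
genericity the form for `u` has norm exactly `1 / ‖x - s₀‖` at `x`; the radius cancels in the
quotient of the two. -/
theorem norm_sum_filter_mul_le {S : Finset K} {ν u : K → K}
    (hu : ∀ T ⊆ S, T.Nonempty → ‖∑ s ∈ T, u s‖ = 1) {x s₀ : K} (hs₀ : s₀ ∈ S) (hx : x ≠ s₀)
    (hmin : ∀ s ∈ S, ‖x - s₀‖ ≤ ‖x - s‖) (hgen : ∀ s ∈ S, ‖s - s₀‖ ≠ ‖x - s₀‖)
    (hV : ∀ v ∈ (logNumerator S ν).roots, ‖v - s₀‖ ≠ ‖x - s₀‖) :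
    ‖∑ s ∈ S with ‖s - s₀‖ < ‖x - s₀‖, ν s‖ * ‖(logNumerator S u).eval x‖ ≤
      ‖(logNumerator S ν).eval x‖ := by
  have hr0 : 0 < ‖x - s₀‖ := norm_pos_iff.2 (sub_ne_zero.2 hx)
  have hxS : x ∉ S := fun h => by
    have := hmin x h
    rw [sub_self, norm_zero] at this
    linarith
  have hprod : 0 < ∏ s ∈ S, ‖x - s‖ := Finset.prod_pos fun s hs => hr0.trans_le (hmin s hs)
  have h1 := norm_sum_filter_le_of_sphere (S := S) (ν := ν) (s₀ := s₀) (x := x)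
    (C := ‖(logNumerator S ν).eval x‖ / ∏ s ∈ S, ‖x - s‖) hr0 rfl hgen (fun x' hx' => by
      have hdist : ∀ s ∈ S, ‖x' - s‖ = ‖x - s‖ := fun s hs => by
        rw [norm_sub_eq_max_of_center (c := s₀) (x := x') (by rw [hx']; exact (hgen s hs).symm),
          norm_sub_eq_max_of_center (c := s₀) (x := x) (hgen s hs).symm, hx']
      have hx'S : x' ∉ S := fun h => by
        have := hdist x' h
        rw [sub_self, norm_zero] at this
        exact (hr0.trans_le (hmin x' h)).ne this
      have hVx : ‖(logNumerator S ν).eval x'‖ = ‖(logNumerator S ν).eval x‖ := by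
        rw [norm_eval_eq_diskNorm_of_ne (c := s₀) (by rwa [hx']),
          norm_eval_eq_diskNorm_of_ne hV, hx']
      rw [← hVx, eval_logNumerator_of_notMem hx'S, norm_mul, norm_prod,
        Finset.prod_congr rfl hdist, mul_div_cancel_right₀ _ hprod.ne'])
  rw [eval_logNumerator_of_notMem (u := u) hxS, norm_mul, norm_prod,
    norm_sum_div_eq_of_generic hu hs₀ hx hmin hgen]
  calc _ ≤ ‖x - s₀‖ * (‖(logNumerator S ν).eval x‖ / ∏ s ∈ S, ‖x - s‖) *
        (1 / ‖x - s₀‖ * ∏ s ∈ S, ‖x - s‖) := by gcongr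
    _ = ‖(logNumerator S ν).eval x‖ := by field_simp

/-- The distance from a generic point of the fibre to the closest zero or pole of `B / A` is not
the distance between two zeros or poles. -/
theorem dist_ne_of_generic {A B : K[X]} {x y s₀ : K} (hs₀ : s₀ ∈ divisorSupport A B)
    (hxy : B.eval x = y * A.eval x) (hmin : ∀ s ∈ divisorSupport A B, ‖x - s₀‖ ≤ ‖x - s‖)
    (hy : ∀ s₁ ∈ divisorSupport A B, s₁ ≠ s₀ →
      diskNorm s₀ ‖s₁ - s₀‖ B ≠ ‖y‖ * diskNorm s₀ ‖s₁ - s₀‖ A) (hx : x ≠ s₀) :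
    ∀ s ∈ divisorSupport A B, ‖s - s₀‖ ≠ ‖x - s₀‖ := by
  classical
  intro s hs h
  -- If some point of the support is at distance `‖x - s₀‖` from `s₀`, then `x`, having no closer
  -- point of the support than `s₀`, evaluates `A` and `B` as the disk through that point does; `y`
  -- was chosen to avoid the resulting ratio.
  have hdist : ∀ σ ∈ divisorSupport A B, ‖x - σ‖ = max ‖s - s₀‖ ‖σ - s₀‖ := fun σ hσ => by
    rw [h]
    by_cases hne : ‖x - s₀‖ = ‖σ - s₀‖
    · rw [← hne, max_self]
      refine le_antisymm ?_ (hmin σ hσ)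
      rw [← sub_sub_sub_cancel_right x σ s₀]
      exact (norm_sub_le_max _ _).trans (by rw [← hne, max_self])
    · exact norm_sub_eq_max_of_center hne
  have hsne : s ≠ s₀ := by
    rintro rfl
    rw [sub_self, norm_zero] at h
    exact hx (sub_eq_zero.1 (norm_eq_zero.1 h.symm))
  refine hy s hs hsne ?_
  rw [← norm_eval_eq_diskNorm (x := x) fun α hα =>
      hdist α (Finset.mem_union_right _ (Multiset.mem_toFinset.2 hα)),
    ← norm_eval_eq_diskNorm (x := x) fun α hα =>
      hdist α (Finset.mem_union_left _ (Multiset.mem_toFinset.2 hα)), hxy, norm_mul]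

/-- At a generic point `x` of the fibre over `y` the degree in the direction of the annulus
containing `x` satisfies the annulus bound. -/
theorem AnnulusBound.lt_of_generic {A B : K[X]} {L : ℝ} {d : ℕ} (h : AnnulusBound A B L d)
    (hA : A ≠ 0) (hB : B ≠ 0) (hne : ∀ s ∈ divisorSupport A B, divisorOrder A B s ≠ 0)
    {x y s₀ : K} (hs₀ : s₀ ∈ divisorSupport A B)
    (hxy : B.eval x = y * A.eval x)
    (hy : ∀ s₁ ∈ divisorSupport A B, s₁ ≠ s₀ →
      diskNorm s₀ ‖s₁ - s₀‖ B ≠ ‖y‖ * diskNorm s₀ ‖s₁ - s₀‖ A) (hx : x ≠ s₀)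
    (hgen : ∀ s ∈ divisorSupport A B, ‖s - s₀‖ ≠ ‖x - s₀‖) :
    ∃ m : ℕ, m ≤ max A.natDegree B.natDegree ∧ L < ‖(m : K)‖ ^ d ∧
      ‖∑ s ∈ divisorSupport A B with ‖s - s₀‖ < ‖x - s₀‖, (divisorOrder A B s : K)‖ =
        ‖(m : K)‖ := by
  classical
  set S := divisorSupport A B with hS
  set r := ‖x - s₀‖ with hr
  have hr0 : 0 < r := norm_pos_iff.2 (sub_ne_zero.2 hx)
  obtain ⟨t, hrt, ht⟩ := exists_gt_forall_le_of_finset (S.image fun s => ‖s - s₀‖) r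
  have ht' : ∀ s ∈ S, r < ‖s - s₀‖ → t ≤ ‖s - s₀‖ := fun s hs => ht _ (Finset.mem_image_of_mem _ hs)
  have hlt : ∀ s ∈ S, ‖s - s₀‖ < t ↔ ‖s - s₀‖ < r := fun s hs =>
    ⟨fun h1 => lt_of_le_of_ne (not_lt.1 fun h2 => absurd (ht' s hs h2) (not_le.2 h1)) (hgen s hs),
      fun h1 => h1.trans hrt⟩
  set T := S.filter fun s => ‖s - s₀‖ < r with hT
  have hs₀T : s₀ ∈ T := by simp [hT, hs₀, hr0]
  set i := A.roots.countP (fun α => ‖α - s₀‖ < t) with hi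
  set j := B.roots.countP (fun α => ‖α - s₀‖ < t) with hj
  have hsum : ∑ s ∈ T, divisorOrder A B s = (j : ℤ) - i := by
    rw [← sum_divisorOrder]
    refine Finset.sum_congr (Finset.filter_congr fun s hs => (hlt s hs).symm) fun _ _ => rfl
  obtain ⟨s₁, hs₁T, hs₁⟩ := Finset.exists_max_image T (fun s => ‖s - s₀‖) ⟨s₀, hs₀T⟩
  have hs₁S : s₁ ∈ S := (Finset.mem_filter.1 hs₁T).1
  have hs₁r : ‖s₁ - s₀‖ < r := (Finset.mem_filter.1 hs₁T).2
  have hgap : ∀ σ ∈ S, ‖σ - s₀‖ ≤ ‖s₁ - s₀‖ ∨ t ≤ ‖σ - s₀‖ := fun σ hσ => by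
    by_cases hc : ‖σ - s₀‖ < t
    · exact Or.inl (hs₁ σ (Finset.mem_filter.2 ⟨hσ, (hlt σ hσ).1 hc⟩))
    · exact Or.inr (not_lt.1 hc)
  have hSA : ∀ α ∈ A.roots, ‖α - s₀‖ ≤ ‖s₁ - s₀‖ ∨ t ≤ ‖α - s₀‖ := fun α hα =>
    hgap α (Finset.mem_union_left _ (Multiset.mem_toFinset.2 hα))
  have hSB : ∀ α ∈ B.roots, ‖α - s₀‖ ≤ ‖s₁ - s₀‖ ∨ t ≤ ‖α - s₀‖ := fun α hα =>
    hgap α (Finset.mem_union_right _ (Multiset.mem_toFinset.2 hα))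
  -- With equal counts `|B / A|` would be constant from the circle of `s₁` up to that of `x`, so
  -- `|y|` would be its value on the disk through `s₁`, which is excluded. If `s₁ = s₀`, then `s₀`
  -- is alone inside and its nonzero order settles the matter.
  have hij : i ≠ j := by
    intro hij
    by_cases h1 : s₁ = s₀
    · have hTs : T = {s₀} := by
        refine Finset.eq_singleton_iff_unique_mem.2 ⟨hs₀T, fun s hs => ?_⟩
        have := hs₁ s hs
        rw [h1, sub_self, norm_zero] at this
        exact sub_eq_zero.1 (norm_le_zero_iff.1 this)
      rw [hTs, Finset.sum_singleton, hij, sub_self] at hsum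
      exact hne s₀ hs₀ hsum
    · obtain ⟨p, hp, hP⟩ := exists_diskNorm_eq_mul_pow hA (hr0.trans hrt) hSA
      obtain ⟨q, hq, hQ⟩ := exists_diskNorm_eq_mul_pow hB (hr0.trans hrt) hSB
      have hA' : ‖A.eval x‖ = p * r ^ i := by
        rw [norm_eval_eq_diskNorm_of_ne (c := s₀) fun α hα =>
          hgen α (Finset.mem_union_left _ (Multiset.mem_toFinset.2 hα)), hP _ hs₁r.le hrt.le]
      have hB' : ‖B.eval x‖ = q * r ^ i := by
        rw [norm_eval_eq_diskNorm_of_ne (c := s₀) fun α hα =>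
          hgen α (Finset.mem_union_right _ (Multiset.mem_toFinset.2 hα)), hQ _ hs₁r.le hrt.le,
          hij]
      have hpq : q = ‖y‖ * p := by
        have : r ^ i * q = r ^ i * (‖y‖ * p) := by
          rw [hxy, norm_mul, hA'] at hB'
          linear_combination -hB'
        exact mul_left_cancel₀ (pow_pos hr0 i).ne' this
      refine hy s₁ hs₁S h1 ?_
      rw [hP _ le_rfl (hs₁r.trans hrt).le, hQ _ le_rfl (hs₁r.trans hrt).le, ← hi, ← hj, hij, hpq]
      ring
  refine ⟨((i : ℤ) - j).natAbs, ?_, ?_, ?_⟩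
  · have h1 : i ≤ A.natDegree := (Multiset.countP_le_card _ _).trans (card_roots' A)
    have h2 : j ≤ B.natDegree := (Multiset.countP_le_card _ _).trans (card_roots' B)
    omega
  · refine h.lt_of_forall_mem hA hB (c := s₀) (s := max ‖s₁ - s₀‖ (r / 2)) (t := t)
      (lt_max_of_lt_right (by linarith)) (max_lt (hs₁r.trans hrt) (by linarith)) ?_ rfl rfl hij
    intro σ hσ
    exact (hgap σ hσ).imp_left fun h => h.trans (le_max_left _ _)
  · have e1 : (∑ s ∈ T, (divisorOrder A B s : K)) = (((j : ℤ) - i : ℤ) : K) := by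
      rw [← hsum]
      push_cast
      rfl
    rw [e1]
    rcases Int.natAbs_eq ((i : ℤ) - j) with h1 | h1
    · rw [show (j : ℤ) - i = -((((i : ℤ) - j).natAbs : ℕ) : ℤ) by omega,
        Int.cast_neg, norm_neg, Int.cast_natCast]
    · rw [show (j : ℤ) - i = ((((i : ℤ) - j).natAbs : ℕ) : ℤ) by omega,
        Int.cast_natCast]

end Core

/-! ### The comparison argument -/

section Core

variable {K : Type*} [NontriviallyNormedField K] [IsUltrametricDist K] [IsAlgClosed K]

omit [IsUltrametricDist K] in
theorem norm_eval_eq_of_sphere {P : K[X]} {z : K} {r : ℝ} (h : ∀ α ∈ P.roots, ‖z - α‖ = r) :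
    ‖P.eval z‖ = ‖P.leadingCoeff‖ * r ^ P.natDegree := by
  rw [norm_eval_eq_prod_roots, Multiset.map_congr rfl h, Multiset.map_const',
    Multiset.prod_replicate, (IsAlgClosed.splits P).natDegree_eq_card_roots]

/-- Far away from its zeros and poles `A / B` is injective and expands. -/
theorem AnnulusBound.injective_of_far {A B : K[X]} {L : ℝ} {d : ℕ} (h : AnnulusBound A B L d)
    (hAd : A.natDegree = d) (hBd : B.natDegree + 1 = d) (hA : A ≠ 0) (hB : B ≠ 0)
    (hL : L = ‖B.leadingCoeff‖ / ‖A.leadingCoeff‖) {a : K} {ρ : ℝ} (hρ : 0 < ρ)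
    (hS : ∀ s ∈ divisorSupport A B, ‖s - a‖ ≤ ρ) :
    L < 1 ∧ (∀ z, ρ < ‖z - a‖ → B.eval z ≠ 0 ∧ ‖A.eval z‖ * L = ‖z - a‖ * ‖B.eval z‖) ∧
      ∀ z w, ρ < ‖z - a‖ → ρ < ‖w - a‖ → A.eval z * B.eval w = A.eval w * B.eval z → z = w := by
  classical
  have hlA : 0 < ‖A.leadingCoeff‖ := norm_pos_iff.2 (leadingCoeff_ne_zero.2 hA)
  have hlB : 0 < ‖B.leadingCoeff‖ := norm_pos_iff.2 (leadingCoeff_ne_zero.2 hB)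
  have hSA : ∀ α ∈ A.roots, ‖α - a‖ ≤ ρ := fun α hα =>
    hS α (Finset.mem_union_left _ (Multiset.mem_toFinset.2 hα))
  have hSB : ∀ α ∈ B.roots, ‖α - a‖ ≤ ρ := fun α hα =>
    hS α (Finset.mem_union_right _ (Multiset.mem_toFinset.2 hα))
  have hdist : ∀ z, ρ < ‖z - a‖ → ∀ α : K, ‖α - a‖ ≤ ρ → ‖z - α‖ = ‖z - a‖ := fun z hz α hα => by
    rw [norm_sub_eq_max_of_center (c := a) (by linarith), max_eq_left (by linarith)]
  have hAz : ∀ z, ρ < ‖z - a‖ → ‖A.eval z‖ = ‖A.leadingCoeff‖ * ‖z - a‖ ^ d := fun z hz => by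
    rw [norm_eval_eq_of_sphere fun α hα => hdist z hz α (hSA α hα), hAd]
  have hBz : ∀ z, ρ < ‖z - a‖ → ‖B.eval z‖ = ‖B.leadingCoeff‖ * ‖z - a‖ ^ B.natDegree :=
    fun z hz => norm_eval_eq_of_sphere fun α hα => hdist z hz α (hSB α hα)
  have hB0 : ∀ z, ρ < ‖z - a‖ → B.eval z ≠ 0 := fun z hz => norm_pos_iff.1 (by
    rw [hBz z hz]
    exact mul_pos hlB (pow_pos (hρ.trans hz) _))
  refine ⟨?_, fun z hz => ⟨hB0 z hz, ?_⟩, fun z w hz hw hzw => ?_⟩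
  -- All d zeros and d - 1 poles are inside, so the multiplicity on the outer annulus is 1, and the
  -- annulus bound reads `L < 1`.
  · have hcard : ∀ P : K[X], (∀ α ∈ P.roots, ‖α - a‖ ≤ ρ) →
        P.roots.countP (fun α => ‖α - a‖ < 2 * ρ) = P.natDegree := fun P hP => by
      rw [(IsAlgClosed.splits P).natDegree_eq_card_roots, Multiset.countP_eq_card]
      intro α hα
      linarith [hP α hα]
    have := h.lt_of_forall_mem hA hB (c := a) (s := ρ) (t := 2 * ρ) hρ (by linarith)
      (fun σ hσ => Or.inl (hS σ hσ)) (hcard A hSA) (hcard B hSB) (by omega)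
    rwa [show ((A.natDegree : ℤ) - B.natDegree).natAbs = 1 by omega, Nat.cast_one, norm_one,
      one_pow] at this
  · rw [hAz z hz, hBz z hz, hL, ← hBd, pow_succ]
    field_simp
  · by_contra hne
    have hzB := hB0 z hz
    have hwB := hB0 w hw
    set t := max ‖z - a‖ ‖w - a‖ + 1
    have hzt : ‖z - a‖ < t := (le_max_left _ _).trans_lt (lt_add_one _)
    have hwt : ‖w - a‖ < t := (le_max_right _ _).trans_lt (lt_add_one _)
    set y := A.eval z / B.eval z with hy
    have hyz : A.eval z = y * B.eval z := by rw [hy]; field_simp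
    have hyw : A.eval w = y * B.eval w := by
      rw [hy]
      field_simp
      exact hzw.symm
    have hc := countP_roots_sub (P := A) (Q := B) (c := a) (s := ρ) (t := t) (i := d)
      (j := B.natDegree) hρ.le hlA hlB (by omega) (fun x hx _ => hAz x hx)
      (fun x hx _ => hBz x hx) hz hzt hyz
    rw [show ((d : ℤ) - B.natDegree).natAbs = 1 by omega, Multiset.countP_eq_card_filter,
      Multiset.card_eq_one] at hc
    obtain ⟨b, hb⟩ := hc
    have hne0 : A - C y * B ≠ 0 := fun h0 => by
      have hA' : A = C y * B := sub_eq_zero.1 h0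
      have h1 := natDegree_C_mul_le y B
      rw [← hA'] at h1
      omega
    have hmem : ∀ x, ρ < ‖x - a‖ → ‖x - a‖ < t → A.eval x = y * B.eval x → x = b :=
      fun x h1 h2 h3 => by
        have : x ∈ (A - C y * B).roots.filter (fun α => ρ < ‖α - a‖ ∧ ‖α - a‖ < t) :=
          Multiset.mem_filter.2 ⟨(mem_roots hne0).2 (by simp [h3]), h1, h2⟩
        rw [hb] at this
        exact Multiset.mem_singleton.1 this
    exact hne ((hmem z hz hzt hyz).trans (hmem w hw hwt hyw).symm)

/-- Only finitely many strict inequalities `L < f n` are involved, so a factor close enough to 1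
preserves them all; `lo ≥ L / c` keeps that factor above `L`. -/
theorem exists_lt_forall_lt_mul {L c : ℝ} (hc : 0 < c) (hL : L < 1) (d : ℕ) (f : ℕ → ℝ) :
    ∃ lo, L / c ≤ lo ∧ lo < 1 / c ∧
      ∀ t, lo < t → t < 1 / c → ∀ n ≤ d, L < f n → L < f n * (c * t) := by
  have h : ∀ n ∈ Finset.range (d + 1), ∀ᶠ t in 𝓝[<] (1 / c), L < f n → L < f n * (c * t) := by
    intro n _
    by_cases hn : L < f n
    · have hcont : Tendsto (fun t => f n * (c * t)) (𝓝[<] (1 / c)) (𝓝 (f n * (c * (1 / c)))) :=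
        ((continuous_const.mul (continuous_const.mul continuous_id)).tendsto _).mono_left
          nhdsWithin_le_nhds
      rw [mul_one_div_cancel hc.ne', mul_one] at hcont
      filter_upwards [hcont.eventually (lt_mem_nhds hn)] with t ht _ using ht
    · exact Eventually.of_forall fun t h => absurd h hn
  have h' := (eventually_all_finset _).2 h
  obtain ⟨l, hl, hsub⟩ := (mem_nhdsLT_iff_exists_Ioo_subset' (sub_one_lt (1 / c))).1 h'
  refine ⟨max l (L / c), le_max_right _ _, max_lt hl (div_lt_div_of_pos_right hL hc),
    fun t ht ht' n hn => ?_⟩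
  exact hsub ⟨(le_max_left _ _).trans_lt ht, ht'⟩ n (Finset.mem_range.2 (by omega))

/-- After rescaling the disk to the unit ball, `h₀` is a point whose residue class is missed by all
of `S`. -/
theorem exists_norm_sub_eq_of_finset {S : Finset K} {a p : K} (hp : p ≠ a)
    (hS : ∀ s ∈ S, ‖s - a‖ ≤ ‖p - a‖) : ∃ h₀ : K, ∀ s ∈ S, ‖h₀ - s‖ = ‖p - a‖ := by
  classical
  have hpa : p - a ≠ 0 := sub_ne_zero.2 hp
  obtain ⟨u, -, hu⟩ := exists_norm_sub_eq_one (S.image fun s => (s - a) / (p - a)) (by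
    intro c hc
    obtain ⟨s, hs, rfl⟩ := Finset.mem_image.1 hc
    rw [norm_div, div_le_one (norm_pos_iff.2 hpa)]
    exact hS s hs)
  refine ⟨a + u * (p - a), fun s hs => ?_⟩
  rw [show a + u * (p - a) - s = (u - (s - a) / (p - a)) * (p - a) by field_simp; ring, norm_mul,
    hu _ (Finset.mem_image_of_mem _ hs), one_mul]

/-- If all zeros of the logarithmic derivative of `B / A` lie where `|B / A| ≥ 1 / ρ`, then the
annulus bound fails. -/
theorem AnnulusBound.exists_root_logNumerator {A B : K[X]} {L : ℝ} {d : ℕ}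
    (h : AnnulusBound A B L d) (hd : 2 ≤ d) (hAd : A.natDegree = d) (hBd : B.natDegree + 1 = d)
    (hAB : IsCoprime A B) (hchar : ∀ n : ℕ, 0 < n → n ≤ d → (n : K) ≠ 0)
    (hL : L = ‖B.leadingCoeff‖ / ‖A.leadingCoeff‖) (hL1 : L < 1) {a p : K}
    (haS : a ∈ divisorSupport A B) (hpS : p ∈ divisorSupport A B) (hpa : p ≠ a)
    (hmax : ∀ s ∈ divisorSupport A B, ‖s - a‖ ≤ ‖p - a‖) :
    ∃ v, (logNumerator (divisorSupport A B) fun s => (divisorOrder A B s : K)).eval v = 0 ∧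
      ‖p - a‖ * ‖B.eval v‖ < ‖A.eval v‖ := by
  classical
  by_contra! hno
  set S := divisorSupport A B with hS
  set ρ := ‖p - a‖ with hρdef
  have hρ : 0 < ρ := norm_pos_iff.2 (sub_ne_zero.2 hpa)
  have hA : A ≠ 0 := by
    rintro rfl
    simp at hAd
    omega
  have hB : B ≠ 0 := by
    rintro rfl
    simp at hBd
    omega
  have hlA : 0 < ‖A.leadingCoeff‖ := norm_pos_iff.2 (leadingCoeff_ne_zero.2 hA)
  have hlB : 0 < ‖B.leadingCoeff‖ := norm_pos_iff.2 (leadingCoeff_ne_zero.2 hB)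
  have hL0 : 0 < L := by rw [hL]; positivity
  have hnotboth : ∀ z, A.eval z = 0 → B.eval z = 0 → False := fun z h1 h2 => by
    obtain ⟨e, f, hef⟩ := hAB
    have := congrArg (eval z) hef
    simp [h1, h2] at this
  have hord : ∀ s ∈ S, (divisorOrder A B s : K) ≠ 0 := fun s hs =>
    divisorOrder_cast_ne_zero hA hB hAB hAd.le (by omega) hchar hs
  have hord1 : ∀ s, ‖(divisorOrder A B s : K)‖ ≤ 1 := fun s =>
    IsUltrametricDist.norm_intCast_le_one K _
  obtain ⟨h₀, hh₀⟩ := exists_norm_sub_eq_of_finset hpa hmax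
  obtain ⟨u, hu, hu0⟩ := exists_forall_norm_sum_eq_one_of_sum_eq_zero hρ hpS haS rfl hh₀
  have hu1 : ∀ s ∈ S, ‖u s‖ = 1 := fun s hs => by
    simpa using hu {s} (Finset.singleton_subset_iff.2 hs) (Finset.singleton_nonempty s)
  set V := logNumerator S fun s => (divisorOrder A B s : K) with hV
  set H := logNumerator S u with hH
  have hSu : ‖∑ s ∈ S, u s‖ = 1 := hu S subset_rfl ⟨a, haS⟩
  have hSu0 : ∑ s ∈ S, u s ≠ 0 := norm_pos_iff.1 (by rw [hSu]; exact one_pos)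
  -- The total residue deg B - deg A = -1 is a unit in every residue characteristic, so `V` has full
  -- degree and a unimodular leading coefficient, like `H`.
  have hSn : ∑ s ∈ S, (divisorOrder A B s : K) = -1 := by
    have h1 := sum_divisorOrder A B (fun _ => True)
    rw [Multiset.countP_True, Multiset.countP_True,
      ← (IsAlgClosed.splits A).natDegree_eq_card_roots,
      ← (IsAlgClosed.splits B).natDegree_eq_card_roots, Finset.filter_true,
      show (B.natDegree : ℤ) - A.natDegree = -1 by omega] at h1
    have h2 := congrArg (Int.cast : ℤ → K) h1
    push_cast at h2
    exact h2
  have hSn0 : ∑ s ∈ S, (divisorOrder A B s : K) ≠ 0 := by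
    rw [hSn]
    exact neg_ne_zero.2 one_ne_zero
  have hVlead : ‖V.leadingCoeff‖ = 1 := by
    rw [hV, leadingCoeff_logNumerator hSn0, hSn, norm_neg, norm_one]
  have hHlead : ‖H.leadingCoeff‖ = 1 := by rw [hH, leadingCoeff_logNumerator hSu0, hSu]
  have hdeg : V.natDegree = H.natDegree := by
    rw [hV, hH, natDegree_logNumerator hSn0, natDegree_logNumerator hSu0]
  have hV0 : V ≠ 0 := leadingCoeff_ne_zero.1 (norm_pos_iff.1 (by rw [hVlead]; exact one_pos))
  have hH0 : H ≠ 0 := leadingCoeff_ne_zero.1 (norm_pos_iff.1 (by rw [hHlead]; exact one_pos))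
  have hVroots : ∀ v ∈ V.roots, 0 < ‖B.eval v‖ ∧ 0 < ‖A.eval v‖ ∧
      ‖A.eval v‖ ≤ ρ * ‖B.eval v‖ := fun v hv => by
    have hv0 : V.eval v = 0 := ((mem_roots hV0).1 hv).eq_zero
    have hvS : v ∉ S := fun hvS => by
      rw [hV, eval_logNumerator_of_mem hvS] at hv0
      refine mul_ne_zero (hord v hvS) (Finset.prod_ne_zero_iff.2 fun s hs => ?_) hv0
      exact sub_ne_zero.2 (Finset.ne_of_mem_erase hs).symm
    rw [hS, mem_divisorSupport hA hB, not_or] at hvS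
    exact ⟨norm_pos_iff.2 hvS.2, norm_pos_iff.2 hvS.1, hno v hv0⟩
  have hh₀H : h₀ ∈ H.roots := by
    rw [mem_roots hH0, IsRoot.def, hH, eval_logNumerator_of_notMem, hu0, zero_mul]
    intro hmem
    have := hh₀ h₀ hmem
    rw [sub_self, norm_zero] at this
    exact hρ.ne this
  have hh₀A : ‖A.eval h₀‖ = ‖A.leadingCoeff‖ * ρ ^ d := by
    rw [norm_eval_eq_of_sphere fun α hα =>
      hh₀ α (Finset.mem_union_left _ (Multiset.mem_toFinset.2 hα)), hAd]
  have hh₀B : ‖B.eval h₀‖ = ‖B.leadingCoeff‖ * ρ ^ B.natDegree :=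
    norm_eval_eq_of_sphere fun α hα =>
      hh₀ α (Finset.mem_union_right _ (Multiset.mem_toFinset.2 hα))
  have hh₀AB : ρ * ‖B.eval h₀‖ = L * ‖A.eval h₀‖ := by
    rw [hh₀A, hh₀B, hL, ← hBd, pow_succ]
    field_simp
  have hh₀A0 : 0 < ‖A.eval h₀‖ := by rw [hh₀A]; positivity
  -- `|y|` is taken close enough to `1 / ρ` to keep the bounds for all multiplicities up to `d`, and
  -- off two finite sets: the values of `|B / A|` on the disks spanned by two points of `S`, and
  -- those at the zeros of `H`.
  obtain ⟨lo, hlo, hlo1, hlof⟩ := exists_lt_forall_lt_mul hρ hL1 d fun n => ‖(n : K)‖ ^ d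
  obtain ⟨lo', hi', hlolo, hlohi, hhi, hE⟩ := exists_Ioo_disjoint_finset
    ((S ×ˢ S).image (fun q => diskNorm q.1 ‖q.2 - q.1‖ B / diskNorm q.1 ‖q.2 - q.1‖ A) ∪
      H.roots.toFinset.image fun z => ‖B.eval z‖ / ‖A.eval z‖) hlo1
  have hlo0 : 0 < lo' := (div_pos hL0 hρ).trans_le (hlo.trans hlolo)
  obtain ⟨y, hy1, hy2⟩ := exists_norm_mem_Ioo (K := K) hlo0.le hlohi
  have hy0 : 0 < ‖y‖ := hlo0.trans hy1
  have hyne : y ≠ 0 := norm_pos_iff.1 hy0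
  have hyρ : ρ * ‖y‖ < 1 := by
    have := hy2.trans_le hhi
    rwa [lt_div_iff₀ hρ, mul_comm] at this
  have hyL : L < ρ * ‖y‖ := by
    have := hlo.trans_lt (hlolo.trans_lt hy1)
    rwa [div_lt_iff₀ hρ, mul_comm] at this
  have hyE : ∀ s₀ ∈ S, ∀ s₁ ∈ S, s₁ ≠ s₀ →
      diskNorm s₀ ‖s₁ - s₀‖ B ≠ ‖y‖ * diskNorm s₀ ‖s₁ - s₀‖ A := fun s₀ hs₀ s₁ hs₁ hne heq => by
    have hpos : 0 < diskNorm s₀ ‖s₁ - s₀‖ A :=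
      diskNorm_pos (norm_pos_iff.2 (sub_ne_zero.2 hne)) hA
    refine hE ‖y‖ (Finset.mem_union_left _ (Finset.mem_image.2
      ⟨(s₀, s₁), Finset.mk_mem_product hs₀ hs₁, ?_⟩)) ⟨hy1, hy2⟩
    rw [heq, mul_div_cancel_right₀ _ hpos.ne']
  have hyH : ∀ z ∈ H.roots, ‖B.eval z‖ ≠ ‖y * A.eval z‖ := fun z hz heq => by
    rw [norm_mul] at heq
    have hAz : ‖A.eval z‖ ≠ 0 := fun h0 => by
      rw [h0, mul_zero] at heq
      exact hnotboth z (norm_eq_zero.1 h0) (norm_eq_zero.1 heq)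
    refine hE ‖y‖ (Finset.mem_union_right _ (Finset.mem_image.2
      ⟨z, Multiset.mem_toFinset.2 hz, ?_⟩)) ⟨hy1, hy2⟩
    rw [heq, mul_div_cancel_right₀ _ hAz]
  -- Its zeros form the fibre of `A / B` over the inverse of `y`, a value of size just above `ρ`.
  set G := B - C y * A with hG
  have hGeval : ∀ z, G.eval z = B.eval z - y * A.eval z := fun z => by simp [hG]
  have hGdeg : G.natDegree = d := by
    have h1 : (C y * A).natDegree = d := by rw [natDegree_C_mul hyne, hAd]
    rw [hG, natDegree_sub_eq_right_of_natDegree_lt (by omega), h1]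
  have hG0 : G ≠ 0 := by
    intro h0
    rw [h0, natDegree_zero] at hGdeg
    omega
  have hlG : 0 < ‖G.leadingCoeff‖ := norm_pos_iff.2 (leadingCoeff_ne_zero.2 hG0)
  have hGcard : Multiset.card G.roots = d := by
    rw [← (IsAlgClosed.splits G).natDegree_eq_card_roots, hGdeg]
  have hprodV : (V.roots.map fun v => ‖G.eval v‖).prod = (V.roots.map fun v => ‖B.eval v‖).prod := by
    congr 1
    refine Multiset.map_congr rfl fun v hv => ?_
    obtain ⟨hv1, hv2, hv3⟩ := hVroots v hv
    rw [hGeval, norm_sub_eq_left]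
    rw [norm_mul]
    nlinarith
  -- At `h₀` the term `y A` dominates, since `|B / A|` equals `L / ρ` there and this is less than
  -- `|y|`. At the other zeros of `H` the choice of `y` rules out cancellation, and so `|B| ≤ |G|`.
  have hprodH : ρ * ‖y‖ * (H.roots.map fun z => ‖B.eval z‖).prod ≤
      L * (H.roots.map fun z => ‖G.eval z‖).prod := by
    rw [← Multiset.cons_erase hh₀H, Multiset.map_cons, Multiset.prod_cons, Multiset.map_cons,
      Multiset.prod_cons]
    have h1 : ‖G.eval h₀‖ = ‖y‖ * ‖A.eval h₀‖ := by
      rw [hGeval, norm_sub_eq_right, norm_mul]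
      rw [norm_mul]
      have : ρ * ‖B.eval h₀‖ < ρ * (‖y‖ * ‖A.eval h₀‖) := by
        rw [hh₀AB, ← mul_assoc]
        gcongr
      exact lt_of_mul_lt_mul_left this hρ.le
    have h2 : ((H.roots.erase h₀).map fun z => ‖B.eval z‖).prod ≤
        ((H.roots.erase h₀).map fun z => ‖G.eval z‖).prod := by
      refine multiset_prod_map_le (fun _ _ => norm_nonneg _) fun z hz => ?_
      have hzH := Multiset.mem_of_mem_erase hz
      rw [hGeval]
      rcases lt_or_gt_of_ne (hyH z hzH) with h3 | h3
      · rw [norm_sub_eq_right h3]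
        exact h3.le
      · rw [norm_sub_eq_left h3]
    calc _ = (ρ * ‖B.eval h₀‖) * ‖y‖ * ((H.roots.erase h₀).map fun z => ‖B.eval z‖).prod := by ring
      _ ≤ (ρ * ‖B.eval h₀‖) * ‖y‖ * ((H.roots.erase h₀).map fun z => ‖G.eval z‖).prod := by
        gcongr
      _ = _ := by
        rw [hh₀AB, h1]
        ring
  -- Integer coefficients have norm at most 1, generic ones exactly 1; the remaining factors at `β`
  -- agree.
  have hVB : ∀ β ∈ B.roots, ‖V.eval β‖ ≤ ‖H.eval β‖ := fun β hβ => by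
    have hβS : β ∈ S := Finset.mem_union_right _ (Multiset.mem_toFinset.2 hβ)
    rw [hV, hH, eval_logNumerator_of_mem hβS, eval_logNumerator_of_mem hβS, norm_mul, norm_mul,
      hu1 β hβS]
    gcongr
    exact hord1 β
  have hprod : ρ * ‖y‖ * (G.roots.map fun x => ‖V.eval x‖).prod ≤
      L * (G.roots.map fun x => ‖H.eval x‖).prod := by
    have e1 := prod_norm_eval_roots V G
    have e2 := prod_norm_eval_roots H G
    rw [hVlead, one_pow, one_mul, hprodV] at e1
    rw [hHlead, one_pow, one_mul] at e2
    have e3 := prod_norm_eval_roots_le hdeg hVlead hHlead hVB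
    refine le_of_mul_le_mul_left ?_ (pow_pos hlG V.natDegree)
    calc _ = ρ * ‖y‖ * (V.roots.map fun v => ‖B.eval v‖).prod := by
          rw [← e1]
          ring
      _ ≤ ρ * ‖y‖ * (H.roots.map fun z => ‖B.eval z‖).prod := by gcongr
      _ ≤ _ := hprodH
      _ = _ := by
        rw [← e2, hdeg]
        ring
  -- `G` has exactly `d` zeros: if the `d`-th power inequality failed at each, multiplying would
  -- contradict the `d`-th power of `hprod`. This is the source of the exponent `d` in the theorem.
  obtain ⟨x, hx, hxd⟩ : ∃ x ∈ G.roots, ρ * ‖y‖ * ‖V.eval x‖ ^ d ≤ L * ‖H.eval x‖ ^ d := by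
    by_contra! hcon
    have hne : G.roots ≠ 0 := by
      intro h0
      rw [h0, Multiset.card_zero] at hGcard
      omega
    have h1 := multiset_prod_map_lt hne (fun x _ => by positivity) hcon
    simp only [Multiset.prod_map_mul, Multiset.map_const', Multiset.prod_replicate, hGcard,
      Multiset.prod_map_pow] at h1
    rw [← mul_pow, ← mul_pow] at h1
    have h2 : 0 ≤ (G.roots.map fun x => ‖V.eval x‖).prod := Multiset.prod_nonneg fun b hb => by
      obtain ⟨x, -, rfl⟩ := Multiset.mem_map.1 hb
      exact norm_nonneg _
    exact absurd (pow_le_pow_left₀ (by positivity) hprod d) (not_le.2 h1)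
  have hxy : B.eval x = y * A.eval x := by
    have := ((mem_roots hG0).1 hx).eq_zero
    rw [hGeval] at this
    exact sub_eq_zero.1 this
  have hxA : A.eval x ≠ 0 := fun h0 => hnotboth x h0 (by rw [hxy, h0, mul_zero])
  have hxB : B.eval x ≠ 0 := by
    rw [hxy]
    exact mul_ne_zero hyne hxA
  have hxS : x ∉ S := by
    rw [hS, mem_divisorSupport hA hB, not_or]
    exact ⟨hxA, hxB⟩
  obtain ⟨s₀, hs₀, hmin⟩ := Finset.exists_min_image S (fun s => ‖x - s‖) ⟨a, haS⟩
  have hxs₀ : x ≠ s₀ := fun heq => hxS (heq ▸ hs₀)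
  have hgen := dist_ne_of_generic hs₀ hxy hmin (hyE s₀ hs₀) hxs₀
  obtain ⟨m, hm, hmL, hmn⟩ := h.lt_of_generic hA hB
    (fun s hs h0 => hord s hs (by rw [h0, Int.cast_zero])) hs₀ hxy (hyE s₀ hs₀) hxs₀ hgen
  -- `|A|` and `|B|` are constant on this circle, so at a zero of `V` on it `|B / A|` would equal
  -- `|y|`, below `1 / ρ`, against the assumption on the zeros of `V`.
  have hVsphere : ∀ v ∈ V.roots, ‖v - s₀‖ ≠ ‖x - s₀‖ := fun v hv heq => by
    obtain ⟨hv1, hv2, hv3⟩ := hVroots v hv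
    have hdn : ∀ P : K[X], (∀ α ∈ P.roots, α ∈ S) → ‖P.eval v‖ = ‖P.eval x‖ := fun P hP => by
      rw [norm_eval_eq_diskNorm_of_ne (c := s₀) (x := v)
          (fun α hα => by rw [heq]; exact hgen α (hP α hα)),
        norm_eval_eq_diskNorm_of_ne (c := s₀) (x := x) (fun α hα => hgen α (hP α hα)), heq]
    rw [hdn A fun α hα => Finset.mem_union_left _ (Multiset.mem_toFinset.2 hα),
      hdn B fun α hα => Finset.mem_union_right _ (Multiset.mem_toFinset.2 hα), hxy, norm_mul] at hv3
    have := norm_pos_iff.2 hxA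
    nlinarith
  have hle := norm_sum_filter_mul_le hu hs₀ hxs₀ hmin hgen hVsphere
  rw [hmn] at hle
  have hHx : 0 < ‖H.eval x‖ := by
    rw [hH, eval_logNumerator_of_notMem hxS, norm_mul, norm_prod,
      norm_sum_div_eq_of_generic hu hs₀ hxs₀ hmin hgen]
    have h1 : 0 < ‖x - s₀‖ := norm_pos_iff.2 (sub_ne_zero.2 hxs₀)
    have h2 : 0 < ∏ s ∈ S, ‖x - s‖ := Finset.prod_pos fun s hs => h1.trans_le (hmin s hs)
    positivity
  -- At `x` the multiplicity satisfies L < |m|^d ρ |y|, opposite to what the comparison with `H`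
  -- gives.
  have hfin := hlof ‖y‖ (hlolo.trans_lt hy1) (hy2.trans_le hhi) m
    (by rw [hAd] at hm; omega) hmL
  have h1 : (‖(m : K)‖ * ‖H.eval x‖) ^ d ≤ ‖V.eval x‖ ^ d :=
    pow_le_pow_left₀ (by positivity) hle d
  rw [mul_pow] at h1
  have h2 : (‖(m : K)‖ ^ d * (ρ * ‖y‖)) * ‖H.eval x‖ ^ d ≤ L * ‖H.eval x‖ ^ d := by
    refine le_trans ?_ hxd
    calc _ = ρ * ‖y‖ * (‖(m : K)‖ ^ d * ‖H.eval x‖ ^ d) := by ring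
      _ ≤ _ := by gcongr
  exact absurd (le_of_mul_le_mul_right h2 (pow_pos hHx d)) (not_le.2 hfin)

end Core

section Core

variable {K : Type*} [NontriviallyNormedField K] [IsUltrametricDist K] [IsAlgClosed K]

/-- The radius is the distance from the pole `a` to the farthest zero or pole; it is positive
because a zero exists and differs from `a`. All orders are nonzero in `K`, so the root of the
numerator lies off the support and is a genuine critical point with finite nonzero value. -/
theorem AnnulusBound.exists_critical {A B : K[X]} {L : ℝ} {d : ℕ}
    (h : AnnulusBound A B L d) (hd : 2 ≤ d) (hAd : A.natDegree = d) (hBd : B.natDegree + 1 = d)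
    (hAB : IsCoprime A B) (hchar : ∀ n : ℕ, 0 < n → n ≤ d → (n : K) ≠ 0)
    (hL : L = ‖B.leadingCoeff‖ / ‖A.leadingCoeff‖) {a : K} (ha : B.eval a = 0) :
    ∃ ρ : ℝ, 0 < ρ ∧ L < 1 ∧
      (∀ z, ρ < ‖z - a‖ → B.eval z ≠ 0 ∧ ‖A.eval z‖ * L = ‖z - a‖ * ‖B.eval z‖) ∧
      (∀ z w, ρ < ‖z - a‖ → ρ < ‖w - a‖ → A.eval z * B.eval w = A.eval w * B.eval z → z = w) ∧
      ∃ v, B.eval v ≠ 0 ∧ ρ * ‖B.eval v‖ < ‖A.eval v‖ ∧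
        A.derivative.eval v * B.eval v = A.eval v * B.derivative.eval v := by
  classical
  have hA : A ≠ 0 := by
    rintro rfl
    simp at hAd
    omega
  have hB : B ≠ 0 := by
    rintro rfl
    simp at hBd
    omega
  set S := divisorSupport A B with hS
  have haS : a ∈ S := (mem_divisorSupport hA hB).2 (Or.inr ha)
  obtain ⟨α, hα⟩ := IsAlgClosed.exists_root A
    (natDegree_pos_iff_degree_pos.1 (by omega : 0 < A.natDegree)).ne'
  have hαS : α ∈ S := (mem_divisorSupport hA hB).2 (Or.inl hα)
  have hαa : α ≠ a := by
    rintro rfl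
    obtain ⟨e, f, hef⟩ := hAB
    have := congrArg (eval α) hef
    simp [ha, hα.eq_zero] at this
  obtain ⟨p, hpS, hmax⟩ := Finset.exists_max_image S (fun s => ‖s - a‖) ⟨a, haS⟩
  have hρ : 0 < ‖p - a‖ := (norm_pos_iff.2 (sub_ne_zero.2 hαa)).trans_le (hmax α hαS)
  have hpa : p ≠ a := sub_ne_zero.1 (norm_pos_iff.1 hρ)
  obtain ⟨hL1, hfar, hinj⟩ := h.injective_of_far hAd hBd hA hB hL hρ hmax
  obtain ⟨v, hv, hvρ⟩ := h.exists_root_logNumerator hd hAd hBd hAB hchar hL hL1 haS hpS hpa hmax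
  have hvS : v ∉ S := fun hvS => by
    rw [eval_logNumerator_of_mem hvS] at hv
    refine mul_ne_zero (divisorOrder_cast_ne_zero hA hB hAB hAd.le (by omega) hchar hvS)
      (Finset.prod_ne_zero_iff.2 fun s hs => ?_) hv
    exact sub_ne_zero.2 (Finset.ne_of_mem_erase hs).symm
  have hvAB := hvS
  rw [hS, mem_divisorSupport hA hB, not_or] at hvAB
  rw [eval_logNumerator_of_notMem hvS] at hv
  have hsum := (mul_eq_zero.1 hv).resolve_right (Finset.prod_ne_zero_iff.2 fun s hs =>
    sub_ne_zero.2 fun h => hvS (h ▸ hs))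
  rw [sum_divisorOrder_div hvAB.1 hvAB.2, sub_eq_zero, div_eq_div_iff hvAB.2 hvAB.1] at hsum
  exact ⟨‖p - a‖, hρ, hL1, hfar, hinj, v, hvAB.2, hvρ, by linear_combination -hsum⟩

end Core

/-! ### Dynamics near a fixed point at infinity -/

section Dynamics

variable {K : Type*} [NontriviallyNormedField K] [IsUltrametricDist K] [IsAlgClosed K]

omit [IsUltrametricDist K] [IsAlgClosed K] in
theorem finsum_rootMultiplicity {G : K[X]} (p : K → Prop) [DecidablePred p] :
    ∑ᶠ z ∈ {z | p z}, G.rootMultiplicity z = G.roots.countP p := by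
  classical
  rw [finsum_mem_eq_sum_of_inter_support_eq (t := G.roots.toFinset.filter p)]
  · simp only [← count_roots]
    exact sum_count_filter (fun s hs => Multiset.mem_toFinset.2 hs) p
  · ext z
    simp only [Set.mem_inter_iff, Set.mem_ofPred_eq, Function.mem_support, Finset.coe_filter,
      Multiset.mem_toFinset, ← count_roots, Multiset.count_ne_zero]
    tauto

omit [IsUltrametricDist K] [IsAlgClosed K] in
/-- Transport of a fibre count from an affine coordinate `M` on the projective line. -/
theorem mapsWithMult_image {φ : RatFunc K} {A B : K[X]} {M : K → OnePoint K}
    (hM : Function.Injective M) {T : K → Prop} [DecidablePred T] {m : ℕ}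
    (hB : ∀ z, T z → B.eval z ≠ 0)
    (hφ : ∀ z, B.eval z ≠ 0 → ratEval φ (M z) = M (A.eval z / B.eval z))
    (hmult : ∀ y z, T z → fiberMult φ (M y) (M z) = (A - C y * B).rootMultiplicity z)
    (hc : ∀ y z, T z → A.eval z = y * B.eval z → (A - C y * B).roots.countP T = m) :
    MapsWithMult φ (M '' {z | T z}) m := by
  rintro _ ⟨_, ⟨z, hz, rfl⟩, rfl⟩
  have hBz := hB z hz
  rw [hφ z hBz, finsum_mem_image hM.injOn,
    ← hc (A.eval z / B.eval z) z hz (by field_simp), ← finsum_rootMultiplicity]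
  exact finsum_mem_congr rfl fun w hw => hmult _ w hw

/-- The theorem for a rational function read in an affine coordinate `M` for which the fixed point
is at infinity. -/
theorem exists_disk_of_coordinate {φ : RatFunc K} {γ : OnePoint K} {M : K → OnePoint K}
    {A B : K[X]} {L : ℝ} {d : ℕ} (hM : Function.Injective M) (hMγ : ∀ z, M z ≠ γ)
    (hγ : ratEval φ γ = γ)
    (hφ : ∀ z, B.eval z ≠ 0 → ratEval φ (M z) = M (A.eval z / B.eval z))
    (hconv : ∀ V : Set (OnePoint K), IsOpenDisk V → γ ∈ V → ∃ T : ℝ, ∀ z, T < ‖z‖ → M z ∈ V)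
    (hdisk : ∀ (a : K) (ρ : ℝ), 0 < ρ → IsDisk (insert γ (M '' {z | ρ < ‖z - a‖})))
    (hcrit : ∀ v, B.eval v ≠ 0 →
      A.derivative.eval v * B.eval v = A.eval v * B.derivative.eval v → IsCriticalPoint φ (M v))
    (h : AnnulusBound A B L d) (hd : 2 ≤ d) (hAd : A.natDegree = d) (hBd : B.natDegree + 1 = d)
    (hAB : IsCoprime A B) (hchar : ∀ n : ℕ, 0 < n → n ≤ d → (n : K) ≠ 0)
    (hL : L = ‖B.leadingCoeff‖ / ‖A.leadingCoeff‖) :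
    ∃ U : Set (OnePoint K), IsDisk U ∧ γ ∈ U ∧ Set.MapsTo (ratEval φ) U U ∧
      Set.InjOn (ratEval φ) U ∧ (∀ x ∈ U, Attracts φ γ x) ∧
      ∃ c : OnePoint K, IsCriticalPoint φ c ∧ ratEval φ c ∈ U ∧
        StrictlyAttracts φ γ (ratEval φ c) := by
  have hA : A ≠ 0 := by
    rintro rfl
    simp at hAd
    omega
  have hB : B ≠ 0 := by
    rintro rfl
    simp at hBd
    omega
  have hL0 : 0 < L := by
    have h1 := norm_pos_iff.2 (leadingCoeff_ne_zero.2 hA)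
    have h2 := norm_pos_iff.2 (leadingCoeff_ne_zero.2 hB)
    rw [hL]
    positivity
  -- The same `a` serves as center in the source and as the value subtracted in the target, so the
  -- expansion of the distance to `a` can be iterated; being a pole, it lies in the support used for
  -- `ρ`.
  obtain ⟨a, ha⟩ := IsAlgClosed.exists_root B
    (natDegree_pos_iff_degree_pos.1 (by omega : 0 < B.natDegree)).ne'
  have hlt : (C a * B).natDegree < A.natDegree := by
    have := natDegree_C_mul_le a B
    omega
  have hlead : (A - C a * B).leadingCoeff = A.leadingCoeff :=
    leadingCoeff_sub_of_degree_lt (degree_lt_degree hlt)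
  have hco := hAB.add_mul_right_left (-C a)
  rw [neg_mul, ← sub_eq_add_neg] at hco
  obtain ⟨ρ, hρ, hL1, hfar, hinj, v, hvB, hvρ, hvd⟩ := (h.sub_C_mul a).exists_critical hd
    (by rw [natDegree_sub_eq_left_of_natDegree_lt hlt, hAd]) hBd
    hco hchar (by rw [hlead]; exact hL) ha
  simp only [eval_sub, eval_mul, eval_C, derivative_sub, derivative_mul, derivative_C, zero_mul,
    zero_add] at hfar hinj hvρ hvd
  set F : K → K := fun z => A.eval z / B.eval z with hF
  have hFsub : ∀ z, B.eval z ≠ 0 → F z - a = (A.eval z - a * B.eval z) / B.eval z := fun z hz => by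
    rw [hF]
    field_simp
  have hstep : ∀ z, ρ < ‖z - a‖ → ‖F z - a‖ * L = ‖z - a‖ := fun z hz => by
    obtain ⟨h1, h2⟩ := hfar z hz
    rw [hFsub z h1, norm_div, div_mul_eq_mul_div, h2,
      mul_div_cancel_right₀ _ (norm_pos_iff.2 h1).ne']
  have hstep' : ∀ z, ρ < ‖z - a‖ → ρ < ‖F z - a‖ := fun z hz => by
    have := hstep z hz
    nlinarith [norm_nonneg (F z - a)]
  have hφF : ∀ z, ρ < ‖z - a‖ → ratEval φ (M z) = M (F z) := fun z hz => hφ z (hfar z hz).1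
  have hiter : ∀ z, ρ < ‖z - a‖ → ∀ n, ∃ w, (ratEval φ)^[n] (M z) = M w ∧ ρ < ‖w - a‖ ∧
      ‖w - a‖ * L ^ n = ‖z - a‖ := fun z hz n => by
    induction n with
    | zero => exact ⟨z, rfl, hz, by simp⟩
    | succ n ih =>
      obtain ⟨w, h1, h2, h3⟩ := ih
      refine ⟨F w, ?_, hstep' w h2, ?_⟩
      · rw [Function.iterate_succ_apply', h1, hφF w h2]
      · rw [pow_succ', ← mul_assoc, hstep w h2, h3]
  have hattr : ∀ z, ρ < ‖z - a‖ → Attracts φ γ (M z) := fun z hz V hV hγV => by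
    obtain ⟨T, hT⟩ := hconv V hV hγV
    have hlim : Tendsto (fun n : ℕ => ‖z - a‖ * (L⁻¹) ^ n) atTop atTop :=
      (tendsto_pow_atTop_atTop_of_one_lt (one_lt_inv₀ hL0 |>.2 hL1)).const_mul_atTop (hρ.trans hz)
    filter_upwards [hlim.eventually_gt_atTop (T + ‖a‖)] with n hn
    obtain ⟨w, h1, -, h3⟩ := hiter z hz n
    rw [h1]
    refine hT w ?_
    have h4 : ‖z - a‖ * (L⁻¹) ^ n = ‖w - a‖ := by
      rw [← h3, inv_pow, mul_assoc, mul_inv_cancel₀ (pow_pos hL0 n).ne', mul_one]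
    have := norm_sub_le w a
    linarith
  have hvU : ρ < ‖F v - a‖ := by
    rw [hFsub v hvB, norm_div, lt_div_iff₀ (norm_pos_iff.2 hvB)]
    exact hvρ
  refine ⟨insert γ (M '' {z | ρ < ‖z - a‖}), hdisk a ρ hρ, Set.mem_insert _ _, ?_, ?_, ?_,
    M v, hcrit v hvB (by linear_combination hvd), ?_, ?_, ?_⟩
  · rintro x (rfl | ⟨z, hz, rfl⟩)
    · rw [hγ]
      exact Set.mem_insert _ _
    · rw [hφF z hz]
      exact Set.mem_insert_of_mem _ ⟨F z, hstep' z hz, rfl⟩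
  · rintro x (rfl | ⟨z, hz, rfl⟩) x' (rfl | ⟨w, hw, rfl⟩) hxx'
    · rfl
    · rw [hγ, hφF w hw] at hxx'
      exact absurd hxx'.symm (hMγ _)
    · rw [hγ, hφF z hz] at hxx'
      exact absurd hxx' (hMγ _)
    · rw [hφF z hz, hφF w hw] at hxx'
      have h1 := hM hxx'
      have hzB := (hfar z hz).1
      have hwB := (hfar w hw).1
      rw [hF] at h1
      simp only at h1
      rw [div_eq_div_iff hzB hwB] at h1
      rw [hinj z w hz hw (by linear_combination h1)]
  · rintro x (rfl | ⟨z, hz, rfl⟩)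
    · intro V _ hV
      exact Eventually.of_forall fun n => by
        change (ratEval φ)^[n] x ∈ V
        rwa [Function.iterate_fixed hγ]
    · exact hattr z hz
  · rw [hφ v hvB]
    exact Set.mem_insert_of_mem _ ⟨F v, hvU, rfl⟩
  · rw [hφ v hvB]
    exact hattr _ hvU
  · intro l _
    rw [hφ v hvB]
    obtain ⟨w, h1, -, -⟩ := hiter (F v) hvU l
    rw [h1]
    exact hMγ w

end Dynamics

/-! ### Points of the Berkovich affine line -/

section Points

variable {K : Type*} [NontriviallyNormedField K]

/-- Multiplicativity alone is required, so this applies to seminorms and to the Gauss norm alike. -/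
theorem map_eq_leadingCoeff_mul_prod_roots [IsAlgClosed K] {F : Type*} [FunLike F K[X] ℝ]
    [MonoidHomClass F K[X] ℝ] (g : F) (P : K[X]) :
    g P = g (C P.leadingCoeff) * (P.roots.map fun α => g (X - C α)).prod := by
  conv_lhs => rw [(IsAlgClosed.splits P).eq_prod_roots]
  rw [map_mul, map_multiset_prod, Multiset.map_map]
  rfl

/-- Both sides are multiplicative, so constants and linear factors suffice. The root formula makes
multiplicativity and continuity in `r` visible; the Gauss norm supplies the triangle inequality. -/
theorem gaussNorm_comp_eq_diskNorm [IsUltrametricDist K] [IsAlgClosed K] (c : K) {r : ℝ}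
    (hr : 0 < r) (P : K[X]) :
    (P.comp (X + C c)).gaussNorm (NormedField.toAbsoluteValue K) r = diskNorm c r P := by
  have hna : IsNonarchimedean (NormedField.toAbsoluteValue K) :=
    IsUltrametricDist.isNonarchimedean_norm
  let g : K[X] →* ℝ :=
    { toFun := fun P => (P.comp (X + C c)).gaussNorm (NormedField.toAbsoluteValue K) r
      map_one' := by
        rw [one_comp, ← C_1, gaussNorm_C, map_one]
      map_mul' := fun P Q => by
        rw [mul_comp, gaussNorm_mul hna hr] }
  change g P = _
  rw [map_eq_leadingCoeff_mul_prod_roots g P, diskNorm]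
  congr 1
  · change ((C P.leadingCoeff).comp (X + C c)).gaussNorm (NormedField.toAbsoluteValue K) r = _
    rw [C_comp, gaussNorm_C]
    rfl
  · congr 1
    refine Multiset.map_congr rfl fun α _ => ?_
    change ((X - C α).comp (X + C c)).gaussNorm (NormedField.toAbsoluteValue K) r = _
    have e : (X - C α).comp (X + C c) = monomial 1 1 + C (c - α) := by
      rw [sub_comp, X_comp, C_comp, C_sub, monomial_one_one_eq_X]
      ring
    rw [e]
    apply le_antisymm
    · refine (isNonarchimedean_gaussNorm _ hna hr.le _ _).trans ?_
      rw [gaussNorm_monomial, gaussNorm_C, map_one, one_mul, pow_one, norm_sub_rev]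
      rfl
    · refine max_le ?_ ?_
      · refine le_trans ?_ (le_gaussNorm _ _ hr.le 1)
        simp
      · refine le_trans ?_ (le_gaussNorm _ _ hr.le 0)
        simp only [coeff_add, coeff_monomial, coeff_C]
        simp [NormedField.toAbsoluteValue, norm_sub_rev]

theorem diskNorm_of_nonpos [IsAlgClosed K] (c : K) {r : ℝ} (hr : r ≤ 0) (P : K[X]) :
    diskNorm c r P = ‖P.eval c‖ :=
  (norm_eval_eq_diskNorm fun α _ => by
    rw [max_eq_right (hr.trans (norm_nonneg _)), norm_sub_rev]).symm

theorem diskNorm_add_le [IsUltrametricDist K] [IsAlgClosed K] (c : K) (r : ℝ) (P Q : K[X]) :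
    diskNorm c r (P + Q) ≤ diskNorm c r P + diskNorm c r Q := by
  rcases le_or_gt r 0 with hr | hr
  · simp only [diskNorm_of_nonpos c hr, eval_add]
    exact norm_add_le _ _
  · simp only [← gaussNorm_comp_eq_diskNorm c hr, add_comp]
    exact ((gaussNorm_isAbsoluteValue (v := NormedField.toAbsoluteValue K)
      IsUltrametricDist.isNonarchimedean_norm hr).abv_add' _ _)

theorem diskNorm_C (c : K) (r : ℝ) (a : K) : diskNorm c r (C a) = ‖a‖ := by
  simp [diskNorm]

theorem diskNorm_X_sub_C (c : K) (r : ℝ) (a : K) : diskNorm c r (X - C a) = max r ‖a - c‖ := by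
  simp [diskNorm]

theorem diskNorm_mul (c : K) (r : ℝ) (P Q : K[X]) :
    diskNorm c r (P * Q) = diskNorm c r P * diskNorm c r Q := by
  rcases eq_or_ne (P * Q) 0 with h | h
  · rcases mul_eq_zero.1 h with h' | h' <;> simp [h', diskNorm]
  · rw [diskNorm, diskNorm, diskNorm, leadingCoeff_mul, roots_mul h, norm_mul, Multiset.map_add,
      Multiset.prod_add]
    ring

/-- The point of the Berkovich affine line given by the disk of center `c` and radius `r`; it is the
point `c` of type I when `r ≤ 0`. -/
def diskPoint [IsUltrametricDist K] [IsAlgClosed K] (c : K) (r : ℝ) : BerkA1 K :=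
  ⟨{ toFun := diskNorm c r
     map_zero' := by simp [diskNorm]
     add_le' := diskNorm_add_le c r
     neg' := fun P => by simp [diskNorm]
     map_one' := by rw [← C_1, diskNorm_C, norm_one]
     map_mul' := diskNorm_mul c r }, diskNorm_C c r⟩

theorem BerkA1.ext_of_X_sub_C [IsAlgClosed K] {ν μ : BerkA1 K}
    (h : ∀ a, ν.1 (X - C a) = μ.1 (X - C a)) : ν = μ := by
  refine Subtype.ext (DFunLike.ext _ _ fun P => ?_)
  rw [map_eq_leadingCoeff_mul_prod_roots ν.1, map_eq_leadingCoeff_mul_prod_roots μ.1, ν.2, μ.2]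
  simp only [h]

theorem BerkA1.nonneg (ν : BerkA1 K) (P : K[X]) : 0 ≤ ν.1 P := apply_nonneg ν.1 P

/-- Expand the n-th power binomially: binomial coefficients have norm at most 1, so the n-th power
of the ratio is at most n + 1 for every n. -/
theorem BerkA1.add_le_max [IsUltrametricDist K] (ν : BerkA1 K) (P Q : K[X]) :
    ν.1 (P + Q) ≤ max (ν.1 P) (ν.1 Q) := by
  set M := max (ν.1 P) (ν.1 Q) with hM
  have hM0 : 0 ≤ M := (ν.nonneg P).trans (le_max_left _ _)
  by_contra! hlt
  have hpos : 0 < M := by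
    refine hM0.lt_of_ne fun h0 => ?_
    have h1 := map_add_le_add ν.1 P Q
    have h2 : ν.1 P ≤ 0 := h0 ▸ le_max_left _ _
    have h3 : ν.1 Q ≤ 0 := h0 ▸ le_max_right _ _
    linarith
  obtain ⟨n, hn⟩ := Real.exists_natCast_add_one_lt_pow_of_one_lt ((one_lt_div hpos).2 hlt)
  rw [div_pow, lt_div_iff₀ (pow_pos hpos n)] at hn
  refine hn.not_ge ?_
  rw [← map_pow, add_pow]
  refine (Finset.le_sum_of_subadditive ν.1 (map_zero _).le (map_add_le_add ν.1) _ _).trans ?_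
  refine (Finset.sum_le_card_nsmul _ _ (M ^ n) fun k hk => ?_).trans ?_
  · have hk' : k ≤ n := Nat.lt_succ_iff.1 (Finset.mem_range.1 hk)
    rw [map_mul, map_mul, map_pow, map_pow, ← C_eq_natCast, ν.2]
    calc ν.1 P ^ k * ν.1 Q ^ (n - k) * ‖((n.choose k : ℕ) : K)‖
        ≤ M ^ k * M ^ (n - k) * 1 := by
          gcongr
          · exact le_max_left _ _
          · exact le_max_right _ _
          · exact IsUltrametricDist.norm_natCast_le_one K _
      _ = M ^ n := by rw [mul_one, ← pow_add, Nat.add_sub_cancel' hk']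
  · simp

end Points

/-! ### Directions at points of the Berkovich line given by disks -/

section Directions

variable {K : Type*} [NontriviallyNormedField K] [IsUltrametricDist K] [IsAlgClosed K]

theorem diskPoint_X_sub_C (c : K) (r : ℝ) (a : K) :
    (diskPoint c r).1 (X - C a) = max r ‖a - c‖ := diskNorm_X_sub_C c r a

theorem diskPoint_of_nonpos (c : K) {r : ℝ} (hr : r ≤ 0) : diskPoint c r = typeI c :=
  Subtype.ext (DFunLike.ext _ _ fun P => diskNorm_of_nonpos c hr P)

theorem diskPoint_eq_of_norm_sub_le {c x : K} {r : ℝ} (h : ‖x - c‖ ≤ r) :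
    diskPoint x r = diskPoint c r := by
  refine BerkA1.ext_of_X_sub_C fun a => ?_
  rw [diskPoint_X_sub_C, diskPoint_X_sub_C]
  have h1 : ‖a - x‖ ≤ max ‖a - c‖ ‖x - c‖ := by
    have := norm_sub_le_max (a - c) (x - c)
    rwa [sub_sub_sub_cancel_right] at this
  have h2 : ‖a - c‖ ≤ max ‖a - x‖ ‖x - c‖ := by
    have := norm_sub_le_max (a - x) (c - x)
    rwa [sub_sub_sub_cancel_right, norm_sub_rev c x] at this
  apply le_antisymm
  · exact max_le (le_max_left _ _)
      (h1.trans (max_le (le_max_right _ _) (h.trans (le_max_left _ _))))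
  · exact max_le (le_max_left _ _)
      (h2.trans (max_le (le_max_right _ _) (h.trans (le_max_left _ _))))

omit [IsUltrametricDist K] [IsAlgClosed K] in
theorem BerkA1.continuous_eval (P : K[X]) : Continuous fun ν : BerkA1 K => ν.1 P :=
  (continuous_apply P).comp continuous_induced_dom

theorem continuous_diskPoint (c : K) : Continuous (diskPoint c) := by
  refine continuous_induced_rng.2 (continuous_pi fun P => ?_)
  change Continuous fun r => diskNorm c r P
  unfold diskNorm
  exact continuous_const.mul
    (continuous_multiset_prod _ fun α _ => continuous_id.max continuous_const)

omit [IsUltrametricDist K] in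
-- Tychonoff: the seminorms form a closed subset of a product of lines, and a bound at one linear
-- polynomial bounds every coordinate through factorization.
theorem BerkA1.isCompact_of_isClosed_of_le {S : Set (BerkA1 K)} (hS : IsClosed S) (x : K) (r : ℝ)
    (h : ∀ ν ∈ S, ν.1 (X - C x) ≤ r) : IsCompact S := by
  set ι : BerkA1 K → K[X] → ℝ := fun ζ f => ζ.1 f with hι
  have hind : IsInducing ι := ⟨rfl⟩
  have hrange : IsClosed (Set.range ι) := by
    have : Set.range ι = {f | (∀ P Q, f (P + Q) ≤ f P + f Q)} ∩ {f | ∀ P, f (-P) = f P} ∩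
        {f | ∀ P Q, f (P * Q) = f P * f Q} ∩ {f | ∀ c : K, f (C c) = ‖c‖} := by
      ext f
      constructor
      · rintro ⟨ν, rfl⟩
        exact ⟨⟨⟨fun P Q => map_add_le_add ν.1 P Q, fun P => map_neg_eq_map ν.1 P⟩,
          fun P Q => map_mul ν.1 P Q⟩, ν.2⟩
      · rintro ⟨⟨⟨h1, h2⟩, h3⟩, h4⟩
        refine ⟨⟨{ toFun := f
                   map_zero' := by rw [← C_0, h4, norm_zero]
                   add_le' := h1
                   neg' := h2
                   map_one' := by rw [← C_1, h4, norm_one]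
                   map_mul' := h3 }, h4⟩, rfl⟩
    rw [this]
    refine ((IsClosed.inter ?_ ?_).inter ?_).inter ?_
    · simp only [Set.ofPred_forall]
      exact isClosed_iInter fun P => isClosed_iInter fun Q => isClosed_le (continuous_apply _)
        (Continuous.add (f := fun f : K[X] → ℝ => f P) (g := fun f => f Q)
          (continuous_apply P) (continuous_apply Q))
    · simp only [Set.ofPred_forall]
      exact isClosed_iInter fun P => isClosed_eq (continuous_apply _) (continuous_apply _)
    · simp only [Set.ofPred_forall]
      exact isClosed_iInter fun P => isClosed_iInter fun Q => isClosed_eq (continuous_apply _)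
        (Continuous.mul (f := fun f : K[X] → ℝ => f P) (g := fun f => f Q)
          (continuous_apply P) (continuous_apply Q))
    · simp only [Set.ofPred_forall]
      exact isClosed_iInter fun P => isClosed_eq (continuous_apply _) continuous_const
  obtain ⟨T, hT, rfl⟩ := hind.isClosed_iff.1 hS
  rw [hind.isCompact_iff, Set.image_preimage_eq_inter_range]
  refine (isCompact_univ_pi fun P : K[X] => isCompact_Icc (a := 0)
    (b := ‖P.leadingCoeff‖ * (P.roots.map fun α => r + ‖x - α‖).prod)).of_isClosed_subset
    (hT.inter hrange) ?_
  rintro _ ⟨hνT, ν, rfl⟩ P -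
  refine ⟨ν.nonneg P, ?_⟩
  change ν.1 P ≤ _
  rw [map_eq_leadingCoeff_mul_prod_roots ν.1 P, ν.2]
  refine mul_le_mul_of_nonneg_left ?_ (norm_nonneg _)
  refine Multiset.prod_map_le_prod_map₀ _ _ (fun α _ => ν.nonneg _) fun α _ => ?_
  have e : (X - C α : K[X]) = (X - C x) + C (x - α) := by rw [C_sub]; ring
  rw [e]
  refine (map_add_le_add ν.1 _ _).trans ?_
  rw [ν.2]
  exact add_le_add_left (h ν hνT) _

/-- The open disk of center `x` and radius `r` in the Berkovich affine line. -/
def berkDisk (x : K) (r : ℝ) : Set (BerkA1 K) := {ν | ν.1 (X - C x) < r}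

omit [IsUltrametricDist K] [IsAlgClosed K] in
theorem isOpen_berkDisk (x : K) (r : ℝ) : IsOpen (berkDisk x r) :=
  isOpen_lt (BerkA1.continuous_eval _) continuous_const

omit [IsAlgClosed K] in
theorem BerkA1.X_sub_C_le (ν : BerkA1 K) (x y : K) :
    ν.1 (X - C y) ≤ max (ν.1 (X - C x)) ‖x - y‖ := by
  have e : (X - C y : K[X]) = (X - C x) + C (x - y) := by rw [C_sub]; ring
  rw [e, ← ν.2]
  exact ν.add_le_max _ _

omit [IsAlgClosed K] in
theorem BerkA1.norm_sub_le (ν : BerkA1 K) (x y : K) :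
    ‖x - y‖ ≤ max (ν.1 (X - C x)) (ν.1 (X - C y)) := by
  have e : C (x - y) = (X - C y : K[X]) + -(X - C x) := by rw [C_sub]; ring
  rw [← ν.2, e, max_comm, ← map_neg_eq_map ν.1 (X - C x)]
  exact ν.add_le_max _ _

/-- Describes the disk with its boundary point by closed conditions: in the closed disk, the
equalities for `y` at distance `r` or more exclude all other open residue disks. -/
theorem insert_berkDisk_eq {x : K} {r : ℝ} (hr : 0 < r) :
    insert (diskPoint x r) (berkDisk x r) =
      {ν : BerkA1 K | ν.1 (X - C x) ≤ r} ∩ {ν | ∀ y, r ≤ ‖x - y‖ → ν.1 (X - C y) = ‖x - y‖} := by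
  ext ν
  constructor
  · rintro (rfl | h)
    · refine ⟨?_, fun y hy => ?_⟩
      · rw [Set.mem_ofPred_eq, diskPoint_X_sub_C]
        simp [hr.le]
      · rw [diskPoint_X_sub_C, norm_sub_rev, max_eq_right hy]
    · have h' : ν.1 (X - C x) < r := h
      refine ⟨h'.le, fun y hy => le_antisymm ?_ ?_⟩
      · exact (ν.X_sub_C_le x y).trans (max_le (by linarith) le_rfl)
      · rcases le_max_iff.1 (ν.norm_sub_le x y) with h1 | h1
        · linarith
        · exact h1
  · rintro ⟨h1, h2⟩
    rcases lt_or_eq_of_le (show ν.1 (X - C x) ≤ r from h1) with h | h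
    · exact Or.inr h
    · refine Or.inl (BerkA1.ext_of_X_sub_C fun y => ?_)
      rw [diskPoint_X_sub_C, norm_sub_rev]
      rcases le_or_gt r ‖x - y‖ with hy | hy
      · rw [h2 y hy, max_eq_right hy]
      · rw [max_eq_left hy.le]
        apply le_antisymm
        · exact (ν.X_sub_C_le x y).trans (max_le h.le hy.le)
        · have := ν.X_sub_C_le y x
          rw [h, norm_sub_rev] at this
          rcases le_max_iff.1 this with h3 | h3
          · exact h3
          · linarith

theorem isClosed_insert_berkDisk {x : K} {r : ℝ} (hr : 0 < r) :
    IsClosed (insert (diskPoint x r) (berkDisk x r)) := by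
  rw [insert_berkDisk_eq hr]
  refine (isClosed_le (BerkA1.continuous_eval _) continuous_const).inter ?_
  simp only [Set.ofPred_forall]
  exact isClosed_iInter fun y => isClosed_iInter fun _ =>
    isClosed_eq (BerkA1.continuous_eval _) continuous_const

theorem isCompact_insert_berkDisk {x : K} {r : ℝ} (hr : 0 < r) :
    IsCompact (insert (diskPoint x r) (berkDisk x r)) := by
  refine BerkA1.isCompact_of_isClosed_of_le (isClosed_insert_berkDisk hr) x r fun ν hν => ?_
  rw [insert_berkDisk_eq hr] at hν
  exact hν.1

/-- A connected set avoiding the boundary point of an open disk and meeting the disk is contained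
in the disk. -/
theorem subset_berkDisk_of_isPreconnected {x : K} {r : ℝ} (hr : 0 < r) {S : Set (BerkP1 K)}
    (hS : IsPreconnected S) (hSr : (OnePoint.some (diskPoint x r) : BerkP1 K) ∉ S)
    (hne : (S ∩ OnePoint.some '' berkDisk x r).Nonempty) : S ⊆ OnePoint.some '' berkDisk x r := by
  refine hS.subset_left_of_subset_union (OnePoint.isOpen_image_coe.2 (isOpen_berkDisk x r))
    (v := (OnePoint.some '' insert (diskPoint x r) (berkDisk x r))ᶜ) ?_ ?_ ?_ hne
  · exact (OnePoint.isClosed_image_coe.2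
      ⟨isClosed_insert_berkDisk hr, isCompact_insert_berkDisk hr⟩).isOpen_compl
  · exact Set.disjoint_compl_right_iff_subset.2 (Set.image_mono (Set.subset_insert _ _))
  · intro ξ hξ
    by_cases h : ξ ∈ OnePoint.some '' insert (diskPoint x r) (berkDisk x r)
    · rw [Set.image_insert_eq] at h
      rcases h with rfl | h
      · exact absurd hξ hSr
      · exact Or.inl h
    · exact Or.inr h

/-- The point of the Berkovich projective line given by the disk of center `c` and radius `r`. -/
def berkPoint (c : K) (r : ℝ) : BerkP1 K := OnePoint.some (diskPoint c r)

theorem toBerk_some (x : K) : toBerk (OnePoint.some x) = berkPoint x 0 := by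
  rw [berkPoint, diskPoint_of_nonpos x le_rfl]
  rfl

theorem berkPoint_eq_of_norm_sub_le {c x : K} {r : ℝ} (h : ‖x - c‖ ≤ r) :
    berkPoint x r = berkPoint c r := by
  rw [berkPoint, berkPoint, diskPoint_eq_of_norm_sub_le h]

theorem max_eq_of_berkPoint_eq {c x : K} {r s : ℝ} (h : berkPoint c r = berkPoint x s) (a : K) :
    max r ‖a - c‖ = max s ‖a - x‖ := by
  rw [← diskPoint_X_sub_C, ← diskPoint_X_sub_C, OnePoint.coe_injective h]

theorem berkPoint_injOn (c : K) {r s : ℝ} (hr : 0 ≤ r) (hs : 0 ≤ s)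
    (h : berkPoint c r = berkPoint c s) : r = s := by
  have := max_eq_of_berkPoint_eq h c
  simpa [hr, hs] using this

theorem mem_image_berkDisk {c x : K} {r s : ℝ} :
    berkPoint c r ∈ (OnePoint.some '' berkDisk x s : Set (BerkP1 K)) ↔ max r ‖x - c‖ < s := by
  rw [berkPoint, OnePoint.coe_injective.mem_set_image, berkDisk, Set.mem_ofPred_eq,
    diskPoint_X_sub_C]

theorem isPreconnected_berkPoint_image (c : K) (s t : ℝ) :
    IsPreconnected (berkPoint c '' Set.Icc s t) :=
  isPreconnected_Icc.image _ (OnePoint.continuous_coe.comp (continuous_diskPoint c)).continuousOn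

/-- The path of growing disks about `c` is connected; if it avoids `ζ`, its ends lie in one
direction. -/
theorem berkPoint_mem_component {ζ : BerkP1 K} {c : K} {s t : ℝ} (hst : s ≤ t)
    (h : ∀ r, s ≤ r → r ≤ t → berkPoint c r ≠ ζ) :
    berkPoint c s ∈ component ζ (berkPoint c t) ∧ berkPoint c t ∈ component ζ (berkPoint c s) := by
  have hsub : berkPoint c '' Set.Icc s t ⊆ {ζ}ᶜ := by
    rintro _ ⟨r, ⟨h1, h2⟩, rfl⟩
    exact h r h1 h2
  have hs : berkPoint c s ∈ berkPoint c '' Set.Icc s t := ⟨s, ⟨le_rfl, hst⟩, rfl⟩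
  have ht : berkPoint c t ∈ berkPoint c '' Set.Icc s t := ⟨t, ⟨hst, le_rfl⟩, rfl⟩
  exact ⟨(isPreconnected_berkPoint_image c s t).subset_connectedComponentIn ht hsub hs,
    (isPreconnected_berkPoint_image c s t).subset_connectedComponentIn hs hsub ht⟩

omit [IsUltrametricDist K] [IsAlgClosed K] in
theorem component_trans {ζ ξ η μ : BerkP1 K} (h : ξ ∈ component ζ η) (h' : η ∈ component ζ μ) :
    ξ ∈ component ζ μ := by
  rwa [component, connectedComponentIn_eq h']

theorem toBerk_mem_component_small_iff {c : K} {s t : ℝ} (hs : 0 < s) (hst : s < t)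
    (x : OnePoint K) :
    toBerk x ∈ component (berkPoint c t) (berkPoint c s) ↔
      x ∈ OnePoint.some '' {x : K | ‖x - c‖ < t} := by
  have hne : berkPoint c s ≠ berkPoint c t := fun h =>
    hst.ne (berkPoint_injOn c hs.le (hs.trans hst).le h)
  constructor
  · intro h
    have hsub : component (berkPoint c t) (berkPoint c s) ⊆ OnePoint.some '' berkDisk c t := by
      refine subset_berkDisk_of_isPreconnected (hs.trans hst) isPreconnected_connectedComponentIn
        (fun h => connectedComponentIn_subset _ _ h rfl)
        ⟨berkPoint c s, mem_connectedComponentIn hne, ?_⟩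
      rw [mem_image_berkDisk]
      simp [hst, hs.trans hst]
    have h' := hsub h
    induction x using OnePoint.rec with
    | infty => exact absurd h' OnePoint.infty_notMem_image_coe
    | coe x =>
      rw [toBerk_some, mem_image_berkDisk] at h'
      refine ⟨x, ?_, rfl⟩
      rw [Set.mem_ofPred_eq, norm_sub_rev]
      exact (le_max_right _ _).trans_lt h'
  · rintro ⟨x, hx, rfl⟩
    have hx' : ‖x - c‖ < t := hx
    rw [toBerk_some]
    have h1 := (berkPoint_mem_component (ζ := berkPoint c t) (c := x) (s := 0)
      (t := max s ‖x - c‖) (hs.le.trans (le_max_left _ _)) fun r _ hr h => by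
        have := max_eq_of_berkPoint_eq h x
        rw [sub_self, norm_zero, max_eq_left hx'.le] at this
        have h2 : max r 0 < t := max_lt (hr.trans_lt (max_lt hst hx')) (hs.trans hst)
        exact h2.ne this).1
    rw [berkPoint_eq_of_norm_sub_le (le_max_right _ _)] at h1
    refine component_trans h1 (berkPoint_mem_component (le_max_left _ _) fun r h1 h2 h => ?_).2
    have := berkPoint_injOn c (hs.le.trans h1) (hs.trans hst).le h
    exact (h2.trans_lt (max_lt hst hx')).ne this

/-- A point within distance `s` of `c` may be taken as center; its direction is then confined to an
open disk of radius `s`, which does not contain the larger disk point. A point farther away is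
joined to it by growing disks. -/
theorem toBerk_mem_component_large_iff {c : K} {s t : ℝ} (hs : 0 < s) (hst : s < t) (x : K) :
    toBerk (OnePoint.some x) ∈ component (berkPoint c s) (berkPoint c t) ↔ s < ‖x - c‖ := by
  have hne : berkPoint c t ≠ berkPoint c s := fun h =>
    hst.ne (berkPoint_injOn c hs.le (hs.trans hst).le h.symm)
  rw [toBerk_some]
  constructor
  · intro h
    by_contra! hx
    rw [← berkPoint_eq_of_norm_sub_le hx] at h
    have hsub : component (berkPoint x s) (berkPoint c t) ⊆ OnePoint.some '' berkDisk x s := by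
      refine subset_berkDisk_of_isPreconnected hs isPreconnected_connectedComponentIn
        (fun h => connectedComponentIn_subset _ _ h rfl) ⟨berkPoint x 0, h, ?_⟩
      rw [mem_image_berkDisk]
      simpa using hs
    rw [berkPoint_eq_of_norm_sub_le hx] at hsub
    have := hsub (mem_connectedComponentIn hne)
    rw [mem_image_berkDisk] at this
    linarith [le_max_left t ‖x - c‖]
  · intro hx
    have hT : t ≤ max t ‖x - c‖ := le_max_left _ _
    have h1 := (berkPoint_mem_component (ζ := berkPoint c s) (c := x) (s := 0)
      (t := max t ‖x - c‖) ((hs.trans hst).le.trans hT) fun r _ _ h => by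
        have := max_eq_of_berkPoint_eq h c
        rw [sub_self, norm_zero, max_eq_left hs.le, norm_sub_rev] at this
        linarith [le_max_right r ‖x - c‖]).1
    rw [berkPoint_eq_of_norm_sub_le (le_max_right _ _)] at h1
    refine component_trans h1 (berkPoint_mem_component hT fun r h1 h2 h => ?_).2
    have := berkPoint_injOn c ((hs.trans hst).le.trans h1) hs.le h
    linarith

theorem annulus_berkPoint {c : K} {s t : ℝ} (hs : 0 < s) (hst : s < t) :
    annulus (berkPoint c s) (berkPoint c t) =
      OnePoint.some '' {x : K | s < ‖x - c‖ ∧ ‖x - c‖ < t} := by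
  ext x
  rw [annulus, Set.mem_ofPred_eq, toBerk_mem_component_small_iff hs hst]
  constructor
  · rintro ⟨h, x, hx, rfl⟩
    exact ⟨x, ⟨(toBerk_mem_component_large_iff hs hst x).1 h, hx⟩, rfl⟩
  · rintro ⟨x, hx, rfl⟩
    exact ⟨(toBerk_mem_component_large_iff hs hst x).2 hx.1, x, hx.2, rfl⟩

/-- A point off the path of disks from radius `s` to radius `t` cannot separate its ends. -/
theorem exists_eq_berkPoint_of_strictlyBetween {c : K} {s t : ℝ} (hst : s < t)
    {ξ : BerkP1 K} (h : StrictlyBetween (berkPoint c s) (berkPoint c t) ξ) :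
    ∃ r, s < r ∧ r < t ∧ ξ = berkPoint c r := by
  obtain ⟨h1, h2, h3⟩ := h
  by_contra! hcon
  refine h3 (berkPoint_mem_component hst.le fun r hr hr' h => ?_).2
  rcases eq_or_lt_of_le hr with rfl | hr
  · exact h1 h.symm
  rcases eq_or_lt_of_le hr' with rfl | hr'
  · exact h2 h.symm
  exact hcon r hr hr' h.symm

/-- The directional multiplicity at the point of a disk can be computed on annuli of `K`. -/
theorem exists_direction_of_mapsWithMult {φ : RatFunc K} {c : K} {s t : ℝ} {m : ℕ} (hs : 0 < s)
    (hst : s < t) (h : ∀ r, s < r → r ≤ t →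
      MapsWithMult φ (OnePoint.some '' {x : K | s < ‖x - c‖ ∧ ‖x - c‖ < r}) m) :
    ∃ (ζ : BerkP1 K) (v : Set (BerkP1 K)), IsDirection ζ v ∧ HasDirectionalDegree φ ζ v m := by
  have hne : berkPoint c t ≠ berkPoint c s := fun h =>
    hst.ne (berkPoint_injOn c hs.le (hs.trans hst).le h.symm)
  refine ⟨berkPoint c s, component (berkPoint c s) (berkPoint c t), ⟨_, hne, rfl⟩,
    berkPoint c t, mem_connectedComponentIn hne, fun ξ hξ => ?_⟩
  obtain ⟨r, hr, hrt, rfl⟩ := exists_eq_berkPoint_of_strictlyBetween hst hξ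
  rw [annulus_berkPoint hs hr]
  exact h r hr hrt.le

end Directions

/-! ### Fixed points at infinity -/

section Algebra

variable {K : Type*} [Field K]

open Classical in
theorem ratEval_some (φ : RatFunc K) (x : K) : ratEval φ (OnePoint.some x) =
    if φ.denom.eval x = 0 then OnePoint.infty
    else OnePoint.some (φ.num.eval x / φ.denom.eval x) := rfl

open Classical in
theorem ratEval_infty (φ : RatFunc K) : ratEval φ OnePoint.infty =
    if φ.denom.coeff (ratDegree φ) = 0 then OnePoint.infty
    else OnePoint.some (φ.num.coeff (ratDegree φ) / φ.denom.coeff (ratDegree φ)) := rfl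

theorem natDegree_num_le (φ : RatFunc K) : φ.num.natDegree ≤ ratDegree φ := le_max_left _ _

theorem natDegree_denom_le (φ : RatFunc K) : φ.denom.natDegree ≤ ratDegree φ := le_max_right _ _

theorem natDegree_fiberPoly_le (φ : RatFunc K) (y : OnePoint K) :
    (fiberPoly φ y).natDegree ≤ ratDegree φ := by
  induction y using OnePoint.rec with
  | infty => exact natDegree_denom_le φ
  | coe y =>
    refine (natDegree_sub_le _ _).trans (max_le (natDegree_num_le φ) ?_)
    exact (natDegree_C_mul_le _ _).trans (natDegree_denom_le φ)

theorem sub_C_mul_ne_zero_of_isCoprime {A B : K[X]} (h : IsCoprime A B) (hd : 0 < A.natDegree)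
    (y : K) : A - C y * B ≠ 0 := by
  intro h0
  have hA : A = C y * B := sub_eq_zero.1 h0
  have hu : IsUnit B := h.isUnit_of_dvd' ⟨C y, by rw [hA, mul_comm]⟩ dvd_rfl
  have h1 := natDegree_C_mul_le y B
  rw [← hA, natDegree_eq_zero_of_isUnit hu] at h1
  omega

theorem fiberPoly_ne_zero {φ : RatFunc K} (hd : 0 < ratDegree φ) (y : OnePoint K) :
    fiberPoly φ y ≠ 0 := by
  induction y using OnePoint.rec with
  | infty => exact φ.denom_ne_zero
  | coe y =>
    rcases Nat.eq_zero_or_pos φ.num.natDegree with h | h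
    · intro h0
      have hA : φ.num = C y * φ.denom := sub_eq_zero.1 h0
      have hu : IsUnit φ.denom :=
        φ.isCoprime_num_denom.isUnit_of_dvd' ⟨C y, by rw [hA, mul_comm]⟩ dvd_rfl
      have := natDegree_eq_zero_of_isUnit hu
      rw [ratDegree] at hd
      omega
    · exact sub_C_mul_ne_zero_of_isCoprime φ.isCoprime_num_denom h y

theorem isCriticalPoint_of_coordinate {φ : RatFunc K} {M : K → OnePoint K} {A B : K[X]}
    (hφ : ∀ z, B.eval z ≠ 0 → ratEval φ (M z) = M (A.eval z / B.eval z))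
    (hmult : ∀ y z, fiberMult φ (M y) (M z) = (A - C y * B).rootMultiplicity z)
    (hAB : IsCoprime A B) (hA : 0 < A.natDegree) {v : K} (hv : B.eval v ≠ 0)
    (h : A.derivative.eval v * B.eval v = A.eval v * B.derivative.eval v) :
    IsCriticalPoint φ (M v) := by
  rw [IsCriticalPoint, hφ v hv, hmult]
  refine (one_lt_rootMultiplicity_iff_isRoot (sub_C_mul_ne_zero_of_isCoprime hAB hA _)).2 ⟨?_, ?_⟩
  · simp [IsRoot, hv]
  · simp only [IsRoot, derivative_sub, derivative_C_mul, eval_sub, eval_mul, eval_C]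
    field_simp
    linear_combination h

theorem eval_zero_derivative (P : K[X]) : (derivative P).eval 0 = P.coeff 1 := by
  rw [← coeff_zero_eq_eval_zero, coeff_derivative]
  simp

theorem coeff_reflect_of_le {P : K[X]} {N i : ℕ} (h : i ≤ N) :
    (reflect N P).coeff i = P.coeff (N - i) := by
  rw [coeff_reflect, revAt_le h]

theorem coeff_denom_ratDegree_of_fixed_infty {φ : RatFunc K}
    (h : ratEval φ OnePoint.infty = OnePoint.infty) : φ.denom.coeff (ratDegree φ) = 0 := by
  by_contra hne
  rw [ratEval_infty, if_neg hne] at h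
  exact OnePoint.coe_ne_infty _ h

theorem multiplier_infty {φ : RatFunc K} (h : ratEval φ OnePoint.infty = OnePoint.infty)
    (hd : 0 < ratDegree φ) : multiplier φ OnePoint.infty =
      φ.denom.coeff (ratDegree φ - 1) / φ.num.coeff (ratDegree φ) := by
  have hq := coeff_denom_ratDegree_of_fixed_infty h
  change derivQuot (φ.denom.reflect (ratDegree φ)) (φ.num.reflect (ratDegree φ)) 0 = _
  rw [derivQuot, eval_zero_derivative, eval_zero_derivative,
    ← coeff_zero_eq_eval_zero, ← coeff_zero_eq_eval_zero, coeff_reflect_of_le (Nat.zero_le _),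
    coeff_reflect_of_le (Nat.zero_le _), coeff_reflect_of_le hd, Nat.sub_zero, hq]
  -- In the degenerate case both sides are divisions by zero, hence 0.
  rcases eq_or_ne (φ.num.coeff (ratDegree φ)) 0 with h0 | h0
  · simp [h0]
  · field_simp
    ring

end Algebra

/-! ### The theorem when the fixed point is infinity -/

section Infinity

variable {K : Type*} [NontriviallyNormedField K] [IsUltrametricDist K] [IsAlgClosed K]

/-- The lower bound for the directional multiplicities, on annuli of `K`. -/
def DegreeBound (φ : RatFunc K) (L : ℝ) (d : ℕ) : Prop :=
  ∀ (c : K) (s t : ℝ) (m : ℕ), 0 < s → s < t →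
    (∀ r, s < r → r ≤ t →
      MapsWithMult φ (OnePoint.some '' {x : K | s < ‖x - c‖ ∧ ‖x - c‖ < r}) m) →
    L < ‖(m : K)‖ ^ d

theorem exists_disk_of_infty {φ : RatFunc K} {d : ℕ} (hd : 2 ≤ d) (hφ : ratDegree φ = d)
    (hγ : ratEval φ OnePoint.infty = OnePoint.infty)
    (hpos : 0 < ‖multiplier φ OnePoint.infty‖)
    (hchar : ∀ n : ℕ, 0 < n → n ≤ d → (n : K) ≠ 0)
    (h : DegreeBound φ ‖multiplier φ OnePoint.infty‖ d) :
    ∃ U : Set (OnePoint K), IsDisk U ∧ OnePoint.infty ∈ U ∧ Set.MapsTo (ratEval φ) U U ∧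
      Set.InjOn (ratEval φ) U ∧ (∀ x ∈ U, Attracts φ OnePoint.infty x) ∧
      ∃ c : OnePoint K, IsCriticalPoint φ c ∧ ratEval φ c ∈ U ∧
        StrictlyAttracts φ OnePoint.infty (ratEval φ c) := by
  have hmul := multiplier_infty hγ (by omega)
  have hq0 := coeff_denom_ratDegree_of_fixed_infty hγ
  rw [hφ] at hmul hq0
  have hne : multiplier φ OnePoint.infty ≠ 0 := norm_pos_iff.1 hpos
  -- A nonzero multiplier forces both coefficients to be nonzero; this gives the exact degrees `d`
  -- and `d - 1`.
  rw [hmul, div_ne_zero_iff] at hne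
  have hpd : φ.num.natDegree = d :=
    le_antisymm (hφ ▸ natDegree_num_le φ) (le_natDegree_of_ne_zero hne.2)
  have hqd : φ.denom.natDegree + 1 = d := by
    have h1 : φ.denom.natDegree ≤ d := hφ ▸ natDegree_denom_le φ
    have h2 := le_natDegree_of_ne_zero hne.1
    have h3 : φ.denom.natDegree ≠ d := fun h3 => by
      rw [← h3, coeff_natDegree, leadingCoeff_eq_zero] at hq0
      exact φ.denom_ne_zero hq0
    omega
  have hev : ∀ z : K, φ.denom.eval z ≠ 0 →
      ratEval φ (OnePoint.some z) = OnePoint.some (φ.num.eval z / φ.denom.eval z) := fun z hz => by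
    rw [ratEval_some, if_neg hz]
  refine exists_disk_of_coordinate (L := ‖multiplier φ OnePoint.infty‖) (M := OnePoint.some) (A := φ.num) (B := φ.denom)
    OnePoint.coe_injective (fun z => OnePoint.coe_ne_infty z) hγ hev ?_ ?_
    (fun v hv hv' => isCriticalPoint_of_coordinate hev (fun y z => rfl) φ.isCoprime_num_denom
      (by omega) hv hv') ?_ hd hpd hqd φ.isCoprime_num_denom hchar ?_
  · rintro V ⟨a, r, hr, rfl | rfl⟩ hV
    · exact absurd hV OnePoint.infty_notMem_image_coe
    · refine ⟨max r ‖a‖, fun z hz hz' => ?_⟩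
      obtain ⟨x, hx, hxz⟩ := hz'
      obtain rfl := OnePoint.coe_injective hxz
      have hx' : ‖x - a‖ ≤ r := hx
      rw [norm_sub_eq_left ((le_max_right _ _).trans_lt hz)] at hx'
      exact hx'.not_gt ((le_max_left _ _).trans_lt hz)
  · intro a ρ hρ
    refine Or.inl ⟨a, ρ, hρ, Or.inr ?_⟩
    ext x
    induction x using OnePoint.rec with
    | infty => simp [finClosedDisk]
    | coe x => simp [finClosedDisk]
  · intro c s t m hs hst hB hm
    refine h c s t m hs hst fun r hr hrt => ?_
    classical
    refine mapsWithMult_image (M := OnePoint.some) (A := φ.num) (B := φ.denom)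
      OnePoint.coe_injective (fun z hz => hB z hz.1 (hz.2.trans_le hrt)) hev
      (fun y z _ => rfl) fun y z hz hyz => ?_
    rw [← hm s r le_rfl hr hrt y z hz.1 hz.2 hyz]
  · rw [hmul, norm_div, leadingCoeff, leadingCoeff, hpd]
    congr
    omega

end Infinity

/-! ### Finite fixed points -/

section Reflect

variable {K : Type*} [Field K]

theorem eval_reflect {N : ℕ} {F : K[X]} (hF : F.natDegree ≤ N) {z : K} (hz : z ≠ 0) :
    (reflect N F).eval z = z ^ N * F.eval z⁻¹ := by
  let _ : Invertible z⁻¹ := invertibleOfNonzero (inv_ne_zero hz)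
  have := eval₂_reflect_mul_pow (RingHom.id K) z⁻¹ N F hF
  rw [invOf_eq_inv, inv_inv, ← eval, ← eval, inv_pow] at this
  rw [← this]
  field_simp

theorem natDegree_reflect_le_of_le {N : ℕ} {F : K[X]} (hF : F.natDegree ≤ N) :
    (reflect N F).natDegree ≤ N := natDegree_reflect_le.trans (max_le le_rfl hF)

/-- Reflection is multiplicative when degrees add up and sends `X - z` to `-z (X - z⁻¹)`, so factors
are pulled out one at a time. The reverse inequality follows because reflection is an involution. -/
theorem rootMultiplicity_le_rootMultiplicity_reflect {N : ℕ} {F : K[X]} (hF : F ≠ 0)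
    (hN : F.natDegree ≤ N) {z : K} (hz : z ≠ 0) :
    F.rootMultiplicity z ≤ (reflect N F).rootMultiplicity z⁻¹ := by
  rw [le_rootMultiplicity_iff (mt reflect_eq_zero_iff.1 hF)]
  have key : ∀ (n : ℕ) (G : K[X]) (N : ℕ), (X - C z) ^ n * G ≠ 0 →
      ((X - C z) ^ n * G).natDegree ≤ N → (X - C z⁻¹) ^ n ∣ reflect N ((X - C z) ^ n * G) := by
    intro n
    induction n with
    | zero => simp
    | succ n ih =>
      intro G N hne hdeg
      have hne' : (X - C z) ^ n * G ≠ 0 := by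
        rintro h
        exact hne (by rw [pow_succ', mul_assoc, h, mul_zero])
      rw [pow_succ', mul_assoc, natDegree_mul (X_sub_C_ne_zero z) hne', natDegree_X_sub_C] at hdeg
      obtain ⟨N, rfl⟩ : ∃ k, N = 1 + k := ⟨N - 1, by omega⟩
      rw [pow_succ' (X - C z), mul_assoc, reflect_mul _ _ (natDegree_X_sub_C z).le
        (by omega : ((X - C z) ^ n * G).natDegree ≤ N), pow_succ']
      refine mul_dvd_mul ?_ (ih G N hne' (by omega))
      refine ⟨C (-z), ?_⟩
      rw [sub_eq_add_neg, ← C_neg, reflect_add, reflect_one_X, reflect_C, sub_mul, ← C_mul,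
        inv_mul_eq_div, neg_div, div_self hz]
      simp
      ring
  obtain ⟨G, hG⟩ := pow_rootMultiplicity_dvd F z
  conv_rhs => rw [hG]
  exact key _ G N (hG ▸ hF) (hG ▸ hN)

theorem rootMultiplicity_reflect {N : ℕ} {F : K[X]} (hF : F ≠ 0) (hN : F.natDegree ≤ N) {z : K}
    (hz : z ≠ 0) : (reflect N F).rootMultiplicity z = F.rootMultiplicity z⁻¹ := by
  apply le_antisymm
  · have := rootMultiplicity_le_rootMultiplicity_reflect (mt reflect_eq_zero_iff.1 hF)
      (natDegree_reflect_le_of_le hN) hz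
    rwa [reflect_reflect] at this
  · have := rootMultiplicity_le_rootMultiplicity_reflect hF hN (inv_ne_zero hz)
    rwa [inv_inv] at this

/-- The degree defect, which counts solutions at infinity in `fiberMult`, becomes the multiplicity
of an ordinary zero. -/
theorem rootMultiplicity_reflect_zero {N : ℕ} {F : K[X]} (hF : F ≠ 0) (hN : F.natDegree ≤ N) :
    (reflect N F).rootMultiplicity 0 = N - F.natDegree := by
  have hF' := mt (reflect_eq_zero_iff (N := N)).1 hF
  apply le_antisymm
  · by_contra! hlt
    have h := pow_rootMultiplicity_dvd (reflect N F) 0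
    rw [C_0, sub_zero, X_pow_dvd_iff] at h
    have := h _ hlt
    rw [coeff_reflect_of_le (Nat.sub_le _ _), Nat.sub_sub_self hN, coeff_natDegree,
      leadingCoeff_eq_zero] at this
    exact hF this
  · rw [le_rootMultiplicity_iff hF', C_0, sub_zero, X_pow_dvd_iff]
    intro i hi
    rw [coeff_reflect_of_le (by omega)]
    exact coeff_eq_zero_of_natDegree_lt (by omega)

theorem rootMultiplicity_taylor (F : K[X]) (g w : K) :
    (taylor g F).rootMultiplicity w = F.rootMultiplicity (g + w) := by
  rw [rootMultiplicity_eq_rootMultiplicity, ← taylor_apply, taylor_taylor,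
    rootMultiplicity_eq_rootMultiplicity (p := F), ← taylor_apply, add_comm]

theorem rootMultiplicity_C_mul_eq {k : K} (hk : k ≠ 0) (P : K[X]) (z : K) :
    (C k * P).rootMultiplicity z = P.rootMultiplicity z := by
  rcases eq_or_ne P 0 with rfl | hP
  · simp
  · rw [rootMultiplicity_mul (mul_ne_zero (C_ne_zero.2 hk) hP), rootMultiplicity_C, zero_add]

theorem coeff_taylor_of_natDegree_le {F : K[X]} {N : ℕ} (h : F.natDegree ≤ N) (g : K) :
    (taylor g F).coeff N = F.coeff N := by
  rcases h.eq_or_lt with rfl | h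
  · rw [coeff_taylor_natDegree, coeff_natDegree]
  · rw [coeff_eq_zero_of_natDegree_lt h,
      coeff_eq_zero_of_natDegree_lt (by rwa [natDegree_taylor])]

end Reflect

/-! ### The coordinate moving a finite fixed point to infinity -/

section InvCoord

variable {K : Type*} [Field K]

open Classical in
/-- The coordinate `z` on the projective line with `x = g + 1 / z`. -/
def invCoord (g z : K) : OnePoint K :=
  if z = 0 then OnePoint.infty else OnePoint.some (g + z⁻¹)

theorem invCoord_zero (g : K) : invCoord g 0 = OnePoint.infty := if_pos rfl

theorem invCoord_of_ne {z : K} (g : K) (hz : z ≠ 0) : invCoord g z = OnePoint.some (g + z⁻¹) :=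
  if_neg hz

theorem invCoord_ne (g z : K) : invCoord g z ≠ OnePoint.some g := by
  rcases eq_or_ne z 0 with rfl | hz
  · rw [invCoord_zero]
    exact OnePoint.infty_ne_coe g
  · rw [invCoord_of_ne g hz]
    intro h
    have := OnePoint.coe_injective h
    simp [hz] at this

theorem invCoord_injective (g : K) : Function.Injective (invCoord g) := by
  intro z w h
  rcases eq_or_ne z 0 with rfl | hz <;> rcases eq_or_ne w 0 with rfl | hw
  · rfl
  · rw [invCoord_zero, invCoord_of_ne g hw] at h
    exact absurd h (OnePoint.infty_ne_coe _)
  · rw [invCoord_zero, invCoord_of_ne g hz] at h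
    exact absurd h (OnePoint.coe_ne_infty _)
  · rw [invCoord_of_ne g hz, invCoord_of_ne g hw] at h
    exact inv_injective (add_left_cancel (OnePoint.coe_injective h))

theorem infty_mem_image_invCoord {g : K} {T : Set K} :
    OnePoint.infty ∈ invCoord g '' T ↔ (0 : K) ∈ T := by
  rw [← invCoord_zero g, (invCoord_injective g).mem_set_image]

theorem some_mem_image_invCoord {g w : K} {T : Set K} :
    OnePoint.some (g + w) ∈ invCoord g '' T ↔ w ≠ 0 ∧ w⁻¹ ∈ T := by
  rcases eq_or_ne w 0 with rfl | hw
  · simp only [add_zero, ne_eq, not_true_eq_false, false_and, iff_false]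
    rintro ⟨z, -, hz⟩
    exact invCoord_ne g z hz
  · have : OnePoint.some (g + w) = invCoord g w⁻¹ := by
      rw [invCoord_of_ne g (inv_ne_zero hw), inv_inv]
    rw [this, (invCoord_injective g).mem_set_image]
    simp [hw]

/-- With `φ = p / q`, the denominator `q` in the coordinate `invCoord g`. -/
def invNum (φ : RatFunc K) (g : K) : K[X] := reflect (ratDegree φ) (taylor g φ.denom)

/-- With `φ = p / q`, the polynomial `p - g q` in the coordinate `invCoord g`. -/
def invDenom (φ : RatFunc K) (g : K) : K[X] :=
  reflect (ratDegree φ) (taylor g (φ.num - C g * φ.denom))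

theorem natDegree_num_sub_le (φ : RatFunc K) (g : K) :
    (φ.num - C g * φ.denom).natDegree ≤ ratDegree φ :=
  natDegree_fiberPoly_le φ (OnePoint.some g)

/-- In the new coordinate the map is q / (p - g q); subtracting y and clearing denominators gives
the old fibre polynomial up to a nonzero constant, so multiplicities can be transported. -/
theorem exists_invNum_sub_eq (φ : RatFunc K) (g y : K) : ∃ k : K, k ≠ 0 ∧
    invNum φ g - C y * invDenom φ g =
      C k * reflect (ratDegree φ) (taylor g (fiberPoly φ (invCoord g y))) := by
  rcases eq_or_ne y 0 with rfl | hy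
  · refine ⟨1, one_ne_zero, ?_⟩
    rw [invCoord_zero, C_0, zero_mul, sub_zero, C_1, one_mul]
    rfl
  · refine ⟨-y, neg_ne_zero.2 hy, ?_⟩
    rw [invCoord_of_ne g hy, invNum, invDenom, ← reflect_C_mul, ← reflect_C_mul, ← reflect_sub]
    congr 1
    have h : ∀ (k : K) (P : K[X]), C k * taylor g P = taylor g (C k * P) := fun k P => by
      rw [taylor_mul, taylor_C]
    rw [h, h, ← map_sub]
    congr 1
    change _ = C (-y) * (φ.num - C (g + y⁻¹) * φ.denom)
    have : C y * C y⁻¹ = (1 : K[X]) := by rw [← C_mul, mul_inv_cancel₀ hy, C_1]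
    rw [C_add, C_neg]
    linear_combination (-φ.denom) * this

theorem fiberMult_invCoord {φ : RatFunc K} (hd : 0 < ratDegree φ) (g y z : K) :
    fiberMult φ (invCoord g y) (invCoord g z) =
      (invNum φ g - C y * invDenom φ g).rootMultiplicity z := by
  obtain ⟨k, hk, he⟩ := exists_invNum_sub_eq φ g y
  have hF := fiberPoly_ne_zero hd (invCoord g y)
  have hN := natDegree_fiberPoly_le φ (invCoord g y)
  rw [he, rootMultiplicity_C_mul_eq hk]
  rw [← natDegree_taylor _ g] at hN
  have hF' := mt (taylor_eq_zero g _).1 hF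
  rcases eq_or_ne z 0 with rfl | hz
  · rw [rootMultiplicity_reflect_zero hF' hN, invCoord_zero, natDegree_taylor]
    rfl
  · rw [rootMultiplicity_reflect hF' hN hz, rootMultiplicity_taylor, invCoord_of_ne g hz]
    rfl

theorem eval_invNum (φ : RatFunc K) (g : K) {z : K} (hz : z ≠ 0) :
    (invNum φ g).eval z = z ^ ratDegree φ * φ.denom.eval (g + z⁻¹) := by
  rw [invNum, eval_reflect (by rw [natDegree_taylor]; exact natDegree_denom_le φ) hz, taylor_eval,
    add_comm]

theorem eval_invDenom (φ : RatFunc K) (g : K) {z : K} (hz : z ≠ 0) :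
    (invDenom φ g).eval z =
      z ^ ratDegree φ * (φ.num.eval (g + z⁻¹) - g * φ.denom.eval (g + z⁻¹)) := by
  rw [invDenom, eval_reflect (by rw [natDegree_taylor]; exact natDegree_num_sub_le φ g) hz,
    taylor_eval, add_comm]
  simp

theorem eval_zero_invNum (φ : RatFunc K) (g : K) :
    (invNum φ g).eval 0 = φ.denom.coeff (ratDegree φ) := by
  rw [invNum, ← coeff_zero_eq_eval_zero, coeff_reflect_of_le (Nat.zero_le _), Nat.sub_zero,
    coeff_taylor_of_natDegree_le (natDegree_denom_le φ)]

theorem eval_zero_invDenom (φ : RatFunc K) (g : K) :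
    (invDenom φ g).eval 0 = φ.num.coeff (ratDegree φ) - g * φ.denom.coeff (ratDegree φ) := by
  rw [invDenom, ← coeff_zero_eq_eval_zero, coeff_reflect_of_le (Nat.zero_le _), Nat.sub_zero,
    coeff_taylor_of_natDegree_le (natDegree_num_sub_le φ g)]
  simp

open Classical in
theorem invCoord_div {g k a b : K} (hk : k ≠ 0) (h : a - g * b ≠ 0) :
    invCoord g (k * b / (k * (a - g * b))) =
      if b = 0 then OnePoint.infty else OnePoint.some (a / b) := by
  split_ifs with hb
  · rw [hb, mul_zero, zero_div, invCoord_zero]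
  · rw [invCoord_of_ne]
    · congr 1
      field_simp
      ring
    · exact div_ne_zero (mul_ne_zero hk hb) (mul_ne_zero hk h)

theorem ratEval_invCoord {φ : RatFunc K} {g z : K} (hz : (invDenom φ g).eval z ≠ 0) :
    ratEval φ (invCoord g z) = invCoord g ((invNum φ g).eval z / (invDenom φ g).eval z) := by
  rcases eq_or_ne z 0 with rfl | h0
  · rw [eval_zero_invDenom] at hz
    rw [eval_zero_invNum, eval_zero_invDenom, invCoord_zero, ratEval_infty]
    have := invCoord_div (k := 1) one_ne_zero hz
    rw [one_mul, one_mul] at this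
    rw [this]
  · rw [eval_invDenom φ g h0] at hz
    rw [eval_invNum φ g h0, eval_invDenom φ g h0,
      invCoord_div (pow_ne_zero _ h0) (right_ne_zero_of_mul hz), invCoord_of_ne g h0, ratEval_some]

theorem isCoprime_invNum_invDenom [IsAlgClosed K] {φ : RatFunc K} (hd : 0 < ratDegree φ) (g : K) :
    IsCoprime (invNum φ g) (invDenom φ g) := by
  rw [isCoprime_iff_aeval_ne_zero_of_isAlgClosed K K]
  intro z
  simp only [coe_aeval_eq_eval]
  by_contra! h
  obtain ⟨h1, h2⟩ := h
  rcases eq_or_ne z 0 with rfl | h0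
  · rw [eval_zero_invNum] at h1
    rw [eval_zero_invDenom, h1, mul_zero, sub_zero] at h2
    rcases max_choice φ.num.natDegree φ.denom.natDegree with h | h
    · rw [ratDegree, h, coeff_natDegree, leadingCoeff_eq_zero] at h2
      rw [ratDegree, h, h2, natDegree_zero] at hd
      exact hd.ne' rfl
    · rw [ratDegree, h, coeff_natDegree, leadingCoeff_eq_zero] at h1
      exact φ.denom_ne_zero h1
  · rw [eval_invNum φ g h0, mul_eq_zero, or_iff_right (pow_ne_zero _ h0)] at h1
    rw [eval_invDenom φ g h0, mul_eq_zero, or_iff_right (pow_ne_zero _ h0), h1, mul_zero,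
      sub_zero] at h2
    have := (isCoprime_iff_aeval_ne_zero_of_isAlgClosed K K _ _).1 φ.isCoprime_num_denom (g + z⁻¹)
    simp only [coe_aeval_eq_eval] at this
    tauto

theorem eval_of_ratEval_eq {φ : RatFunc K} {g : K}
    (h : ratEval φ (OnePoint.some g) = OnePoint.some g) :
    φ.denom.eval g ≠ 0 ∧ φ.num.eval g = g * φ.denom.eval g := by
  have h1 : φ.denom.eval g ≠ 0 := fun h0 => by
    rw [ratEval_some, if_pos h0] at h
    exact OnePoint.infty_ne_coe _ h
  rw [ratEval_some, if_neg h1] at h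
  exact ⟨h1, (div_eq_iff h1).1 (OnePoint.coe_injective h)⟩

theorem coeff_invNum (φ : RatFunc K) (g : K) :
    (invNum φ g).coeff (ratDegree φ) = φ.denom.eval g := by
  rw [invNum, coeff_reflect_of_le le_rfl, Nat.sub_self, taylor_coeff_zero]

theorem coeff_invDenom (φ : RatFunc K) (g : K) :
    (invDenom φ g).coeff (ratDegree φ) = φ.num.eval g - g * φ.denom.eval g := by
  rw [invDenom, coeff_reflect_of_le le_rfl, Nat.sub_self, taylor_coeff_zero]
  simp

/-- It is the derivative of `p - g q` at `g`. Divided by the leading coefficient `q(g)` of `invNum φ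
g`, it gives the multiplier. -/
theorem coeff_pred_invDenom {φ : RatFunc K} (hd : 0 < ratDegree φ) {g : K}
    (h : ratEval φ (OnePoint.some g) = OnePoint.some g) :
    (invDenom φ g).coeff (ratDegree φ - 1) =
      multiplier φ (OnePoint.some g) * φ.denom.eval g := by
  obtain ⟨h1, h2⟩ := eval_of_ratEval_eq h
  rw [invDenom, coeff_reflect_of_le (Nat.sub_le _ _), Nat.sub_sub_self hd, taylor_coeff_one]
  change _ = derivQuot φ.num φ.denom g * _
  rw [derivQuot, h2]
  simp
  field_simp

end InvCoord

/-! ### Inversion of disks and annuli; the theorem for finite fixed points -/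

section Finite

variable {K : Type*} [NontriviallyNormedField K] [IsUltrametricDist K]

omit [IsUltrametricDist K] in
theorem norm_inv_sub {a w : K} (ha : a ≠ 0) (hw : w ≠ 0) :
    ‖w⁻¹ - a‖ = ‖a‖ * ‖w - a⁻¹‖ / ‖w‖ := by
  rw [← norm_mul, ← norm_div, ← norm_neg]
  congr 1
  field_simp
  ring

theorem norm_eq_of_norm_sub_lt {w b : K} (h : ‖w - b‖ < ‖b‖) : ‖w‖ = ‖b‖ := by
  have := norm_add_eq_left h
  rwa [add_sub_cancel] at this

theorem isDisk_insert_image_invCoord (g a : K) {ρ : ℝ} (hρ : 0 < ρ) :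
    IsDisk (insert (OnePoint.some g) (invCoord g '' {z | ρ < ‖z - a‖})) := by
  -- The coordinate 0 is the point at infinity. If the removed disk contains it, a finite open disk
  -- remains; otherwise the removed disk is inverted into the closed disk of radius `ρ / ‖a‖ ^ 2`
  -- about `g + a⁻¹`.
  rcases le_or_gt ‖a‖ ρ with ha | ha
  · refine Or.inl ⟨g, ρ⁻¹, inv_pos.2 hρ, Or.inl ?_⟩
    ext x
    rw [Set.mem_insert_iff]
    induction x using OnePoint.rec with
    | infty =>
      rw [infty_mem_image_invCoord]
      simp only [OnePoint.infty_ne_coe, false_or, Set.mem_ofPred_eq, zero_sub, norm_neg]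
      exact iff_of_false (not_lt.2 ha) OnePoint.infty_notMem_image_coe
    | coe x =>
      obtain ⟨w, rfl⟩ : ∃ w, x = g + w := ⟨x - g, by ring⟩
      rw [some_mem_image_invCoord, finOpenDisk, OnePoint.coe_injective.mem_set_image]
      simp only [OnePoint.coe_eq_coe, add_eq_left, Set.mem_ofPred_eq, add_sub_cancel_left]
      rcases eq_or_ne w 0 with rfl | hw
      · simpa using hρ
      · have hw' := norm_pos_iff.2 hw
        have key : ρ < ‖w⁻¹ - a‖ ↔ ρ < ‖w⁻¹‖ := by
          constructor
          · intro h
            rcases le_max_iff.1 (norm_sub_le_max w⁻¹ a) with h1 | h1 <;> linarith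
          · intro h
            rwa [norm_sub_eq_left (ha.trans_lt h)]
        rw [key, norm_inv, lt_inv_comm₀ hρ hw']
        simp [hw]
  · have ha' : 0 < ‖a‖ := hρ.trans ha
    have ha0 : a ≠ 0 := norm_pos_iff.1 ha'
    have hlt : ρ / ‖a‖ ^ 2 < ‖a⁻¹‖ := by
      rw [norm_inv, div_lt_iff₀ (by positivity)]
      field_simp
      exact ha
    refine Or.inl ⟨g + a⁻¹, ρ / ‖a‖ ^ 2, by positivity, Or.inr ?_⟩
    ext x
    rw [Set.mem_insert_iff, Set.mem_compl_iff]
    induction x using OnePoint.rec with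
    | infty =>
      rw [infty_mem_image_invCoord]
      refine iff_of_true (Or.inr ?_) OnePoint.infty_notMem_image_coe
      simpa using ha
    | coe x =>
      obtain ⟨w, rfl⟩ : ∃ w, x = g + w := ⟨x - g, by ring⟩
      rw [some_mem_image_invCoord, finClosedDisk, OnePoint.coe_injective.mem_set_image]
      simp only [OnePoint.coe_eq_coe, add_eq_left, Set.mem_ofPred_eq, add_sub_add_left_eq_sub,
        not_le]
      rcases eq_or_ne w 0 with rfl | hw
      · simpa using hlt
      · have hw' := norm_pos_iff.2 hw
        simp only [hw, false_or, ne_eq, not_false_eq_true, true_and]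
        rw [norm_inv_sub ha0 hw]
        rcases lt_or_ge ‖w - a⁻¹‖ ‖a⁻¹‖ with h | h
        · rw [norm_eq_of_norm_sub_lt h, norm_inv, div_inv_eq_mul, div_lt_iff₀ (by positivity)]
          exact iff_of_eq (congrArg _ (by ring))
        · refine iff_of_true ?_ (hlt.trans_le h)
          have : ‖w‖ ≤ ‖w - a⁻¹‖ := by
            have h1 := norm_sub_le_max (w - a⁻¹) (-a⁻¹)
            rwa [sub_neg_eq_add, sub_add_cancel, norm_neg, max_eq_left h] at h1
          rw [lt_div_iff₀ hw']
          exact (mul_lt_mul_of_pos_right ha hw').trans_le (mul_le_mul_of_nonneg_left this ha'.le)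

theorem exists_forall_invCoord_mem {g : K} {V : Set (OnePoint K)} (hV : IsOpenDisk V)
    (hg : OnePoint.some g ∈ V) : ∃ T : ℝ, ∀ z, T < ‖z‖ → invCoord g z ∈ V := by
  obtain ⟨a, r, hr, hV⟩ := hV
  refine ⟨r⁻¹, fun z hz => ?_⟩
  have hz0 : z ≠ 0 := norm_pos_iff.1 ((inv_pos.2 hr).trans hz)
  have hlt : ‖z⁻¹‖ < r := by
    rw [norm_inv]
    exact inv_lt_of_inv_lt₀ hr hz
  have e : g + z⁻¹ - a = (g - a) - (-z⁻¹) := by ring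
  rw [invCoord_of_ne g hz0]
  rcases hV with rfl | rfl
  · rw [finOpenDisk, OnePoint.coe_injective.mem_set_image, Set.mem_ofPred_eq] at hg ⊢
    rw [e]
    refine (norm_sub_le_max _ _).trans_lt (max_lt hg ?_)
    rwa [norm_neg]
  · rw [Set.mem_compl_iff, finClosedDisk, OnePoint.coe_injective.mem_set_image, Set.mem_ofPred_eq,
      not_le] at hg ⊢
    rw [e, norm_sub_eq_left]
    · exact hg
    · rw [norm_neg]
      exact hlt.trans hg

theorem image_invCoord_annulus_of_le {g c : K} {s t r : ℝ} (hc : ‖c‖ ≤ s) (ht : 0 < t)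
    (hr : 0 < r) (hrs : s ≤ r⁻¹) :
    OnePoint.some '' {x : K | t⁻¹ < ‖x - g‖ ∧ ‖x - g‖ < r} =
      invCoord g '' {z | r⁻¹ < ‖z - c‖ ∧ ‖z - c‖ < t} := by
  ext x
  induction x using OnePoint.rec with
  | infty =>
    rw [infty_mem_image_invCoord]
    refine iff_of_false OnePoint.infty_notMem_image_coe fun h => ?_
    have h1 := h.1
    rw [zero_sub, norm_neg] at h1
    linarith
  | coe x =>
    obtain ⟨w, rfl⟩ : ∃ w, x = g + w := ⟨x - g, by ring⟩
    rw [some_mem_image_invCoord, OnePoint.coe_injective.mem_set_image]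
    simp only [Set.mem_ofPred_eq, add_sub_cancel_left]
    rcases eq_or_ne w 0 with rfl | hw
    · simp [ht.le]
    · have hw' := norm_pos_iff.2 hw
      have heq : r⁻¹ < ‖w⁻¹‖ → ‖w⁻¹ - c‖ = ‖w⁻¹‖ := fun h => norm_sub_eq_left (by linarith)
      have key : r⁻¹ < ‖w⁻¹ - c‖ ↔ r⁻¹ < ‖w⁻¹‖ := by
        constructor
        · intro h
          rcases le_max_iff.1 (norm_sub_le_max w⁻¹ c) with h1 | h1 <;> linarith
        · intro h
          rwa [heq h]
      have h1 : r⁻¹ < ‖w⁻¹‖ ↔ ‖w‖ < r := by rw [norm_inv, inv_lt_inv₀ hr hw']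
      have h2 : ‖w⁻¹‖ < t ↔ t⁻¹ < ‖w‖ := by rw [norm_inv, inv_lt_comm₀ hw' ht]
      constructor
      · rintro ⟨h3, h4⟩
        refine ⟨hw, key.2 (h1.2 h4), ?_⟩
        rw [heq (h1.2 h4)]
        exact h2.2 h3
      · rintro ⟨-, h3, h4⟩
        rw [heq (key.1 h3)] at h4
        exact ⟨h2.1 h4, h1.1 (key.1 h3)⟩

theorem image_invCoord_annulus_of_lt {g c : K} {s r : ℝ} (hc : c ≠ 0) (hrc : r ≤ ‖c‖) :
    OnePoint.some '' {x : K | s / ‖c‖ ^ 2 < ‖x - (g + c⁻¹)‖ ∧ ‖x - (g + c⁻¹)‖ < r / ‖c‖ ^ 2} =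
      invCoord g '' {z | s < ‖z - c‖ ∧ ‖z - c‖ < r} := by
  have hc' := norm_pos_iff.2 hc
  have hrc' : r / ‖c‖ ^ 2 ≤ ‖c⁻¹‖ := by
    rw [norm_inv, div_le_iff₀ (by positivity)]
    field_simp
    exact hrc
  ext x
  induction x using OnePoint.rec with
  | infty =>
    rw [infty_mem_image_invCoord]
    refine iff_of_false OnePoint.infty_notMem_image_coe fun h => ?_
    have h1 := h.2
    rw [zero_sub, norm_neg] at h1
    linarith
  | coe x =>
    obtain ⟨w, rfl⟩ : ∃ w, x = g + w := ⟨x - g, by ring⟩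
    rw [some_mem_image_invCoord, OnePoint.coe_injective.mem_set_image]
    simp only [Set.mem_ofPred_eq, add_sub_add_left_eq_sub]
    rcases eq_or_ne w 0 with rfl | hw
    · simp only [ne_eq, not_true_eq_false, false_and, iff_false, zero_sub, norm_neg]
      rintro ⟨-, h⟩
      linarith
    · have heq : ‖w‖ = ‖c⁻¹‖ → ‖w⁻¹ - c‖ = ‖w - c⁻¹‖ * ‖c‖ ^ 2 := fun h => by
        rw [norm_inv_sub hc hw, h, norm_inv, div_inv_eq_mul]
        ring
      simp only [hw, ne_eq, not_false_eq_true, true_and]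
      rcases lt_or_ge ‖w - c⁻¹‖ ‖c⁻¹‖ with h | h
      · rw [heq (norm_eq_of_norm_sub_lt h), div_lt_iff₀ (by positivity),
          lt_div_iff₀ (by positivity)]
      · refine iff_of_false (fun h' => by linarith [h'.2]) fun h' => ?_
        have h1 : ‖w⁻¹‖ = ‖c‖ := norm_eq_of_norm_sub_lt (h'.2.trans_le hrc)
        have h2 : ‖w‖ = ‖c⁻¹‖ := by rw [norm_inv, ← h1, norm_inv, inv_inv]
        have h3 := h'.2
        rw [heq h2, ← lt_div_iff₀ (by positivity)] at h3
        linarith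

theorem annulusBound_invNum_invDenom {φ : RatFunc K} {L : ℝ} {d : ℕ} (hd : 0 < ratDegree φ)
    (g : K) (h : DegreeBound φ L d) : AnnulusBound (invNum φ g) (invDenom φ g) L d := by
  classical
  intro c s t m hs hst hB hm
  have key : ∀ s' t', s ≤ s' → s' < t' → t' ≤ t →
      MapsWithMult φ (invCoord g '' {z | s' < ‖z - c‖ ∧ ‖z - c‖ < t'}) m := by
    intro s' t' hs' hst' ht'
    refine mapsWithMult_image (invCoord_injective g)
      (fun z hz => hB z (hs'.trans_lt hz.1) (hz.2.trans_le ht'))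
      (fun z hz => ratEval_invCoord hz) (fun y z _ => fiberMult_invCoord hd g y z)
      fun y z hz hyz => ?_
    rw [← hm s' t' hs' hst' ht' y z hz.1 hz.2 hyz]
  -- If the inner disk contains 0, inversion exchanges the two ends, so thin annuli abutting the new
  -- inner end come from those abutting the old outer end; this is why `AnnulusBound` speaks of all
  -- subannuli. Otherwise the outer radius is cut down to at most `‖c‖`, and inversion rescales the
  -- annulus by `‖c‖ ^ 2` while keeping its orientation.
  rcases le_or_gt ‖c‖ s with hc | hc
  · have ht := hs.trans hst
    refine h g t⁻¹ s⁻¹ m (inv_pos.2 ht) ((inv_lt_inv₀ ht hs).2 hst) fun r hr hrs => ?_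
    have hr0 := (inv_pos.2 ht).trans hr
    have hrs' : s ≤ r⁻¹ := (le_inv_comm₀ hs hr0).2 hrs
    rw [image_invCoord_annulus_of_le hc ht hr0 hrs']
    exact key _ _ hrs' (inv_lt_of_inv_lt₀ ht hr) le_rfl
  · have hc0 := hs.trans hc
    have hc2 : 0 < ‖c‖ ^ 2 := by positivity
    refine h (g + c⁻¹) (s / ‖c‖ ^ 2) (min t ‖c‖ / ‖c‖ ^ 2) m (by positivity)
      (div_lt_div_of_pos_right (lt_min hst hc) hc2) fun r hr hrt => ?_
    have e : r = r * ‖c‖ ^ 2 / ‖c‖ ^ 2 := by field_simp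
    have hrt' : r * ‖c‖ ^ 2 ≤ min t ‖c‖ := (le_div_iff₀ hc2).1 hrt
    rw [e, image_invCoord_annulus_of_lt (norm_pos_iff.1 hc0) (hrt'.trans (min_le_right _ _))]
    exact key _ _ le_rfl ((div_lt_iff₀ hc2).1 hr) (hrt'.trans (min_le_left _ _))

variable [IsAlgClosed K]

theorem exists_disk_of_finite {φ : RatFunc K} {g : K} {d : ℕ} (hd : 2 ≤ d) (hφ : ratDegree φ = d)
    (hγ : ratEval φ (OnePoint.some g) = OnePoint.some g)
    (hpos : 0 < ‖multiplier φ (OnePoint.some g)‖)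
    (hchar : ∀ n : ℕ, 0 < n → n ≤ d → (n : K) ≠ 0)
    (h : DegreeBound φ ‖multiplier φ (OnePoint.some g)‖ d) :
    ∃ U : Set (OnePoint K), IsDisk U ∧ OnePoint.some g ∈ U ∧ Set.MapsTo (ratEval φ) U U ∧
      Set.InjOn (ratEval φ) U ∧ (∀ x ∈ U, Attracts φ (OnePoint.some g) x) ∧
      ∃ c : OnePoint K, IsCriticalPoint φ c ∧ ratEval φ c ∈ U ∧
        StrictlyAttracts φ (OnePoint.some g) (ratEval φ c) := by
  have hd0 : 0 < ratDegree φ := by omega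
  obtain ⟨hq, hpq⟩ := eval_of_ratEval_eq hγ
  have hA : (invNum φ g).natDegree = ratDegree φ := by
    refine le_antisymm (natDegree_reflect_le_of_le ?_) (le_natDegree_of_ne_zero ?_)
    · rw [natDegree_taylor]
      exact natDegree_denom_le φ
    · rwa [coeff_invNum]
  have hB : (invDenom φ g).natDegree = ratDegree φ - 1 := by
    refine le_antisymm ?_ (le_natDegree_of_ne_zero ?_)
    · have h1 : (invDenom φ g).natDegree ≤ ratDegree φ := by
        refine natDegree_reflect_le_of_le ?_
        rw [natDegree_taylor]
        exact natDegree_num_sub_le φ g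
      refine Nat.le_sub_one_of_lt (h1.lt_of_ne fun h2 => ?_)
      have h3 := coeff_invDenom φ g
      rw [hpq, sub_self, ← h2, coeff_natDegree, leadingCoeff_eq_zero] at h3
      rw [h3, natDegree_zero] at h2
      omega
    · rw [coeff_pred_invDenom hd0 hγ]
      exact mul_ne_zero (norm_pos_iff.1 hpos) hq
  have hAB := isCoprime_invNum_invDenom hd0 g
  refine exists_disk_of_coordinate (L := ‖multiplier φ (OnePoint.some g)‖)
    (invCoord_injective g) (invCoord_ne g) hγ (fun z hz => ratEval_invCoord hz)
    (fun V hV hg => exists_forall_invCoord_mem hV hg)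
    (fun a ρ hρ => isDisk_insert_image_invCoord g a hρ)
    (fun v hv hv' => isCriticalPoint_of_coordinate (fun z hz => ratEval_invCoord hz)
      (fiberMult_invCoord hd0 g) hAB (by omega) hv hv')
    (annulusBound_invNum_invDenom hd0 g h) hd (hA.trans hφ) (by omega) hAB hchar ?_
  rw [leadingCoeff, leadingCoeff, hA, hB, coeff_invNum, coeff_pred_invDenom hd0 hγ, norm_mul,
    mul_div_cancel_right₀ _ (norm_ne_zero_iff.2 hq)]

end Finite

end BerkDyn

end

theorem theorem4p1 {K : Type*} [NontriviallyNormedField K] [IsUltrametricDist K]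
    [CompleteSpace K] [IsAlgClosed K] (d : ℕ) (hd : 2 ≤ d)
    (hchar : ringChar K = 0 ∨ d < ringChar K)
    (φ : RatFunc K) (hφ : BerkDyn.ratDegree φ = d)
    (γ : OnePoint K) (hγ : BerkDyn.ratEval φ γ = γ)
    (hpos : 0 < ‖BerkDyn.multiplier φ γ‖)
    (hmult : ∀ (ζ : BerkDyn.BerkP1 K) (v : Set (BerkDyn.BerkP1 K)), BerkDyn.IsDirection ζ v →
      ∀ m : ℕ, BerkDyn.HasDirectionalDegree φ ζ v m →
        ‖BerkDyn.multiplier φ γ‖ < ‖(m : K)‖ ^ d) :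
    ∃ U : Set (OnePoint K), BerkDyn.IsDisk U ∧ γ ∈ U ∧
      Set.MapsTo (BerkDyn.ratEval φ) U U ∧ Set.InjOn (BerkDyn.ratEval φ) U ∧
      (∀ x ∈ U, BerkDyn.Attracts φ γ x) ∧
      ∃ c : OnePoint K, BerkDyn.IsCriticalPoint φ c ∧ BerkDyn.ratEval φ c ∈ U ∧
        BerkDyn.StrictlyAttracts φ γ (BerkDyn.ratEval φ c) := by
  have hchar' : ∀ n : ℕ, 0 < n → n ≤ d → (n : K) ≠ 0 := by
    intro n hn hnd h0
    have hdvd := (ringChar.spec K n).1 h0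
    rcases hchar with h | h
    · rw [h, zero_dvd_iff] at hdvd
      omega
    · have := Nat.le_of_dvd hn hdvd
      omega
  have hbound : BerkDyn.DegreeBound φ ‖BerkDyn.multiplier φ γ‖ d := by
    intro c s t m hs hst h
    obtain ⟨ζ, v, hv, hm⟩ := BerkDyn.exists_direction_of_mapsWithMult hs hst h
    exact hmult ζ v hv m hm
  induction γ using OnePoint.rec with
  | infty => exact BerkDyn.exists_disk_of_infty hd hφ hγ hpos hchar' hbound
  | coe g => exact BerkDyn.exists_disk_of_finite hd hφ hγ hpos hchar' hbound
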